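/- Let $d\in\mathbb R\setminus\{0\}$ and $f_0,\zeta,\mu\in\mathbb R$, and let $V:\mathbb R\to\mathbb R$ be $2\pi$-periodic and continuously differentiable (A1). For $\epsilon\in\mathbb R$ consider, for $u\in H^2_{\rm per}([-\pi,\pi],\mathbb C)$, the equation $$-d u''+\mathrm i\epsilon V(x)u'+(\zeta-\mathrm i\mu)u-|u|^2u+\mathrm i f_0=0, \qquad (1_\epsilon)$$ and, for $u=u_1+\mathrm i u_2$, the operator $$\widetilde L_{u,\epsilon}=JA_u-(\mu-\epsilon V(x)\partial_x),\quad J=\begin{pmatrix}0&1\\-1&0\end{pmatrix},\quad A_u=\begin{pmatrix}-d\partial_x^2+\zeta-(3u_1^2+u_2^2)&-2u_1u_2\\-2u_1u_2&-d\partial_x^2+\zeta-(u_1^2+3u_2^2)\end{pmatrix}$$ in $L^2([-\pi,\pi],\mathbb C)^2$ with domain $H^2_{\rm per}([-\pi,\pi],\mathbb C)^2$. A solution $u$ of $(1_\epsilon)$ is called spectrally stable if $\operatorname{Re}\lambda\le0$ for all eigenvalues $\lambda$ of $\widetilde L_{u,\epsilon}$, and spectrally unstable if $\operatorname{Re}\lambda>0$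 for some eigenvalue $\lambda$. Let $u_0\in H^2_{\rm per}$ be a non-constant solution of $(1_0)$ which is non-degenerate: the kernel in $H^2_{\rm per}$ of the real-linear operator $L_{u_0}\varphi=-d\varphi''+(\zeta-\mathrm i\mu-2|u_0|^2)\varphi-u_0^2\bar\varphi$ is $\operatorname{span}_{\mathbb R}\{u_0'\}$. Assume (A2): $0$ is an algebraically simple eigenvalue of $\widetilde L_{u_0,0}$, and there is $\xi>0$ with $\sigma(\widetilde L_{u_0,0})\subset\{\operatorname{Re}z\le-\xi\}\cup\{0\}$. Let $\phi_0^*\in H^2_{\rm per}$ lie in the kernel of the adjoint of $L_{u_0}$ with respect to the real inner product $\operatorname{Re}\int_{-\pi}^{\pi} f\bar g\,dx$, normalized by $$\int_{-\pi}^{\pi}\boldsymbol u_0'\cdot J\boldsymbol\phi_0^*\,dx=1,$$ where bold letters denote the vectors of real and imaginary parts. Let $\sigma_0\in\mathbb R$ be a simple zero of $$V_{\rm eff}(\sigma)=\operatorname{Re}\int_{-\pi}^{\pi}\mathrm i V(x+\sigma)u_0'\overline{\phi_0^*}\,dx,$$ that is, $V_{\rm eff}(\sigma_0)=0\ne V_{\rm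 eff}'(\sigma_0)$. Then $$V_{\rm eff}'(\sigma_0)=\operatorname{Re}\int_{-\pi}^{\pi}\mathrm i V'(x+\sigma_0)u_0'\overline{\phi_0^*}\,dx=\langle V'(\cdot+\sigma_0)\boldsymbol u_0',J\boldsymbol\phi_0^*\rangle_{L^2}\ne0 .$$ Moreover, for some $r>0$ there is a curve $(-r,r)\ni\epsilon\mapsto u(\epsilon)\in H^2_{\rm per}$, continuous in $H^2$, of solutions $u(\epsilon)$ of $(1_\epsilon)$ with $u(0)=u_0(\cdot-\sigma_0)$ and $\|u(\epsilon)-u_0(\cdot-\sigma_0)\|_{H^2}\le C|\epsilon|$ for a constant $C$. For every $H^2$-continuous curve $(-r,r)\ni\epsilon\mapsto u(\epsilon)$ (with any $r>0$) of solutions of $(1_\epsilon)$ with $u(0)=u_0(\cdot-\sigma_0)$ there is $\epsilon_0\in(0,r]$ such that for all $\epsilon\in(-\epsilon_0,\epsilon_0)$ the solution $u(\epsilon)$ is spectrally stable if $V_{\rm eff}'(\sigma_0)\,\epsilon>0$ and spectrally unstable if $V_{\rm eff}'(\sigma_0)\,\epsilon<0$. -/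

import Mathlib

open MeasureTheory Filter Topology Set
open scoped Real NNReal Matrix

noncomputable section

namespace LLE

/-- Lebesgue measure on one period `(-π, π]`; `L²([-π,π])` refers to this measure. -/
def periodMeasure : Measure ℝ := volume.restrict (Ioc (-π) π)

/-- The periodic Sobolev space `H²_per([-π,π], E)`, elements being represented by their unique
continuous `2π`-periodic extension to `ℝ`: the function is `C¹` and its derivative is the integral
of a function in `L²` (which is then, almost everywhere, the second derivative). -/
def MemH2per {E : Type*} [NormedAddCommGroup E] [NormedSpace ℝ E] (u : ℝ → E) : Prop :=
  Function.Periodic u (2 * π) ∧ ContDiff ℝ 1 u ∧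
    ∃ g : ℝ → E, MemLp g 2 periodMeasure ∧
      ∀ x ∈ Icc (-π) π, deriv u x = deriv u (-π) + ∫ t in (-π)..x, g t

/-- The norm of `H²([-π,π], ℂ)`. -/
def H2norm (u : ℝ → ℂ) : ℝ :=
  Real.sqrt ((∫ x in (-π)..π, ‖u x‖ ^ 2) + (∫ x in (-π)..π, ‖deriv u x‖ ^ 2)
    + ∫ x in (-π)..π, ‖deriv (deriv u) x‖ ^ 2)

/-- `u ∈ H²_per` solves
`-d u'' + i ε V(x) u' + (ζ - i μ) u - |u|² u + i f₀ = 0`. -/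
def IsStationarySolution (d f₀ ζ μ ε : ℝ) (V : ℝ → ℝ) (u : ℝ → ℂ) : Prop :=
  MemH2per u ∧ ∀ᵐ x ∂periodMeasure,
    -(d : ℂ) * deriv (deriv u) x + Complex.I * ε * V x * deriv u x
      + ((ζ : ℂ) - Complex.I * μ) * u x - ((‖u x‖ ^ 2 : ℝ) : ℂ) * u x + Complex.I * f₀ = 0

/-- `L_u φ = -d φ'' + (ζ - i μ - 2|u|²) φ - u² φ̄`. -/
def complexLinearization (d ζ μ : ℝ) (u φ : ℝ → ℂ) (x : ℝ) : ℂ :=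
  -(d : ℂ) * deriv (deriv φ) x
    + ((ζ : ℂ) - Complex.I * μ - 2 * ((‖u x‖ ^ 2 : ℝ) : ℂ)) * φ x
    - u x ^ 2 * (starRingEnd ℂ) (φ x)

/-- A non-constant function `u` is non-degenerate if the kernel of `L_u` on `H²_per` is the real
span of `u'`. -/
def IsNondegenerate (d ζ μ : ℝ) (u : ℝ → ℂ) : Prop :=
  (¬ ∃ c : ℂ, ∀ x, u x = c) ∧
    {φ : ℝ → ℂ | MemH2per φ ∧ complexLinearization d ζ μ u φ =ᵐ[periodMeasure] 0}
      = {φ : ℝ → ℂ | ∃ c : ℝ, φ = c • deriv u}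

/-- `φ` lies in the kernel of the adjoint of `L_u`, i.e. it is orthogonal to the range of `L_u`
for the real inner product `⟨f, g⟩ = Re ∫ f ḡ` of `L²([-π,π], ℂ)`. -/
def MemAdjointKernel (d ζ μ : ℝ) (u φ : ℝ → ℂ) : Prop :=
  MemH2per φ ∧ ∀ ψ : ℝ → ℂ, MemH2per ψ →
    (∫ x in (-π)..π, complexLinearization d ζ μ u ψ x * (starRingEnd ℂ) (φ x)).re = 0

/-- The matrix `J`. -/
def matJ (R : Type*) [Ring R] : Matrix (Fin 2) (Fin 2) R := !![0, 1; -1, 0]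

/-- The identification of `z = z₁ + i z₂` with the vector `(z₁, z₂)`. -/
def toVec (z : ℂ) : Fin 2 → ℝ := ![z.re, z.im]

/-- The pairing `⟨W 𝐮, J 𝛗⟩_{L²} = ∫ W(x) 𝐮(x) · J 𝛗(x) dx` for a real weight `W`. -/
def pairingJ (W : ℝ → ℝ) (u φ : ℝ → ℂ) : ℝ :=
  ∫ x in (-π)..π, (W x • toVec (u x)) ⬝ᵥ (matJ ℝ *ᵥ toVec (φ x))

/-- `Re ∫ i W(x) u(x) φ̄(x) dx`. -/
def pairingI (W : ℝ → ℝ) (u φ : ℝ → ℂ) : ℝ :=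
  (∫ x in (-π)..π, Complex.I * W x * u x * (starRingEnd ℂ) (φ x)).re

/-- The effective potential `V_eff(σ) = Re ∫ i V(x + σ) u₀'(x) φ̄(x) dx`. -/
def Veff (V : ℝ → ℝ) (u₀ φ : ℝ → ℂ) (σ : ℝ) : ℝ :=
  pairingI (fun x => V (x + σ)) (deriv u₀) φ

/-- The nonlinear potential in `A_u`, for `u₁ + i u₂ = z`. -/
def matPot (z : ℂ) : Matrix (Fin 2) (Fin 2) ℂ :=
  !![((3 * z.re ^ 2 + z.im ^ 2 : ℝ) : ℂ), ((2 * z.re * z.im : ℝ) : ℂ);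
     ((2 * z.re * z.im : ℝ) : ℂ), ((z.re ^ 2 + 3 * z.im ^ 2 : ℝ) : ℂ)]

/-- `A_u v = -d v'' + ζ v - (nonlinear potential) v`. -/
def opA (d ζ : ℝ) (u : ℝ → ℂ) (v : ℝ → Fin 2 → ℂ) (x : ℝ) : Fin 2 → ℂ :=
  -(d : ℂ) • deriv (deriv v) x + (ζ : ℂ) • v x - matPot (u x) *ᵥ v x

/-- The linearization `L̃_{u,ε} = J A_u - (μ - ε V(x) ∂ₓ)`, an operator in
`L²([-π,π], ℂ) × L²([-π,π], ℂ)` with domain `H²_per × H²_per`. -/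
def linearization (d ζ μ ε : ℝ) (V : ℝ → ℝ) (u : ℝ → ℂ) (v : ℝ → Fin 2 → ℂ) (x : ℝ) :
    Fin 2 → ℂ :=
  matJ ℂ *ᵥ opA d ζ u v x - ((μ : ℂ) • v x - ((ε * V x : ℝ) : ℂ) • deriv v x)

/-! Spectral notions for an operator `T` in `L² × L²` with domain `H²_per × H²_per`. -/

/-- `z` is an eigenvalue of `T`. -/
def IsEigenvalue (T : (ℝ → Fin 2 → ℂ) → ℝ → Fin 2 → ℂ) (z : ℂ) : Prop :=
  ∃ v : ℝ → Fin 2 → ℂ, v ≠ 0 ∧ MemH2per v ∧ T v =ᵐ[periodMeasure] z • v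

/-- `v` lies in the kernel of `(T - z)ⁿ`. -/
def IsGenEigenvector (T : (ℝ → Fin 2 → ℂ) → ℝ → Fin 2 → ℂ) (z : ℂ) :
    ℕ → (ℝ → Fin 2 → ℂ) → Prop
  | 0, v => v = 0
  | n + 1, v => MemH2per v ∧
      ∃ w, IsGenEigenvector T z n w ∧ T v - z • v =ᵐ[periodMeasure] w

/-- `z` is an algebraically simple eigenvalue: its generalized eigenspace `⋃ₙ ker (T - z)ⁿ` is
one-dimensional over `ℂ`. -/
def IsAlgSimpleEigenvalue (T : (ℝ → Fin 2 → ℂ) → ℝ → Fin 2 → ℂ) (z : ℂ) : Prop :=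
  ∃ w : ℝ → Fin 2 → ℂ, w ≠ 0 ∧
    {v | ∃ n, IsGenEigenvector T z n v} = {v | ∃ c : ℂ, v = c • w}

/-- The resolvent set: `z - T : H²_per × H²_per → L² × L²` is bijective with bounded inverse
as an operator in `L² × L²`. -/
def resolventSetL2 (T : (ℝ → Fin 2 → ℂ) → ℝ → Fin 2 → ℂ) : Set ℂ :=
  {z | (∀ F : ℝ → Fin 2 → ℂ, MemLp F 2 periodMeasure →
          ∃! v : ℝ → Fin 2 → ℂ, MemH2per v ∧ z • v - T v =ᵐ[periodMeasure] F) ∧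
        ∃ C : ℝ≥0, ∀ v : ℝ → Fin 2 → ℂ, MemH2per v →
          eLpNorm v 2 periodMeasure ≤ C * eLpNorm (z • v - T v) 2 periodMeasure}

/-- The spectrum in `L² × L²`. -/
def spectrumL2 (T : (ℝ → Fin 2 → ℂ) → ℝ → Fin 2 → ℂ) : Set ℂ := (resolventSetL2 T)ᶜ

def IsSpectrallyStable (T : (ℝ → Fin 2 → ℂ) → ℝ → Fin 2 → ℂ) : Prop :=
  ∀ z : ℂ, IsEigenvalue T z → z.re ≤ 0

def IsSpectrallyUnstable (T : (ℝ → Fin 2 → ℂ) → ℝ → Fin 2 → ℂ) : Prop :=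
  ∃ z : ℂ, IsEigenvalue T z ∧ 0 < z.re

/-- Assumption (A1): `V` is `2π`-periodic and continuously differentiable. -/
def AssumptionA1 (V : ℝ → ℝ) : Prop := Function.Periodic V (2 * π) ∧ ContDiff ℝ 1 V

/-- Assumption (A2) for an operator `T`: zero is an algebraically simple eigenvalue and the rest of
the spectrum lies in some half-plane `Re z ≤ -ξ` with `ξ > 0`. -/
def AssumptionA2 (T : (ℝ → Fin 2 → ℂ) → ℝ → Fin 2 → ℂ) : Prop :=
  IsAlgSimpleEigenvalue T 0 ∧
    ∃ ξ : ℝ, 0 < ξ ∧ spectrumL2 T ⊆ {z : ℂ | z.re ≤ -ξ} ∪ {0}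

/-- `ε ↦ u ε` is an `H²`-continuous curve of stationary solutions on `(-r, r)` starting, at
`ε = 0`, from `w`. -/
def IsSolutionBranch (d f₀ ζ μ : ℝ) (V : ℝ → ℝ) (w : ℝ → ℂ) (r : ℝ) (u : ℝ → ℝ → ℂ) : Prop :=
  u 0 = w ∧
    (∀ ε ∈ Ioo (-r) r, IsStationarySolution d f₀ ζ μ ε V (u ε)) ∧
    ∀ ε ∈ Ioo (-r) r, Tendsto (fun ε' => H2norm (u ε' - u ε)) (𝓝 ε) (𝓝 0)

end LLE

end

noncomputable section

namespace LLE

instance factTwoPiPos : Fact (0 < 2 * π) := ⟨Real.two_pi_pos⟩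

/-- Continuous `2π`-periodic functions with values in `E`, with the supremum norm. -/
abbrev Per (E : Type*) [TopologicalSpace E] := C(AddCircle (2 * π), E)

namespace Per

section Basic

variable {E : Type*} [TopologicalSpace E]

/-- The periodic function on the line underlying a function on the circle. -/
def fn (f : Per E) (x : ℝ) : E := f (x : AddCircle (2 * π))

lemma continuous_fn (f : Per E) : Continuous f.fn :=
  f.continuous.comp (AddCircle.continuous_mk' _)

lemma periodic_fn (f : Per E) : Function.Periodic f.fn (2 * π) := fun x => by
  simp only [fn, AddCircle.coe_add_period]

lemma ext_fn {f g : Per E} (h : ∀ x, f.fn x = g.fn x) : f = g := by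
  ext θ
  induction θ using QuotientAddGroup.induction_on with
  | H x => exact h x

lemma fn_injective : Function.Injective (fn : Per E → ℝ → E) :=
  fun _ _ h => ext_fn fun x => congrFun h x

/-- A continuous periodic function on the line as a function on the circle. -/
def of (f : ℝ → E) (hc : Continuous f) (hp : Function.Periodic f (2 * π)) : Per E where
  toFun := hp.lift
  continuous_toFun := by
    refine continuous_coinduced_dom.mpr ?_
    exact hc

@[simp] lemma of_fn (f : ℝ → E) (hc : Continuous f) (hp : Function.Periodic f (2 * π)) :
    (of f hc hp).fn = f := rfl

/-- Translation of a periodic function. -/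
def translate (s : ℝ) (f : Per E) : Per E :=
  f.comp ⟨fun θ => θ + (s : AddCircle (2 * π)), by fun_prop⟩

@[simp] lemma translate_fn (s : ℝ) (f : Per E) (x : ℝ) : (translate s f).fn x = f.fn (x + s) := by
  simp [translate, fn]

lemma continuous_translate : Continuous fun p : ℝ × Per E => translate p.1 p.2 := by
  have h : Continuous fun s : ℝ =>
      (⟨fun θ => θ + (s : AddCircle (2 * π)), by fun_prop⟩ :
        C(AddCircle (2 * π), AddCircle (2 * π))) := by
    refine ContinuousMap.continuous_of_continuous_uncurry _ ?_
    have : Continuous fun p : ℝ × AddCircle (2 * π) => p.2 + (p.1 : AddCircle (2 * π)) :=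
      continuous_snd.add ((AddCircle.continuous_mk' _).comp continuous_fst)
    exact this
  exact continuous_snd.compCM (h.comp continuous_fst)

end Basic

section Norm

variable {E : Type*} [NormedAddCommGroup E]

lemma norm_fn_le (f : Per E) (x : ℝ) : ‖f.fn x‖ ≤ ‖f‖ := f.norm_coe_le_norm _

lemma norm_le_of_fn {f : Per E} {C : ℝ} (hC : 0 ≤ C) (h : ∀ x, ‖f.fn x‖ ≤ C) : ‖f‖ ≤ C := by
  refine (ContinuousMap.norm_le _ hC).2 fun θ => ?_
  induction θ using QuotientAddGroup.induction_on with
  | H x => exact h x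

@[simp] lemma add_fn (f g : Per E) (x : ℝ) : (f + g).fn x = f.fn x + g.fn x := rfl
@[simp] lemma sub_fn (f g : Per E) (x : ℝ) : (f - g).fn x = f.fn x - g.fn x := rfl
@[simp] lemma neg_fn (f : Per E) (x : ℝ) : (-f).fn x = -f.fn x := rfl
@[simp] lemma zero_fn (x : ℝ) : (0 : Per E).fn x = 0 := rfl
@[simp] lemma smul_fn {𝕜 : Type*} [NormedField 𝕜] [NormedSpace 𝕜 E] (c : 𝕜) (f : Per E) (x : ℝ) :
    (c • f).fn x = c • f.fn x := rfl

end Norm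

section Relax

variable (𝕜 : Type*) [RCLike 𝕜] {E : Type*} [NormedAddCommGroup E] [NormedSpace 𝕜 E]
  [NormedSpace ℝ E] [SMulCommClass ℝ 𝕜 E]

/-- The periodic solution `y` of `y' + a y = f`. -/
def relax (a : ℝ) : Per E →L[𝕜] Per E :=
  LinearMap.mkContinuous
    { toFun := fun f =>
        ⟨fun θ => (1 - Real.exp (-(2 * π * a)))⁻¹ • ∫ t in (0 : ℝ)..2 * π,
          Real.exp (-(a * t)) • f (θ - (t : AddCircle (2 * π))), by
          refine Continuous.const_smul ?_ _
          refine intervalIntegral.continuous_parametric_intervalIntegral_of_continuous' ?_ _ _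
          refine Continuous.smul (by fun_prop) (f.continuous.comp ?_)
          exact continuous_fst.sub ((AddCircle.continuous_mk' _).comp continuous_snd)⟩
      map_add' := fun f g => by
        ext θ
        have hc : ∀ f : Per E, IntervalIntegrable (fun t : ℝ => Real.exp (-(a * t)) •
            f (θ - (t : AddCircle (2 * π)))) volume 0 (2 * π) := fun f => by
          refine Continuous.intervalIntegrable (Continuous.smul (by fun_prop)
            (f.continuous.comp ?_)) _ _
          exact continuous_const.sub (AddCircle.continuous_mk' _)
        simp only [ContinuousMap.add_apply, ContinuousMap.coe_mk, smul_add]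
        rw [intervalIntegral.integral_add (hc f) (hc g), smul_add]
      map_smul' := fun c f => by
        ext θ
        simp only [ContinuousMap.smul_apply, ContinuousMap.coe_mk, RingHom.id_apply]
        have h : ∀ t : ℝ, Real.exp (-(a * t)) • c • f (θ - (t : AddCircle (2 * π))) =
            c • Real.exp (-(a * t)) • f (θ - (t : AddCircle (2 * π))) := fun t => smul_comm _ _ _
        simp only [h]
        rw [intervalIntegral.integral_smul, smul_comm] }
    (|(1 - Real.exp (-(2 * π * a)))⁻¹| * (Real.exp (2 * π * |a|) * (2 * π)))
    fun f => by
      refine (ContinuousMap.norm_le _ (by positivity)).2 fun θ => ?_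
      simp only [LinearMap.coe_mk, AddHom.coe_mk, ContinuousMap.coe_mk]
      rw [norm_smul, Real.norm_eq_abs, mul_assoc |_| _ ‖f‖]
      refine mul_le_mul_of_nonneg_left ?_ (abs_nonneg _)
      have := intervalIntegral.norm_integral_le_of_norm_le_const (a := 0) (b := 2 * π)
        (f := fun t : ℝ => Real.exp (-(a * t)) • f (θ - (t : AddCircle (2 * π))))
        (C := Real.exp (2 * π * |a|) * ‖f‖) (fun t ht => by
          rw [uIoc_of_le Real.two_pi_pos.le] at ht
          rw [norm_smul, Real.norm_eq_abs, Real.abs_exp]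
          refine mul_le_mul ?_ (f.norm_coe_le_norm _) (norm_nonneg _) (Real.exp_pos _).le
          refine Real.exp_le_exp.2 ?_
          calc -(a * t) ≤ |a * t| := neg_le_abs _
            _ = t * |a| := by rw [abs_mul, abs_of_pos ht.1, mul_comm]
            _ ≤ 2 * π * |a| := mul_le_mul_of_nonneg_right ht.2 (abs_nonneg _))
      rw [sub_zero, abs_of_pos Real.two_pi_pos] at this
      linarith

lemma relax_fn (a : ℝ) (f : Per E) (x : ℝ) :
    (relax 𝕜 a f).fn x = (1 - Real.exp (-(2 * π * a)))⁻¹ •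
      Real.exp (-(a * x)) • ∫ t in (x - 2 * π)..x, Real.exp (a * t) • f.fn t := by
  have h := intervalIntegral.integral_comp_sub_left (a := 0) (b := 2 * π)
    (fun t : ℝ => Real.exp (-(a * (x - t))) • f.fn t) x
  simp only [sub_sub_cancel, sub_zero] at h
  have h1 : (relax 𝕜 a f).fn x = (1 - Real.exp (-(2 * π * a)))⁻¹ •
      ∫ t in (0 : ℝ)..2 * π, Real.exp (-(a * t)) • f.fn (x - t) := rfl
  rw [h1, h, ← intervalIntegral.integral_smul (Real.exp (-(a * x)))]
  refine congrArg _ (intervalIntegral.integral_congr fun t _ => ?_)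
  rw [smul_smul, ← Real.exp_add]
  ring_nf

variable [CompleteSpace E]

lemma one_sub_exp_ne_zero {a : ℝ} (ha : a ≠ 0) : 1 - Real.exp (-(2 * π * a)) ≠ 0 := by
  rw [sub_ne_zero, ne_comm, Ne, Real.exp_eq_one_iff]
  have := Real.pi_ne_zero
  simp [this, ha]

lemma hasDerivAt_relax {a : ℝ} (ha : a ≠ 0) (f : Per E) (x : ℝ) :
    HasDerivAt (relax 𝕜 a f).fn (f.fn x - a • (relax 𝕜 a f).fn x) x := by
  have hc : Continuous fun t : ℝ => Real.exp (a * t) • f.fn t :=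
    Continuous.smul (by fun_prop) f.continuous_fn
  have h1 : ∀ y, ∫ t in (y - 2 * π)..y, Real.exp (a * t) • f.fn t =
      (∫ t in (0 : ℝ)..y, Real.exp (a * t) • f.fn t) -
        ∫ t in (0 : ℝ)..(y - 2 * π), Real.exp (a * t) • f.fn t := fun y =>
    (intervalIntegral.integral_interval_sub_left (hc.intervalIntegrable _ _)
      (hc.intervalIntegrable _ _)).symm
  have h2 : HasDerivAt (fun y : ℝ => ∫ t in (y - 2 * π)..y, Real.exp (a * t) • f.fn t)
      (Real.exp (a * x) • f.fn x - Real.exp (a * (x - 2 * π)) • f.fn (x - 2 * π)) x := by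
    simp only [h1]
    refine (hc.integral_hasStrictDerivAt 0 x).hasDerivAt.sub ?_
    have := (hc.integral_hasStrictDerivAt 0 (x - 2 * π)).hasDerivAt
    exact this.comp_sub_const x (2 * π)
  have h3 : HasDerivAt (fun y : ℝ => Real.exp (-(a * y))) (Real.exp (-(a * x)) * -(a * 1)) x :=
    (((hasDerivAt_id x).const_mul a).neg).exp
  have h4 := (h3.smul h2).const_smul (1 - Real.exp (-(2 * π * a)))⁻¹
  have h5 : (relax 𝕜 a f).fn = fun y => (1 - Real.exp (-(2 * π * a)))⁻¹ •
      Real.exp (-(a * y)) • ∫ t in (y - 2 * π)..y, Real.exp (a * t) • f.fn t :=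
    funext (relax_fn 𝕜 a f)
  rw [h5]
  refine h4.congr_deriv ?_
  have hp : f.fn (x - 2 * π) = f.fn x := f.periodic_fn.sub_eq x
  have hne := one_sub_exp_ne_zero ha
  rw [hp, ← sub_smul, smul_smul, smul_add, smul_smul]
  have e1 : Real.exp (-(a * x)) * (Real.exp (a * x) - Real.exp (a * (x - 2 * π)))
      = 1 - Real.exp (-(2 * π * a)) := by
    rw [mul_sub, ← Real.exp_add, ← Real.exp_add]
    ring_nf
    simp
  rw [e1, inv_mul_cancel₀ hne, one_smul]
  simp only [smul_smul, mul_one, sub_eq_add_neg, ← neg_smul]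
  congr 2
  ring

lemma relax_of_hasDerivAt {a : ℝ} (ha : a ≠ 0) {y f : Per E}
    (h : ∀ x, HasDerivAt y.fn (f.fn x - a • y.fn x) x) : relax 𝕜 a f = y := by
  refine ext_fn fun x => ?_
  have h1 : ∀ t, HasDerivAt (fun t => Real.exp (a * t) • y.fn t) (Real.exp (a * t) • f.fn t) t := by
    intro t
    have h3 : HasDerivAt (fun t : ℝ => Real.exp (a * t)) (Real.exp (a * t) * (a * 1)) t :=
      ((hasDerivAt_id t).const_mul a).exp
    refine (h3.smul (h t)).congr_deriv ?_
    rw [smul_sub, smul_smul, mul_one, sub_add_cancel]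
  have hc : Continuous fun t : ℝ => Real.exp (a * t) • f.fn t :=
    Continuous.smul (by fun_prop) f.continuous_fn
  have hp : y.fn (x - 2 * π) = y.fn x := y.periodic_fn.sub_eq x
  rw [relax_fn, intervalIntegral.integral_eq_sub_of_hasDerivAt (fun t _ => h1 t)
    (hc.intervalIntegrable _ _), hp, ← sub_smul, smul_smul, smul_smul]
  have e1 : Real.exp (-(a * x)) * (Real.exp (a * x) - Real.exp (a * (x - 2 * π)))
      = 1 - Real.exp (-(2 * π * a)) := by
    rw [mul_sub, ← Real.exp_add, ← Real.exp_add]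
    ring_nf
    simp
  rw [mul_assoc, e1, inv_mul_cancel₀ (one_sub_exp_ne_zero ha), one_smul]

/-- The solution operator `g ↦ u` of `u - u'' = g` on periodic functions. -/
def K : Per E →L[𝕜] Per E := -(relax 𝕜 (-1) ∘L relax 𝕜 1)

/-- The operator `g ↦ u'`, where `u - u'' = g`. -/
def D : Per E →L[𝕜] Per E := K 𝕜 - relax 𝕜 1

lemma hasDerivAt_K (g : Per E) (x : ℝ) : HasDerivAt (K 𝕜 g).fn ((D 𝕜 g).fn x) x := by
  have h := (hasDerivAt_relax 𝕜 (a := -1) (by norm_num) (relax 𝕜 1 g) x).neg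
  refine h.congr_deriv ?_
  simp [D, K]
  abel

lemma hasDerivAt_D (g : Per E) (x : ℝ) : HasDerivAt (D 𝕜 g).fn ((K 𝕜 g - g).fn x) x := by
  have h := (hasDerivAt_K 𝕜 g x).sub (hasDerivAt_relax 𝕜 (a := 1) one_ne_zero g x)
  refine h.congr_deriv ?_
  simp [D]

lemma deriv_K (g : Per E) : deriv (K 𝕜 g).fn = (D 𝕜 g).fn :=
  funext fun x => (hasDerivAt_K 𝕜 g x).deriv

lemma deriv_deriv_K (g : Per E) : deriv (deriv (K 𝕜 g).fn) = (K 𝕜 g - g).fn := by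
  rw [deriv_K]
  exact funext fun x => (hasDerivAt_D 𝕜 g x).deriv

lemma K_of_hasDerivAt {u v w : Per E} (h1 : ∀ x, HasDerivAt u.fn (v.fn x) x)
    (h2 : ∀ x, HasDerivAt v.fn (w.fn x) x) : K 𝕜 (u - w) = u ∧ D 𝕜 (u - w) = v := by
  have e1 : relax 𝕜 1 (u - w) = u - v := by
    refine relax_of_hasDerivAt 𝕜 one_ne_zero fun x => ?_
    refine ((h1 x).sub (h2 x)).congr_deriv ?_
    simp
  have e2 : relax 𝕜 (-1) (-(u - v)) = u := by
    refine relax_of_hasDerivAt 𝕜 (by norm_num) fun x => ?_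
    refine (h1 x).congr_deriv ?_
    simp
  have e3 : K 𝕜 (u - w) = u := by
    rw [map_neg] at e2
    change -(relax 𝕜 (-1) (relax 𝕜 1 (u - w))) = u
    rw [e1]
    exact e2
  refine ⟨e3, ?_⟩
  simp [D, e3, e1]

lemma exists_eq_K {u v w : ℝ → E} (hu : Function.Periodic u (2 * π))
    (h1 : ∀ x, HasDerivAt u (v x) x) (h2 : ∀ x, HasDerivAt v (w x) x) (hw : Continuous w) :
    ∃ g : Per E, u = (K 𝕜 g).fn ∧ v = (D 𝕜 g).fn ∧ w = (K 𝕜 g - g).fn := by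
  have hv : Function.Periodic v (2 * π) := fun x => by
    have := (h1 (x + 2 * π)).comp_add_const x (2 * π)
    simp only [hu _] at this
    exact this.unique (h1 x)
  have hwp : Function.Periodic w (2 * π) := fun x => by
    have := (h2 (x + 2 * π)).comp_add_const x (2 * π)
    simp only [hv _] at this
    exact this.unique (h2 x)
  have cu : Continuous u := continuous_iff_continuousAt.2 fun x => (h1 x).continuousAt
  have cv : Continuous v := continuous_iff_continuousAt.2 fun x => (h2 x).continuousAt
  have := K_of_hasDerivAt 𝕜 (u := of u cu hu) (v := of v cv hv) (w := of w hw hwp) h1 h2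
  refine ⟨of u cu hu - of w hw hwp, ?_, ?_, ?_⟩
  · rw [this.1, of_fn]
  · rw [this.2, of_fn]
  · rw [this.1, sub_sub_cancel, of_fn]

lemma K_injective : Function.Injective (K 𝕜 : Per E →L[𝕜] Per E) := by
  refine (injective_iff_map_eq_zero _).2 fun g hg => ?_
  have h1 : ∀ x, (D 𝕜 g).fn x = 0 := fun x => by
    have := hasDerivAt_K 𝕜 g x
    rw [hg] at this
    exact this.unique (hasDerivAt_const x (0 : E))
  have h2 : ∀ x, (K 𝕜 g - g).fn x = 0 := fun x => by
    have := hasDerivAt_D 𝕜 g x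
    rw [show (D 𝕜 g).fn = fun _ => 0 from funext h1] at this
    exact this.unique (hasDerivAt_const x (0 : E))
  refine ext_fn fun x => ?_
  have := h2 x
  rw [hg] at this
  simpa using this

lemma lipschitz_K (g : Per E) (x y : ℝ) :
    ‖(K 𝕜 g).fn x - (K 𝕜 g).fn y‖ ≤ ‖D 𝕜 g‖ * |x - y| := by
  have := Convex.norm_image_sub_le_of_norm_hasDerivWithin_le (s := univ) (C := ‖D 𝕜 g‖)
    (f := (K 𝕜 g).fn) (f' := (D 𝕜 g).fn) (fun x _ => (hasDerivAt_K 𝕜 g x).hasDerivWithinAt)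
    (fun x _ => norm_fn_le _ x) convex_univ (mem_univ y) (mem_univ x)
  simpa using this

lemma lipschitz_D (g : Per E) (x y : ℝ) :
    ‖(D 𝕜 g).fn x - (D 𝕜 g).fn y‖ ≤ ‖K 𝕜 g - g‖ * |x - y| := by
  have := Convex.norm_image_sub_le_of_norm_hasDerivWithin_le (s := univ) (C := ‖K 𝕜 g - g‖)
    (f := (D 𝕜 g).fn) (f' := (K 𝕜 g - g).fn) (fun x _ => (hasDerivAt_D 𝕜 g x).hasDerivWithinAt)
    (fun x _ => norm_fn_le _ x) convex_univ (mem_univ y) (mem_univ x)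
  simpa using this

end Relax

end Per

namespace Per

section Compact

variable (𝕜 : Type*) [RCLike 𝕜] {E : Type*} [NormedAddCommGroup E] [NormedSpace 𝕜 E]
  [NormedSpace ℝ E] [SMulCommClass ℝ 𝕜 E] [CompleteSpace E] [ProperSpace E]

lemma isCompactOperator_K : IsCompactOperator (K 𝕜 : Per E →L[𝕜] Per E) := by
  have h0 := isCompactOperator_iff_isCompact_closure_image_closedBall
    (K 𝕜 : Per E →L[𝕜] Per E).toLinearMap (r := 1) one_pos
  refine h0.2 ?_
  let Φ := ContinuousMap.isometryEquivBoundedOfCompact (AddCircle (2 * π)) E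
  set A : Set (Per E) := (K 𝕜 : Per E →L[𝕜] Per E) '' Metric.closedBall 0 1 with hA
  have hcomp : IsCompact (closure (Φ '' A)) := by
    refine BoundedContinuousFunction.arzela_ascoli
      (Metric.closedBall (0 : E) ‖(K 𝕜 : Per E →L[𝕜] Per E)‖)
      (isCompact_closedBall _ _) (Φ '' A) ?_ ?_
    · rintro f θ ⟨_, ⟨g, hg, rfl⟩, rfl⟩
      rw [mem_closedBall_zero_iff] at hg ⊢
      calc ‖(K 𝕜 g) θ‖ ≤ ‖K 𝕜 g‖ := ContinuousMap.norm_coe_le_norm _ _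
        _ ≤ _ := (K 𝕜).le_of_opNorm_le_of_le le_rfl hg |>.trans (by simp)
    · intro θ₀
      induction θ₀ using QuotientAddGroup.induction_on with
      | H x₀ =>
      rw [Metric.equicontinuousAt_iff]
      intro ε hε
      set M := ‖(D 𝕜 : Per E →L[𝕜] Per E)‖ + 1 with hM
      have hM0 : 0 < M := by positivity
      refine ⟨ε / M, by positivity, ?_⟩
      intro θ hθ f
      obtain ⟨_, _, ⟨g, hg, rfl⟩, rfl⟩ := f
      rw [mem_closedBall_zero_iff] at hg
      obtain ⟨x, rfl, hx⟩ : ∃ x : ℝ, (x : AddCircle (2 * π)) = θ ∧ |x - x₀| < ε / M := by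
        rw [dist_eq_norm] at hθ
        obtain ⟨y, hy, hy'⟩ := QuotientAddGroup.norm_lt_iff.1 hθ
        refine ⟨y + x₀, ?_, by simpa using hy'⟩
        rw [AddCircle.coe_add]
        rw [hy]
        exact sub_add_cancel _ _
      have h1 : ‖D 𝕜 g‖ ≤ M := by
        refine ((D 𝕜).le_of_opNorm_le_of_le le_rfl hg).trans ?_
        rw [hM]; linarith
      have h2 := lipschitz_K 𝕜 g x x₀
      rw [dist_comm, dist_eq_norm]
      calc ‖(K 𝕜 g).fn x - (K 𝕜 g).fn x₀‖ ≤ M * |x - x₀| :=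
            h2.trans (mul_le_mul_of_nonneg_right h1 (abs_nonneg _))
        _ < M * (ε / M) := mul_lt_mul_of_pos_left hx hM0
        _ = ε := by field_simp
  have : closure A = Φ.symm '' closure (Φ '' A) := by
    have h := Φ.symm.toHomeomorph.image_closure (Φ '' A)
    have h' : Φ.symm.toHomeomorph '' (Φ '' A) = A := by
      rw [← image_comp]
      simp [Function.comp_def]
    rw [h'] at h
    exact h.symm
  change IsCompact (closure A)
  rw [this]
  exact hcomp.image Φ.symm.continuous

end Compact

section Mul

variable {𝕜 : Type*} [RCLike 𝕜] {E : Type*} [NormedAddCommGroup E] [NormedSpace 𝕜 E]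

/-- Pointwise application of an operator-valued periodic function. -/
def mulOp : Per (E →L[𝕜] E) →L[𝕜] Per E →L[𝕜] Per E :=
  LinearMap.mkContinuous₂
    (LinearMap.mk₂ 𝕜 (fun (m : Per (E →L[𝕜] E)) (f : Per E) => (⟨fun θ => m θ (f θ), by fun_prop⟩ : Per E))
      (fun m m' f => by ext; simp) (fun c m f => by ext; simp)
      (fun m f f' => by ext; simp) (fun c m f => by ext; simp)) 1
    (fun m f => by
      refine (ContinuousMap.norm_le _ (by positivity)).2 fun θ => ?_
      rw [one_mul]
      have h0 : (0 : ℝ) ≤ ‖m‖ := norm_nonneg m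
      exact ((m θ).le_opNorm _).trans (mul_le_mul (m.norm_coe_le_norm _) (f.norm_coe_le_norm _)
        (norm_nonneg _) h0))

end Mul

end Per

section Fredholm

variable {𝕜 X : Type*} [RCLike 𝕜] [NormedAddCommGroup X] [NormedSpace 𝕜 X]

lemma isUnit_of_compact_perturbation [CompleteSpace X] {U T : X →L[𝕜] X} (hU : IsUnit U) (hT : IsCompactOperator T)
    (hinj : ∀ x, (U + T) x = 0 → x = 0) : IsUnit (U + T) := by
  obtain ⟨W, rfl⟩ := hU
  have hc : IsCompactOperator ((↑W⁻¹ : X →L[𝕜] X) * T) := hT.clm_comp (↑W⁻¹ : X →L[𝕜] X)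
  have h := hc.hasEigenvalue_or_mem_resolventSet (μ := (-1 : 𝕜)) (by simp)
  have hfac : (W : X →L[𝕜] X) + T = W * (1 + (↑W⁻¹ : X →L[𝕜] X) * T) := by
    rw [mul_add, mul_one, ← mul_assoc, Units.mul_inv, one_mul]
  rcases h with h | h
  · exfalso
    obtain ⟨x, hx, hx0⟩ := h.exists_hasEigenvector
    refine hx0 (hinj x ?_)
    rw [Module.End.mem_eigenspace_iff] at hx
    rw [hfac]
    change (W : X →L[𝕜] X) (x + ((↑W⁻¹ : X →L[𝕜] X) * T) x) = 0
    have hx' : ((↑W⁻¹ : X →L[𝕜] X) * T) x = (-1 : 𝕜) • x := hx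
    rw [hx']
    simp
  · rw [spectrum.mem_resolventSet_iff] at h
    rw [hfac]
    refine W.isUnit.mul ?_
    rw [← IsUnit.neg_iff]
    convert h using 1
    simp
    abel

lemma exists_bound_of_isUnit {B : X →L[𝕜] X} (hB : IsUnit B) :
    ∃ C : ℝ, 0 < C ∧ ∀ᶠ B' in 𝓝 B, ∀ x, ‖x‖ ≤ C * ‖B' x‖ := by
  obtain ⟨W, rfl⟩ := hB
  set c := ‖(↑W⁻¹ : X →L[𝕜] X)‖ + 1 with hc
  have hc0 : 0 < c := by positivity
  refine ⟨2 * c, by positivity, ?_⟩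
  have hball : Metric.ball (W : X →L[𝕜] X) (1 / (2 * c)) ∈ 𝓝 (W : X →L[𝕜] X) :=
    Metric.ball_mem_nhds _ (by positivity)
  filter_upwards [hball] with B' hB' x
  rw [mem_ball_iff_norm] at hB'
  have h1 : x = (↑W⁻¹ : X →L[𝕜] X) (B' x - (B' - W) x) := by
    have : B' x - (B' - (W : X →L[𝕜] X)) x = (W : X →L[𝕜] X) x := by simp
    rw [this, ← mul_apply_eq_comp, Units.inv_mul, one_apply_eq_self]
  have h2 : ‖x‖ ≤ c * (‖B' x‖ + 1 / (2 * c) * ‖x‖) := by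
    calc ‖x‖ = ‖(↑W⁻¹ : X →L[𝕜] X) (B' x - (B' - W) x)‖ := by rw [← h1]
      _ ≤ ‖(↑W⁻¹ : X →L[𝕜] X)‖ * ‖B' x - (B' - W) x‖ := ContinuousLinearMap.le_opNorm _ _
      _ ≤ c * (‖B' x‖ + 1 / (2 * c) * ‖x‖) := by
        refine mul_le_mul (by rw [hc]; linarith) ?_ (norm_nonneg _) hc0.le
        refine (norm_sub_le _ _).trans (add_le_add le_rfl ?_)
        exact (ContinuousLinearMap.le_opNorm _ _).trans
          (mul_le_mul_of_nonneg_right hB'.le (norm_nonneg _))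
  have h3 : c * (‖B' x‖ + 1 / (2 * c) * ‖x‖) = c * ‖B' x‖ + ‖x‖ / 2 := by field_simp
  linarith

end Fredholm

section Regularity

variable {E : Type*} [NormedAddCommGroup E] [NormedSpace ℝ E]

lemma periodic_deriv_of_periodic {v : ℝ → E} {T : ℝ} (hv : Function.Periodic v T) :
    Function.Periodic (deriv v) T := fun x => by
  rw [← deriv_comp_add_const]
  simp only [hv _]

lemma MemH2per.continuous {v : ℝ → E} (hv : MemH2per v) : Continuous v := hv.2.1.continuous

lemma MemH2per.continuous_deriv {v : ℝ → E} (hv : MemH2per v) : Continuous (deriv v) :=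
  hv.2.1.continuous_deriv le_rfl

lemma MemH2per.periodic_deriv {v : ℝ → E} (hv : MemH2per v) :
    Function.Periodic (deriv v) (2 * π) := periodic_deriv_of_periodic hv.1

variable [CompleteSpace E]

instance : IsFiniteMeasure periodMeasure := by
  unfold periodMeasure
  infer_instance

lemma neg_pi_add_two_pi : -π + 2 * π = π := by ring

/-- A function in `H²_per` whose second derivative has a continuous representative is `C²`. -/
lemma MemH2per.exists_eq_K (𝕜 : Type*) [RCLike 𝕜] [NormedSpace 𝕜 E] [SMulCommClass ℝ 𝕜 E]
    {v h : ℝ → E} (hv : MemH2per v) (hc : Continuous h)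
    (hhp : Function.Periodic h (2 * π))
    (hh : deriv (deriv v) =ᵐ[periodMeasure] h) :
    ∃ g : Per E, v = (Per.K 𝕜 g).fn ∧ deriv v = (Per.D 𝕜 g).fn ∧ h = (Per.K 𝕜 g - g).fn := by
  obtain ⟨hp, hC, g, hg, hint⟩ := hv
  have hpi : -π ≤ π := by linarith [Real.pi_pos]
  have hgi : IntervalIntegrable g volume (-π) π := by
    rw [intervalIntegrable_iff_integrableOn_Ioc_of_le hpi]
    exact (hg.integrable (by norm_num) : Integrable g periodMeasure)
  have hgh : ∀ᵐ x ∂(volume.restrict (Ioc (-π) π)), g x = h x := by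
    have h1 := hgi.ae_hasDerivAt_integral
    have h2 : ∀ᵐ x : ℝ, x ≠ π := by simp [ae_iff, measure_singleton]
    filter_upwards [hh, ae_restrict_mem measurableSet_Ioc, ae_restrict_of_ae h1,
      ae_restrict_of_ae h2] with x hx hxm hx1 hx2
    rw [uIcc_of_le hpi] at hx1
    have h3 := hx1 ⟨hxm.1.le, hxm.2⟩ (-π) ⟨le_rfl, hpi⟩
    have h4 : HasDerivAt (deriv v) (g x) x := by
      refine (h3.const_add (deriv v (-π))).congr_of_eventuallyEq ?_
      filter_upwards [Ioo_mem_nhds hxm.1 (lt_of_le_of_ne hxm.2 hx2)] with y hy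
      exact hint y ⟨hy.1.le, hy.2.le⟩
    rw [← h4.deriv, hx]
  have hint' : ∀ x ∈ Icc (-π) π, deriv v x = deriv v (-π) + ∫ t in (-π)..x, h t := by
    intro x hx
    rw [hint x hx]
    congr 1
    refine intervalIntegral.integral_congr_ae ?_
    rw [uIoc_of_le hx.1]
    have := (ae_restrict_iff' measurableSet_Ioc).1 hgh
    filter_upwards [this] with t ht htx
    exact ht ⟨htx.1, htx.2.trans hx.2⟩
  have hdp : Function.Periodic (deriv v) (2 * π) := periodic_deriv_of_periodic hp
  set H : ℝ → E := fun x => deriv v (-π) + ∫ t in (-π)..x, h t with hH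
  have hHd : ∀ x, HasDerivAt H (h x) x := fun x =>
    (hc.integral_hasStrictDerivAt (-π) x).hasDerivAt.const_add _
  have hzero : ∫ t in (-π)..π, h t = 0 := by
    have h1 := hint' π ⟨hpi, le_rfl⟩
    have h2 := hdp (-π)
    rw [neg_pi_add_two_pi] at h2
    rw [h2] at h1
    simpa using h1
  have hHp : Function.Periodic H (2 * π) := fun x => by
    have h1 := intervalIntegral.integral_add_adjacent_intervals
      (hc.intervalIntegrable (μ := volume) (-π) x) (hc.intervalIntegrable x (x + 2 * π))
    have h2 := hhp.intervalIntegral_add_eq x (-π)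
    rw [neg_pi_add_two_pi, hzero] at h2
    rw [h2, add_zero] at h1
    simp only [hH, h1]
  have heq : deriv v = H := by
    funext x
    obtain ⟨n, hn⟩ : ∃ n : ℤ, x - n * (2 * π) ∈ Icc (-π) π := by
      obtain ⟨n, hn, -⟩ := existsUnique_sub_zsmul_mem_Ioc Real.two_pi_pos x (-π)
      rw [neg_pi_add_two_pi] at hn
      exact ⟨n, by simpa using Ioc_subset_Icc_self hn⟩
    rw [← hdp.sub_int_mul_eq n, ← hHp.sub_int_mul_eq n]
    exact hint' _ hn
  refine Per.exists_eq_K 𝕜 hp (fun x => ?_) (fun x => ?_) hc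
  · exact (hC.differentiable (by norm_num) x).hasDerivAt
  · rw [heq]; exact hHd x

lemma memH2per_K (𝕜 : Type*) [RCLike 𝕜] [NormedSpace 𝕜 E] [SMulCommClass ℝ 𝕜 E] (g : Per E) :
    MemH2per (Per.K 𝕜 g).fn := by
  refine ⟨Per.periodic_fn _, ?_, (Per.K 𝕜 g - g).fn, ?_, ?_⟩
  · rw [contDiff_one_iff_deriv]
    refine ⟨fun x => (Per.hasDerivAt_K 𝕜 g x).differentiableAt, ?_⟩
    rw [Per.deriv_K]
    exact Per.continuous_fn _
  · refine MemLp.of_bound (Per.continuous_fn _).aestronglyMeasurable ‖Per.K 𝕜 g - g‖ ?_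
    exact Eventually.of_forall fun x => Per.norm_fn_le _ x
  · intro x _
    rw [Per.deriv_K, intervalIntegral.integral_eq_sub_of_hasDerivAt
      (fun t _ => Per.hasDerivAt_D 𝕜 g t) ((Per.continuous_fn _).intervalIntegrable _ _)]
    abel

end Regularity

/-! ### Classical form of the equations -/

section Classical

variable {d f₀ ζ μ ε : ℝ} {V : ℝ → ℝ}

/-- The stationary equation at a point, for the values `u, u', u''` of the function and its
derivatives. -/
def stationaryExpr (d f₀ ζ μ ε V : ℝ) (u u' u'' : ℂ) : ℂ :=
  -(d : ℂ) * u'' + Complex.I * ε * V * u'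
      + ((ζ : ℂ) - Complex.I * μ) * u - ((‖u‖ ^ 2 : ℝ) : ℂ) * u + Complex.I * f₀

lemma IsStationarySolution.exists_eq_K (hd : d ≠ 0) (hV : Continuous V)
    (hVp : Function.Periodic V (2 * π)) {u : ℝ → ℂ} (hu : IsStationarySolution d f₀ ζ μ ε V u) :
    ∃ g : Per ℂ, u = (Per.K ℝ g).fn ∧ ∀ x, stationaryExpr d f₀ ζ μ ε (V x)
      ((Per.K ℝ g).fn x) ((Per.D ℝ g).fn x) ((Per.K ℝ g - g).fn x) = 0 := by
  obtain ⟨hu, heq⟩ := hu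
  have hd' : (d : ℂ) ≠ 0 := by exact_mod_cast hd
  set h : ℝ → ℂ := fun x => (d : ℂ)⁻¹ * (Complex.I * ε * V x * deriv u x
      + ((ζ : ℂ) - Complex.I * μ) * u x - ((‖u x‖ ^ 2 : ℝ) : ℂ) * u x + Complex.I * f₀) with hh
  have cu := hu.continuous
  have cu' := hu.continuous_deriv
  obtain ⟨g, h1, h2, h3⟩ := hu.exists_eq_K ℝ (h := h) (by fun_prop)
    (fun x => by simp only [hh, hVp x, hu.1 x, hu.periodic_deriv x]) (by
      filter_upwards [heq] with x hx
      rw [hh]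
      field_simp
      linear_combination -hx)
  refine ⟨g, h1, fun x => ?_⟩
  rw [← h1, ← h2, ← h3]
  simp only [hh, stationaryExpr]
  field_simp
  ring

lemma isStationarySolution_K {g : Per ℂ} (h : ∀ x, stationaryExpr d f₀ ζ μ ε (V x)
      ((Per.K ℝ g).fn x) ((Per.D ℝ g).fn x) ((Per.K ℝ g - g).fn x) = 0) :
    IsStationarySolution d f₀ ζ μ ε V (Per.K ℝ g).fn := by
  refine ⟨memH2per_K ℝ g, Eventually.of_forall fun x => ?_⟩
  rw [Per.deriv_deriv_K, Per.deriv_K]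
  exact h x

end Classical

/-- The linearization at a point, for the values `v, v', v''`. -/
def linExpr (d ζ μ ε V : ℝ) (u : ℂ) (v v' v'' : Fin 2 → ℂ) : Fin 2 → ℂ :=
  matJ ℂ *ᵥ (-(d : ℂ) • v'' + (ζ : ℂ) • v - matPot u *ᵥ v) -
    ((μ : ℂ) • v - ((ε * V : ℝ) : ℂ) • v')

lemma linearization_apply (d ζ μ ε : ℝ) (V : ℝ → ℝ) (u : ℝ → ℂ) (v : ℝ → Fin 2 → ℂ) (x : ℝ) :
    linearization d ζ μ ε V u v x =
      linExpr d ζ μ ε (V x) (u x) (v x) (deriv v x) (deriv (deriv v) x) := rfl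

lemma linExpr_zero (d ζ μ ε V : ℝ) (u : ℂ) (v v' v'' : Fin 2 → ℂ) :
    linExpr d ζ μ ε V u v v' v'' 0 = -d * v'' 1 + ζ * v 1
      - (2 * u.re * u.im * v 0 + (u.re ^ 2 + 3 * u.im ^ 2) * v 1) - (μ * v 0 - ε * V * v' 0) := by
  simp [linExpr, matJ, matPot, dotProduct, Fin.sum_univ_two, Matrix.vecHead, Matrix.vecTail]

lemma linExpr_one (d ζ μ ε V : ℝ) (u : ℂ) (v v' v'' : Fin 2 → ℂ) :
    linExpr d ζ μ ε V u v v' v'' 1 = -(-d * v'' 0 + ζ * v 0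
      - ((3 * u.re ^ 2 + u.im ^ 2) * v 0 + 2 * u.re * u.im * v 1)) - (μ * v 1 - ε * V * v' 1) := by
  simp [linExpr, matJ, matPot, dotProduct, Fin.sum_univ_two, Matrix.vecHead, Matrix.vecTail]

/-- A matrix as a continuous linear map. -/
def matCLM : Matrix (Fin 2) (Fin 2) ℂ →ₗ[ℂ] ((Fin 2 → ℂ) →L[ℂ] (Fin 2 → ℂ)) :=
  LinearMap.toContinuousLinearMap.toLinearMap ∘ₗ (Matrix.toLin' (R := ℂ)).toLinearMap

lemma continuous_matCLM : Continuous matCLM := LinearMap.continuous_of_finiteDimensional _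

/-- The zeroth order coefficient of the linearization composed with `K`. -/
def potMat (d ζ μ : ℝ) (u : ℂ) : Matrix (Fin 2) (Fin 2) ℂ :=
  matJ ℂ * (((ζ : ℂ) - d) • (1 : Matrix (Fin 2) (Fin 2) ℂ) - matPot u) - (μ : ℂ) • 1

lemma continuous_matPot : Continuous matPot := by
  unfold matPot
  refine continuous_matrix fun i j => ?_
  fin_cases i <;> fin_cases j <;> simp <;> fun_prop

lemma continuous_potMat (d ζ μ : ℝ) : Continuous (potMat d ζ μ) := by
  unfold potMat
  have := continuous_matPot
  fun_prop

/-- Multiplication of `ℂ²`-valued functions by the matrix `J`. -/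
def opJ : Per (Fin 2 → ℂ) →L[ℂ] Per (Fin 2 → ℂ) :=
  (matCLM (matJ ℂ)).compLeftContinuous ℂ (AddCircle (2 * π))

/-- Multiplication by the zeroth order coefficient of the linearization. -/
def opPot (d ζ μ : ℝ) (u : Per ℂ) : Per (Fin 2 → ℂ) →L[ℂ] Per (Fin 2 → ℂ) :=
  Per.mulOp ((⟨fun z => matCLM (potMat d ζ μ z),
    continuous_matCLM.comp (continuous_potMat d ζ μ)⟩ : C(ℂ, _)).comp u)

lemma continuous_opPot (d ζ μ : ℝ) : Continuous (opPot d ζ μ) :=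
  Per.mulOp.continuous.comp (ContinuousMap.continuous_postcomp _)

/-- Multiplication by a real periodic function. -/
def opMul (V : Per ℝ) : Per (Fin 2 → ℂ) →L[ℂ] Per (Fin 2 → ℂ) :=
  Per.mulOp ((⟨fun t => (t : ℂ) • ContinuousLinearMap.id ℂ (Fin 2 → ℂ), by fun_prop⟩ :
    C(ℝ, _)).comp V)

@[simp] lemma opMul_fn (V : Per ℝ) (g : Per (Fin 2 → ℂ)) (x : ℝ) :
    (opMul V g).fn x = (V.fn x : ℂ) • g.fn x := rfl

/-- The linearization composed with the solution operator `K`. -/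
def opS (d ζ μ : ℝ) (V : Per ℝ) (u : Per ℂ) (ε : ℝ) : Per (Fin 2 → ℂ) →L[ℂ] Per (Fin 2 → ℂ) :=
  (d : ℂ) • opJ + (opPot d ζ μ u ∘L Per.K ℂ + (ε : ℂ) • (opMul V ∘L Per.D ℂ))

lemma opS_fn (d ζ μ : ℝ) (V : Per ℝ) (u : Per ℂ) (ε : ℝ) (g : Per (Fin 2 → ℂ)) (x : ℝ) :
    (opS d ζ μ V u ε g).fn x = linExpr d ζ μ ε (V.fn x) (u.fn x) ((Per.K ℂ g).fn x)
      ((Per.D ℂ g).fn x) ((Per.K ℂ g - g).fn x) := by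
  have h : (opS d ζ μ V u ε g).fn x = (d : ℂ) • (matJ ℂ *ᵥ g.fn x) +
    (potMat d ζ μ (u.fn x) *ᵥ (Per.K ℂ g).fn x + (ε : ℂ) • (V.fn x : ℂ) • (Per.D ℂ g).fn x) := rfl
  rw [h]
  simp only [potMat, linExpr, Matrix.sub_mulVec, ← Matrix.mulVec_mulVec, Matrix.smul_mulVec,
    Matrix.one_mulVec, Matrix.mulVec_sub, Matrix.mulVec_add, Matrix.mulVec_smul, Per.sub_fn,
    Complex.ofReal_mul]
  module

lemma opS_fn_eq_linearization (d ζ μ : ℝ) (V : Per ℝ) (u : Per ℂ) (ε : ℝ)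
    (g : Per (Fin 2 → ℂ)) (x : ℝ) :
    (opS d ζ μ V u ε g).fn x = linearization d ζ μ ε V.fn u.fn (Per.K ℂ g).fn x := by
  rw [opS_fn, linearization_apply, Per.deriv_deriv_K, Per.deriv_K]

lemma continuous_opS (d ζ μ : ℝ) (V : Per ℝ) :
    Continuous fun p : Per ℂ × ℝ => opS d ζ μ V p.1 p.2 := by
  unfold opS
  have := continuous_opPot d ζ μ
  fun_prop

lemma matJ_mulVec_matJ_mulVec (w : Fin 2 → ℂ) : matJ ℂ *ᵥ (matJ ℂ *ᵥ w) = -w := by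
  ext i
  fin_cases i <;> simp [matJ, Matrix.mulVec, dotProduct, Fin.sum_univ_two]

lemma isUnit_smul_opJ {d : ℝ} (hd : d ≠ 0) : IsUnit ((d : ℂ) • opJ) := by
  have hd' : (d : ℂ) ≠ 0 := by exact_mod_cast hd
  refine isUnit_iff_exists.2 ⟨(-(d : ℂ)⁻¹) • opJ, ?_, ?_⟩
  · ext1 g
    refine Per.ext_fn fun x => ?_
    change (d : ℂ) • (matJ ℂ *ᵥ ((-(d : ℂ)⁻¹) • (matJ ℂ *ᵥ g.fn x))) = g.fn x
    rw [Matrix.mulVec_smul, matJ_mulVec_matJ_mulVec, smul_smul]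
    simp [hd']
  · ext1 g
    refine Per.ext_fn fun x => ?_
    change (-(d : ℂ)⁻¹) • (matJ ℂ *ᵥ ((d : ℂ) • (matJ ℂ *ᵥ g.fn x))) = g.fn x
    rw [Matrix.mulVec_smul, matJ_mulVec_matJ_mulVec, smul_smul]
    simp [hd']

/-- A bounded perturbation of the leading part composed with `K` is invertible if injective. -/
lemma isUnit_opS_add {d : ℝ} (hd : d ≠ 0) (ζ μ : ℝ) (V : Per ℝ) (u : Per ℂ)
    (P : Per (Fin 2 → ℂ) →L[ℂ] Per (Fin 2 → ℂ))
    (hinj : ∀ g, (opS d ζ μ V u 0 + P ∘L Per.K ℂ) g = 0 → g = 0) :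
    IsUnit (opS d ζ μ V u 0 + P ∘L Per.K ℂ) := by
  have h : opS d ζ μ V u 0 + P ∘L Per.K ℂ = (d : ℂ) • opJ + (opPot d ζ μ u + P) ∘L Per.K ℂ := by
    simp only [opS, Complex.ofReal_zero, zero_smul, add_zero, ContinuousLinearMap.add_comp,
      add_assoc]
  rw [h] at hinj ⊢
  exact isUnit_of_compact_perturbation (isUnit_smul_opJ hd)
    ((Per.isCompactOperator_K ℂ).clm_comp (opPot d ζ μ u + P)) hinj

section Eigen

variable {d ζ μ ε : ℝ}

/-- Solutions in `H²_per` of resolvent equations with continuous right hand side are classical. -/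
lemma exists_eq_K_of_linearization (hd : d ≠ 0) (V : Per ℝ) (u : Per ℂ) {v F : ℝ → Fin 2 → ℂ}
    (hv : MemH2per v) (hF : Continuous F) (hFp : Function.Periodic F (2 * π))
    (h : linearization d ζ μ ε V.fn u.fn v =ᵐ[periodMeasure] F) :
    ∃ g : Per (Fin 2 → ℂ), v = (Per.K ℂ g).fn ∧ (opS d ζ μ V u ε g).fn = F := by
  have hd' : (d : ℂ) ≠ 0 := by exact_mod_cast hd
  set w : ℝ → Fin 2 → ℂ := fun x => (d : ℂ)⁻¹ • ((ζ : ℂ) • v x - matPot (u.fn x) *ᵥ v x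
    + matJ ℂ *ᵥ (F x + ((μ : ℂ) • v x - ((ε * V.fn x : ℝ) : ℂ) • deriv v x))) with hw
  have cv := hv.continuous
  have cv' := hv.continuous_deriv
  have cV := V.continuous_fn
  have cP : Continuous fun x => matPot (u.fn x) *ᵥ v x :=
    (continuous_matPot.comp u.continuous_fn).matrix_mulVec cv
  have cJ : Continuous fun x => matJ ℂ *ᵥ (F x + ((μ : ℂ) • v x -
      ((ε * V.fn x : ℝ) : ℂ) • deriv v x)) :=
    continuous_const.matrix_mulVec (by fun_prop)
  have key : ∀ x, linExpr d ζ μ ε (V.fn x) (u.fn x) (v x) (deriv v x) (w x) = F x := by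
    intro x
    simp only [linExpr, hw, smul_smul, neg_mul, mul_inv_cancel₀ hd', neg_smul, one_smul]
    have : ∀ a b c : Fin 2 → ℂ, -(a - b + c) + a - b = -c := by
      intro a b c; abel
    rw [this, Matrix.mulVec_neg, matJ_mulVec_matJ_mulVec, neg_neg]
    abel
  obtain ⟨g, h1, h2, h3⟩ := hv.exists_eq_K ℂ (h := w) (by fun_prop)
    (fun x => by simp only [hw, hv.1 x, u.periodic_fn x, V.periodic_fn x, hFp x,
      hv.periodic_deriv x]) (by
      filter_upwards [h] with x hx
      rw [linearization_apply, linExpr, sub_eq_iff_eq_add] at hx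
      simp only [hw]
      rw [← hx, matJ_mulVec_matJ_mulVec]
      have : (ζ : ℂ) • v x - matPot (u.fn x) *ᵥ v x + -(-(d : ℂ) • deriv (deriv v) x +
        (ζ : ℂ) • v x - matPot (u.fn x) *ᵥ v x) = (d : ℂ) • deriv (deriv v) x := by module
      rw [this, inv_smul_smul₀ hd'])
  refine ⟨g, h1, funext fun x => ?_⟩
  rw [opS_fn, ← h1, ← h2, ← h3, key]

lemma IsEigenvalue.exists_opS (hd : d ≠ 0) {V : Per ℝ} {u : Per ℂ} {z : ℂ}
    (h : IsEigenvalue (linearization d ζ μ ε V.fn u.fn) z) :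
    ∃ g : Per (Fin 2 → ℂ), g ≠ 0 ∧ opS d ζ μ V u ε g = z • Per.K ℂ g := by
  obtain ⟨v, hv0, hv, hz⟩ := h
  have cv := hv.continuous
  obtain ⟨g, h1, h2⟩ := exists_eq_K_of_linearization hd V u hv (F := z • v) (by fun_prop)
    (fun x => by simp only [Pi.smul_apply, hv.1 x]) hz
  refine ⟨g, ?_, Per.fn_injective ?_⟩
  · rintro rfl
    apply hv0
    rw [h1, map_zero]
    rfl
  · rw [h2, h1]
    rfl

lemma isEigenvalue_of_opS {V : Per ℝ} {u : Per ℂ} {z : ℂ}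
    {g : Per (Fin 2 → ℂ)} (hg : g ≠ 0) (h : opS d ζ μ V u ε g = z • Per.K ℂ g) :
    IsEigenvalue (linearization d ζ μ ε V.fn u.fn) z := by
  refine ⟨(Per.K ℂ g).fn, fun h0 => hg ?_, memH2per_K ℂ g, Eventually.of_forall fun x => ?_⟩
  · refine (injective_iff_map_eq_zero _).1 (Per.K_injective ℂ) g (Per.ext_fn fun x => ?_)
    rw [h0]
    rfl
  · rw [← opS_fn_eq_linearization, h]
    rfl

end Eigen

lemma ofReal_norm_sq (z : ℂ) : ((‖z‖ ^ 2 : ℝ) : ℂ) = z * (starRingEnd ℂ) z := by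
  rw [Complex.mul_conj, Complex.normSq_eq_norm_sq]

namespace Per

section PostComp

variable {𝕜 𝕜' : Type*} [RCLike 𝕜] [RCLike 𝕜'] {E F : Type*} [NormedAddCommGroup E]
  [NormedAddCommGroup F] [NormedSpace ℝ E] [NormedSpace ℝ F] [NormedSpace 𝕜 E] [NormedSpace 𝕜' F]
  [SMulCommClass ℝ 𝕜 E] [SMulCommClass ℝ 𝕜' F]

/-- Pointwise application of a fixed real linear map. -/
def postcomp (A : E →L[ℝ] F) : Per E →L[ℝ] Per F := A.compLeftContinuous ℝ (AddCircle (2 * π))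

@[simp] lemma postcomp_fn (A : E →L[ℝ] F) (f : Per E) (x : ℝ) :
    (postcomp A f).fn x = A (f.fn x) := rfl

lemma K_D_postcomp [CompleteSpace E] [CompleteSpace F] (A : E →L[ℝ] F) (g : Per E) :
    K 𝕜' (postcomp A g) = postcomp A (K 𝕜 g) ∧ D 𝕜' (postcomp A g) = postcomp A (D 𝕜 g) := by
  have h := K_of_hasDerivAt 𝕜' (u := postcomp A (K 𝕜 g)) (v := postcomp A (D 𝕜 g))
    (w := postcomp A (K 𝕜 g - g))
    (fun x => A.hasFDerivAt.comp_hasDerivAt x (hasDerivAt_K 𝕜 g x))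
    (fun x => A.hasFDerivAt.comp_hasDerivAt x (hasDerivAt_D 𝕜 g x))
  rwa [← map_sub, sub_sub_cancel] at h

end PostComp

@[simp] lemma mul_fn (f g : Per ℂ) (x : ℝ) : (f * g).fn x = f.fn x * g.fn x := rfl

end Per

/-! ### The real linearization -/

/-- The zeroth order coefficient of `L_u`, composed with `K`. -/
def potL (d ζ μ : ℝ) (z : ℂ) : ℂ →L[ℝ] ℂ :=
  ContinuousLinearMap.mul ℝ ℂ ((ζ : ℂ) - d - Complex.I * μ - 2 * ((‖z‖ ^ 2 : ℝ) : ℂ)) -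
    ContinuousLinearMap.mul ℝ ℂ (z ^ 2) ∘L Complex.conjCLE.toContinuousLinearMap

lemma continuous_potL (d ζ μ : ℝ) : Continuous (potL d ζ μ) := by
  unfold potL
  fun_prop

/-- The operator `L_u` composed with `K`. -/
def opL (d ζ μ : ℝ) (u : Per ℂ) : Per ℂ →L[ℝ] Per ℂ :=
  d • 1 + Per.mulOp ((⟨potL d ζ μ, continuous_potL d ζ μ⟩ : C(ℂ, _)).comp u) ∘L Per.K ℝ

lemma opL_fn (d ζ μ : ℝ) (u g : Per ℂ) (x : ℝ) :
    (opL d ζ μ u g).fn x = -d * (Per.K ℝ g - g).fn x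
      + (ζ - Complex.I * μ - 2 * ((‖u.fn x‖ ^ 2 : ℝ) : ℂ)) * (Per.K ℝ g).fn x
      - u.fn x ^ 2 * (starRingEnd ℂ) ((Per.K ℝ g).fn x) := by
  have h : (opL d ζ μ u g).fn x = (d : ℝ) • g.fn x + potL d ζ μ (u.fn x) ((Per.K ℝ g).fn x) := rfl
  rw [h]
  simp [potL]
  ring

lemma opL_fn_eq_complexLinearization (d ζ μ : ℝ) (u g : Per ℂ) :
    (opL d ζ μ u g).fn = complexLinearization d ζ μ u.fn (Per.K ℝ g).fn := by
  funext x
  rw [opL_fn, complexLinearization, Per.deriv_deriv_K]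

lemma isUnit_opL_add {d : ℝ} (hd : d ≠ 0) (ζ μ : ℝ) (u : Per ℂ) (P : Per ℂ →L[ℝ] Per ℂ)
    (hinj : ∀ g, (opL d ζ μ u + P ∘L Per.K ℝ) g = 0 → g = 0) :
    IsUnit (opL d ζ μ u + P ∘L Per.K ℝ) := by
  have h : opL d ζ μ u + P ∘L Per.K ℝ = d • (1 : Per ℂ →L[ℝ] Per ℂ) +
      (Per.mulOp ((⟨potL d ζ μ, continuous_potL d ζ μ⟩ : C(ℂ, _)).comp u) + P) ∘L Per.K ℝ := by
    simp only [opL, ContinuousLinearMap.add_comp, add_assoc]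
  rw [h] at hinj ⊢
  refine isUnit_of_compact_perturbation ?_ ((Per.isCompactOperator_K ℝ).clm_comp
    (Per.mulOp ((⟨potL d ζ μ, continuous_potL d ζ μ⟩ : C(ℂ, _)).comp u) + P)) hinj
  refine isUnit_iff_exists.2 ⟨d⁻¹ • 1, ?_, ?_⟩ <;>
  · ext1 g
    simp [smul_smul, hd]

/-! ### Real vectors in `ℂ²` -/

/-- The embedding `z ↦ (Re z, Im z)` of `ℂ = ℝ²` into `ℂ²`. -/
def cvec : ℂ →L[ℝ] (Fin 2 → ℂ) :=
  ContinuousLinearMap.pi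
    ![Complex.ofRealCLM ∘L Complex.reCLM, Complex.ofRealCLM ∘L Complex.imCLM]

@[simp] lemma cvec_zero (z : ℂ) : cvec z 0 = z.re := rfl
@[simp] lemma cvec_one (z : ℂ) : cvec z 1 = z.im := rfl

/-- The real part of a vector in `ℂ²`, as an element of `ℂ = ℝ²`. -/
def reVec : (Fin 2 → ℂ) →L[ℝ] ℂ :=
  Complex.ofRealCLM ∘L Complex.reCLM ∘L ContinuousLinearMap.proj 0 +
    Complex.I • (Complex.ofRealCLM ∘L Complex.reCLM ∘L ContinuousLinearMap.proj 1)

/-- The imaginary part of a vector in `ℂ²`, as an element of `ℂ = ℝ²`. -/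
def imVec : (Fin 2 → ℂ) →L[ℝ] ℂ :=
  Complex.ofRealCLM ∘L Complex.imCLM ∘L ContinuousLinearMap.proj 0 +
    Complex.I • (Complex.ofRealCLM ∘L Complex.imCLM ∘L ContinuousLinearMap.proj 1)

lemma reVec_apply (v : Fin 2 → ℂ) : reVec v = (v 0).re + Complex.I * (v 1).re := rfl
lemma imVec_apply (v : Fin 2 → ℂ) : imVec v = (v 0).im + Complex.I * (v 1).im := rfl

lemma cvec_reVec_add (v : Fin 2 → ℂ) : cvec (reVec v) + Complex.I • cvec (imVec v) = v := by
  ext i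
  fin_cases i <;> apply Complex.ext <;> simp [reVec_apply, imVec_apply]

lemma eq_zero_of_cvec_add {a b : ℂ} (h : cvec a + Complex.I • cvec b = 0) : a = 0 ∧ b = 0 := by
  have h0 := congrFun h 0
  have h1 := congrFun h 1
  simp only [Pi.add_apply, Pi.smul_apply, cvec_zero, cvec_one, Pi.zero_apply, smul_eq_mul,
    Complex.ext_iff] at h0 h1
  simp at h0 h1
  exact ⟨Complex.ext h0.1 h1.1, Complex.ext h0.2 h1.2⟩

namespace Per

/-- The `ℂ²`-valued function of the real and imaginary part. -/
def toC2 : Per ℂ →L[ℝ] Per (Fin 2 → ℂ) := postcomp cvec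

@[simp] lemma toC2_fn (f : Per ℂ) (x : ℝ) : (toC2 f).fn x = cvec (f.fn x) := rfl

lemma K_toC2 (g : Per ℂ) : K ℂ (toC2 g) = toC2 (K ℝ g) := (K_D_postcomp cvec g).1

lemma D_toC2 (g : Per ℂ) : D ℂ (toC2 g) = toC2 (D ℝ g) := (K_D_postcomp cvec g).2

lemma zero_smul_C2 (w : Per (Fin 2 → ℂ)) : (0 : ℂ) • w = 0 := zero_smul ℂ w

lemma decompose (g : Per (Fin 2 → ℂ)) :
    toC2 (postcomp reVec g) + Complex.I • toC2 (postcomp imVec g) = g :=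
  ext_fn fun x => cvec_reVec_add (g.fn x)

lemma eq_zero_of_toC2_add {a b : Per ℂ} (h : toC2 a + Complex.I • toC2 b = 0) :
    a = 0 ∧ b = 0 := by
  have h' : ∀ x, a.fn x = 0 ∧ b.fn x = 0 := fun x =>
    eq_zero_of_cvec_add (by
      have := congrArg (fun f : Per (Fin 2 → ℂ) => f.fn x) h
      exact this)
  exact ⟨ext_fn fun x => (h' x).1, ext_fn fun x => (h' x).2⟩

end Per

lemma opS_toC2 (d ζ μ : ℝ) (V : Per ℝ) (u : Per ℂ) (ε : ℝ) (g : Per ℂ) :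
    opS d ζ μ V u ε (Per.toC2 g) = Per.toC2 (-Complex.I • opL d ζ μ u g)
      + (ε : ℂ) • opMul V (Per.toC2 (Per.D ℝ g)) := by
  refine Per.ext_fn fun x => ?_
  rw [opS_fn, Per.K_toC2, Per.D_toC2, ← map_sub]
  have hr : (Per.toC2 (-Complex.I • opL d ζ μ u g)
      + (ε : ℂ) • opMul V (Per.toC2 (Per.D ℝ g))).fn x =
      cvec (-Complex.I * (opL d ζ μ u g).fn x) + (ε : ℂ) • (V.fn x : ℂ) •
        cvec ((Per.D ℝ g).fn x) := rfl
  rw [hr, opL_fn]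
  simp only [Per.toC2_fn]
  generalize (Per.K ℝ g - g).fn x = w
  generalize (Per.K ℝ g).fn x = v
  generalize (Per.D ℝ g).fn x = v'
  generalize u.fn x = z
  generalize V.fn x = t
  have hn : ‖z‖ ^ 2 = z.re ^ 2 + z.im ^ 2 := by
    rw [← Complex.normSq_eq_norm_sq, Complex.normSq_apply]; ring
  rw [hn]
  ext i
  fin_cases i
  · simp only [Fin.zero_eta, linExpr_zero, Pi.add_apply, Pi.smul_apply, cvec_zero, cvec_one,
      smul_eq_mul]
    apply Complex.ext
    · simp [pow_two]; ring
    · simp [pow_two]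
  · simp only [Fin.mk_one, linExpr_one, Pi.add_apply, Pi.smul_apply, cvec_zero, cvec_one,
      smul_eq_mul]
    apply Complex.ext
    · simp [pow_two]; ring
    · simp [pow_two]

lemma opS_decompose (d ζ μ : ℝ) (V : Per ℝ) (u : Per ℂ) (g : Per (Fin 2 → ℂ)) :
    opS d ζ μ V u 0 g = Per.toC2 (-Complex.I • opL d ζ μ u (Per.postcomp reVec g)) +
      Complex.I • Per.toC2 (-Complex.I • opL d ζ μ u (Per.postcomp imVec g)) := by
  conv_lhs => rw [← Per.decompose g]
  rw [map_add, map_smul, opS_toC2, opS_toC2]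
  rw [Complex.ofReal_zero, Per.zero_smul_C2, Per.zero_smul_C2, add_zero, add_zero]

/-! ### Pairings -/

/-- The real inner product `Re ∫ f ḡ`, as a functional of `f`. -/
def innerL (g : Per ℂ) : Per ℂ →L[ℝ] ℝ :=
  LinearMap.mkContinuous
    { toFun := fun f => (∫ x in (-π)..π, f.fn x * (starRingEnd ℂ) (g.fn x)).re
      map_add' := fun f f' => by
        have hc : ∀ f : Per ℂ, IntervalIntegrable
            (fun x => f.fn x * (starRingEnd ℂ) (g.fn x)) volume (-π) π := fun f =>
          Continuous.intervalIntegrable (by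
            have := f.continuous_fn
            have := g.continuous_fn
            fun_prop) _ _
        simp only [Per.add_fn, add_mul]
        rw [intervalIntegral.integral_add (hc f) (hc f'), Complex.add_re]
      map_smul' := fun c f => by
        simp only [Per.smul_fn, smul_mul_assoc, RingHom.id_apply]
        rw [intervalIntegral.integral_smul, Complex.smul_re] }
    (‖g‖ * (2 * π)) fun f => by
      refine (Complex.abs_re_le_norm _).trans ?_
      have := intervalIntegral.norm_integral_le_of_norm_le_const (a := -π) (b := π)
        (f := fun x => f.fn x * (starRingEnd ℂ) (g.fn x)) (C := ‖f‖ * ‖g‖) (fun x _ => by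
          rw [norm_mul, RCLike.norm_conj]
          exact mul_le_mul (f.norm_fn_le x) (g.norm_fn_le x) (norm_nonneg _) (norm_nonneg _))
      refine this.trans (le_of_eq ?_)
      rw [abs_of_pos (by linarith [Real.pi_pos])]
      ring

lemma innerL_apply (g f : Per ℂ) :
    innerL g f = (∫ x in (-π)..π, f.fn x * (starRingEnd ℂ) (g.fn x)).re := rfl

lemma innerL_eq_integral (g f : Per ℂ) :
    innerL g f = ∫ x in (-π)..π, ((f.fn x).re * (g.fn x).re + (f.fn x).im * (g.fn x).im) := by
  have h := (Complex.reCLM.intervalIntegral_comp_comm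
    (Continuous.intervalIntegrable (μ := volume) (u := fun x => f.fn x * (starRingEnd ℂ) (g.fn x))
      (by
        have := f.continuous_fn
        have := g.continuous_fn
        fun_prop) (-π) π))
  rw [innerL_apply]
  refine h.symm.trans ?_
  simp

lemma eq_zero_of_innerL_self {f : Per ℂ} (hf : innerL f f = 0) : f = 0 := by
  have hpi : -π < π := by linarith [Real.pi_pos]
  rw [innerL_eq_integral] at hf
  have hc := f.continuous_fn
  by_contra hne
  obtain ⟨x, hx⟩ : ∃ x, f.fn x ≠ 0 := by
    by_contra! h
    exact hne (Per.ext_fn h)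
  obtain ⟨y, hy, hxy⟩ := f.periodic_fn.exists_mem_Ioc Real.two_pi_pos x (-π)
  rw [neg_pi_add_two_pi] at hy
  have : 0 < ∫ x in (-π)..π, ((f.fn x).re * (f.fn x).re + (f.fn x).im * (f.fn x).im) := by
    refine intervalIntegral.integral_pos hpi (by fun_prop) (fun t _ => by
      nlinarith [mul_self_nonneg (f.fn t).re, mul_self_nonneg (f.fn t).im])
      ⟨y, Ioc_subset_Icc_self hy, ?_⟩
    rw [← Complex.normSq_apply, Complex.normSq_pos, ← hxy]
    exact hx
  linarith

/-- The pairing `∫ 𝐟 · J 𝛗` as a real functional of `f`. -/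
def pairR (φ : Per ℂ) : Per ℂ →L[ℝ] ℝ :=
  innerL φ ∘L Per.postcomp (ContinuousLinearMap.mul ℝ ℂ Complex.I)

lemma pairR_apply (φ f : Per ℂ) : pairR φ f = innerL φ (Complex.I • f) := rfl

lemma pairR_eq_integral (φ f : Per ℂ) : pairR φ f =
    ∫ x in (-π)..π, ((f.fn x).re * (φ.fn x).im - (f.fn x).im * (φ.fn x).re) := by
  rw [pairR_apply, innerL_eq_integral]
  refine intervalIntegral.integral_congr fun x _ => ?_
  simp
  ring

/-- The complex bilinear pairing `∫ 𝐟 · J 𝛗`. -/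
def pairC (φ : Per ℂ) : Per (Fin 2 → ℂ) →L[ℂ] ℂ :=
  LinearMap.mkContinuous
    { toFun := fun f => ∫ x in (-π)..π, (f.fn x 0 * (φ.fn x).im - f.fn x 1 * (φ.fn x).re)
      map_add' := fun f f' => by
        have hc : ∀ f : Per (Fin 2 → ℂ), IntervalIntegrable
            (fun x => f.fn x 0 * ((φ.fn x).im : ℂ) - f.fn x 1 * ((φ.fn x).re : ℂ))
            volume (-π) π := fun f =>
          Continuous.intervalIntegrable (by
            have := f.continuous_fn
            have := φ.continuous_fn
            fun_prop) _ _
        rw [← intervalIntegral.integral_add (hc f) (hc f')]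
        refine intervalIntegral.integral_congr fun x _ => ?_
        simp
        ring
      map_smul' := fun c f => by
        rw [RingHom.id_apply, ← intervalIntegral.integral_smul]
        refine intervalIntegral.integral_congr fun x _ => ?_
        simp
        ring }
    (2 * ‖φ‖ * (2 * π)) fun f => by
      have := intervalIntegral.norm_integral_le_of_norm_le_const (a := -π) (b := π)
        (f := fun x => f.fn x 0 * ((φ.fn x).im : ℂ) - f.fn x 1 * ((φ.fn x).re : ℂ))
        (C := ‖f‖ * ‖φ‖ + ‖f‖ * ‖φ‖) (fun x _ => by
          refine (norm_sub_le _ _).trans (add_le_add ?_ ?_)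
          · rw [norm_mul, Complex.norm_real, Real.norm_eq_abs]
            exact mul_le_mul ((norm_le_pi_norm _ _).trans (f.norm_fn_le x))
              ((Complex.abs_im_le_norm _).trans (φ.norm_fn_le x)) (abs_nonneg _) (norm_nonneg _)
          · rw [norm_mul, Complex.norm_real, Real.norm_eq_abs]
            exact mul_le_mul ((norm_le_pi_norm _ _).trans (f.norm_fn_le x))
              ((Complex.abs_re_le_norm _).trans (φ.norm_fn_le x)) (abs_nonneg _) (norm_nonneg _))
      refine this.trans (le_of_eq ?_)
      rw [abs_of_pos (by linarith [Real.pi_pos])]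
      ring

lemma pairC_toC2 (φ f : Per ℂ) : pairC φ (Per.toC2 f) = pairR φ f := by
  rw [pairR_eq_integral, ← intervalIntegral.integral_ofReal]
  refine intervalIntegral.integral_congr fun x _ => ?_
  simp only [Per.toC2_fn, cvec_zero, cvec_one]
  push_cast
  ring

/-! ### Perturbation of a simple eigenvalue -/

section Abstract

variable {X : Type*} [NormedAddCommGroup X] [NormedSpace ℂ X]

/-- The operator `w ↦ S w - ℓ (k w) k₀` bordering the pencil `S - z k` at `z = 0`. -/
def bordered (S k : X →L[ℂ] X) (ℓ : X →L[ℂ] ℂ) (v₀ : X) : X →L[ℂ] X :=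
  S - (ℓ ∘L k).smulRight (k v₀)

lemma bordered_apply (S k : X →L[ℂ] X) (ℓ : X →L[ℂ] ℂ) (v₀ w : X) :
    bordered S k ℓ v₀ w = S w - ℓ (k w) • k v₀ := rfl

/-- A simple eigenvalue zero of the pencil `S₀ - z k` persists under small perturbations. -/
lemma eventually_exists_eigenvalue [CompleteSpace X] {S₀ k : X →L[ℂ] X} {ℓ : X →L[ℂ] ℂ} {v₀ : X}
    (hv₀ : v₀ ≠ 0) (hS₀ : S₀ v₀ = 0) (hB : IsUnit (bordered S₀ k ℓ v₀)) {ρ : ℝ} (hρ : 0 < ρ) :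
    ∀ᶠ S in 𝓝 S₀, ∃ z : ℂ, ∃ v : X, ‖z‖ < ρ ∧ v ≠ 0 ∧ S v = z • k v := by
  set f : (X →L[ℂ] X) × X → X := fun p => p.1 (v₀ + p.2) - ℓ (k p.2) • k (v₀ + p.2) with hf
  have hf0 : f (S₀, 0) = 0 := by simp [hf, hS₀]
  have hC : ContDiff ℂ 1 f := by
    rw [hf]
    fun_prop
  have hs : HasStrictFDerivAt f (fderiv ℂ f (S₀, 0)) (S₀, 0) :=
    hC.contDiffAt.hasStrictFDerivAt (by norm_num)
  have hpart : fderiv ℂ f (S₀, 0) ∘L .inr ℂ (X →L[ℂ] X) X = bordered S₀ k ℓ v₀ := by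
    have h1 : HasFDerivAt (fun w : X => f (S₀, w))
        (fderiv ℂ f (S₀, 0) ∘L .inr ℂ (X →L[ℂ] X) X) 0 :=
      hs.hasFDerivAt.comp (0 : X) (hasFDerivAt_prodMk_right S₀ 0)
    have h2 : HasFDerivAt (fun w : X => f (S₀, w)) (bordered S₀ k ℓ v₀) 0 := by
      have a1 : HasFDerivAt (fun w : X => v₀ + w) (ContinuousLinearMap.id ℂ X) 0 :=
        (hasFDerivAt_id (𝕜 := ℂ) (0 : X)).const_add v₀
      have a2 := S₀.hasFDerivAt.comp (0 : X) a1
      have a3 := k.hasFDerivAt.comp (0 : X) a1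
      have a4 := ((ℓ ∘L k).hasFDerivAt (x := (0 : X))).smul a3
      refine (a2.sub a4).congr_fderiv ?_
      ext w
      simp [bordered_apply]
    exact h1.unique h2
  have hinv : (fderiv ℂ f (S₀, 0) ∘L .inr ℂ (X →L[ℂ] X) X).IsInvertible := by
    rw [hpart]
    obtain ⟨W, hW⟩ := hB
    exact ⟨ContinuousLinearEquiv.ofUnit W, by rw [← hW]; rfl⟩
  have ht := hs.tendsto_implicitFunctionOfProdDomain hinv
  have he := hs.eventually_apply_implicitFunctionOfProdDomain hinv
  set w := hs.implicitFunctionOfProdDomain hinv with hw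
  have hz : Tendsto (fun S => ‖ℓ (k (w S))‖) (𝓝 S₀) (𝓝 0) := by
    have : Continuous fun y : X => ‖ℓ (k y)‖ := by fun_prop
    have h := (this.tendsto (0 : X)).comp ht
    simpa [Function.comp_def] using h
  have hv : Tendsto (fun S => v₀ + w S) (𝓝 S₀) (𝓝 v₀) := by
    have h := ht.const_add v₀
    simpa using h
  filter_upwards [he, hz.eventually (gt_mem_nhds hρ), hv.eventually_ne hv₀] with S h1 h2 h3
  refine ⟨ℓ (k (w S)), v₀ + w S, h2, h3, ?_⟩
  rw [hf0] at h1
  exact sub_eq_zero.1 h1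

/-- First order asymptotics of the perturbed eigenvalue: if `S p = -ε q` for an almost
eigenvector `p`, then `z ≈ -ε ℓ(q)`. -/
lemma eigenvalue_asymptotics {S₀ k : X →L[ℂ] X} {ℓ : X →L[ℂ] ℂ} {v₀ q₀ : X}
    (hℓS : ∀ w, ℓ (S₀ w) = 0) (hℓ : ℓ (k v₀) = 1) (hB : IsUnit (bordered S₀ k ℓ v₀))
    {η : ℝ} (hη : 0 < η) :
    ∃ ρ > 0, ∀ᶠ Sπ in 𝓝 (S₀, k v₀, q₀), ∀ (z ε : ℂ) (p v : X), ‖z‖ < ρ →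
      k p = Sπ.2.1 → Sπ.1 p = -(ε • Sπ.2.2) → v ≠ 0 → Sπ.1 v = z • k v →
      ‖z + ε * ℓ q₀‖ ≤ η * (‖z‖ + ‖ε‖) := by
  obtain ⟨C, hC, hbound⟩ := exists_bound_of_isUnit hB
  have hcont : Continuous fun t : ℂ × (X →L[ℂ] X) => t.2 - t.1 • k - (ℓ ∘L k).smulRight (k v₀) := by
    fun_prop
  have h1 : ∀ᶠ t in 𝓝 ((0 : ℂ), S₀), ∀ x : X,
      ‖x‖ ≤ C * ‖(t.2 - t.1 • k - (ℓ ∘L k).smulRight (k v₀)) x‖ := by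
    have := hcont.tendsto ((0 : ℂ), S₀)
    simp only [zero_smul, sub_zero] at this
    exact this.eventually hbound
  rw [nhds_prod_eq, eventually_prod_iff] at h1
  obtain ⟨pz, hpz, pS, hpS, h1⟩ := h1
  obtain ⟨ρ, hρ, hρz⟩ := Metric.eventually_nhds_iff.1 hpz
  set M := ‖q₀‖ + ‖k v₀‖ + 1 with hM
  have hM0 : 0 < M := by positivity
  have e1 : ∀ᶠ Sπ : (X →L[ℂ] X) × X × X in 𝓝 (S₀, k v₀, q₀), pS Sπ.1 :=
    (continuous_fst.tendsto _).eventually hpS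
  have e2 : ∀ᶠ Sπ : (X →L[ℂ] X) × X × X in 𝓝 (S₀, k v₀, q₀), ‖Sπ.2.1‖ < M := by
    have hc : Continuous fun Sπ : (X →L[ℂ] X) × X × X => ‖Sπ.2.1‖ := by fun_prop
    exact (hc.tendsto _).eventually (gt_mem_nhds (by simp only [hM]; linarith [norm_nonneg q₀]))
  have e3 : ∀ᶠ Sπ : (X →L[ℂ] X) × X × X in 𝓝 (S₀, k v₀, q₀), ‖Sπ.2.2‖ < M := by
    have hc : Continuous fun Sπ : (X →L[ℂ] X) × X × X => ‖Sπ.2.2‖ := by fun_prop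
    exact (hc.tendsto _).eventually
      (gt_mem_nhds (by simp only [hM]; linarith [norm_nonneg (k v₀)]))
  have e4 : ∀ᶠ Sπ : (X →L[ℂ] X) × X × X in 𝓝 (S₀, k v₀, q₀), ℓ Sπ.2.1 ≠ 0 := by
    have hc : Continuous fun Sπ : (X →L[ℂ] X) × X × X => ℓ Sπ.2.1 := by fun_prop
    exact (hc.tendsto _).eventually_ne (by simp [hℓ])
  have e5 : ∀ᶠ Sπ : (X →L[ℂ] X) × X × X in 𝓝 (S₀, k v₀, q₀), ‖ℓ Sπ.2.1 - 1‖ < η / 2 := by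
    have hc : Continuous fun Sπ : (X →L[ℂ] X) × X × X => ‖ℓ Sπ.2.1 - 1‖ := by fun_prop
    exact (hc.tendsto _).eventually (gt_mem_nhds (by simp [hℓ, hη]))
  have e6 : ∀ᶠ Sπ : (X →L[ℂ] X) × X × X in 𝓝 (S₀, k v₀, q₀), ‖ℓ Sπ.2.2 - ℓ q₀‖ < η / 2 := by
    have hc : Continuous fun Sπ : (X →L[ℂ] X) × X × X => ‖ℓ Sπ.2.2 - ℓ q₀‖ := by fun_prop
    exact (hc.tendsto _).eventually (gt_mem_nhds (by simp [hη]))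
  have e7 : ∀ᶠ Sπ : (X →L[ℂ] X) × X × X in 𝓝 (S₀, k v₀, q₀),
      ‖ℓ‖ * ‖Sπ.1 - S₀‖ * (C * M) < η / 2 := by
    have hc : Continuous fun Sπ : (X →L[ℂ] X) × X × X => ‖ℓ‖ * ‖Sπ.1 - S₀‖ * (C * M) := by
      fun_prop
    exact (hc.tendsto _).eventually (gt_mem_nhds (by simp [hη]))
  refine ⟨ρ, hρ, ?_⟩
  filter_upwards [e1, e2, e3, e4, e5, e6, e7] with ⟨S, π', q⟩ e1 e2 e3 e4 e5 e6 e7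
  simp only at e1 e2 e3 e4 e5 e6 e7 ⊢
  intro z ε p v hz hkp hSp hv hSv
  subst hkp
  set c := ℓ (k v) / ℓ (k p) with hc
  set y := v - c • p with hy
  have hℓy : ℓ (k y) = 0 := by
    simp only [hy, map_sub, map_smul, smul_eq_mul, hc]
    field_simp
    ring
  have hSy : S y - z • k y = c • (ε • q + z • k p) := by
    simp only [hy, map_sub, map_smul, hSv, hSp]
    module
  have hb : ‖y‖ ≤ C * (‖c‖ * (M * (‖z‖ + ‖ε‖))) := by
    have h := h1 (hρz (by simpa using hz)) e1 y
    have h' : (S - z • k - (ℓ ∘L k).smulRight (k v₀)) y = c • (ε • q + z • k p) := by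
      rw [← hSy]
      simp [hℓy]
    simp only [h'] at h
    refine h.trans (mul_le_mul_of_nonneg_left ?_ hC.le)
    rw [norm_smul]
    refine mul_le_mul_of_nonneg_left ?_ (norm_nonneg _)
    calc ‖ε • q + z • k p‖ ≤ ‖ε‖ * ‖q‖ + ‖z‖ * ‖k p‖ := by
          rw [← norm_smul, ← norm_smul]; exact norm_add_le _ _
      _ ≤ ‖ε‖ * M + ‖z‖ * M := by gcongr
      _ = M * (‖z‖ + ‖ε‖) := by ring
  have hc0 : 0 < ‖c‖ := by
    rw [norm_pos_iff]
    intro hc0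
    rw [hc0] at hb
    simp only [norm_zero, zero_mul, mul_zero] at hb
    have : y = 0 := norm_le_zero_iff.1 hb
    rw [hy, hc0, zero_smul, sub_zero] at this
    exact hv this
  have hℓSy : ℓ ((S - S₀) y) = c * (ε * ℓ q + z * ℓ (k p)) := by
    have h : (S - S₀) y = z • k y + c • (ε • q + z • k p) - S₀ y := by
      rw [← hSy]; simp
    rw [h, map_sub, hℓS]
    simp [hℓy]
    ring
  have h3 : ‖c‖ * ‖ε * ℓ q + z * ℓ (k p)‖ ≤ ‖c‖ * (η / 2 * (‖z‖ + ‖ε‖)) := by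
    calc ‖c‖ * ‖ε * ℓ q + z * ℓ (k p)‖ = ‖ℓ ((S - S₀) y)‖ := by rw [hℓSy, norm_mul]
      _ ≤ ‖ℓ‖ * (‖S - S₀‖ * ‖y‖) := (ℓ.le_opNorm _).trans
          (mul_le_mul_of_nonneg_left ((S - S₀).le_opNorm y) (norm_nonneg _))
      _ ≤ ‖ℓ‖ * (‖S - S₀‖ * (C * (‖c‖ * (M * (‖z‖ + ‖ε‖))))) := by gcongr
      _ = ‖c‖ * ((‖ℓ‖ * ‖S - S₀‖ * (C * M)) * (‖z‖ + ‖ε‖)) := by ring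
      _ ≤ ‖c‖ * (η / 2 * (‖z‖ + ‖ε‖)) := by gcongr
  have h4 := le_of_mul_le_mul_left h3 hc0
  have h5 : z + ε * ℓ q₀ = (ε * ℓ q + z * ℓ (k p)) - z * (ℓ (k p) - 1) - ε * (ℓ q - ℓ q₀) := by
    ring
  rw [h5]
  calc _ ≤ ‖ε * ℓ q + z * ℓ (k p)‖ + ‖z * (ℓ (k p) - 1)‖ + ‖ε * (ℓ q - ℓ q₀)‖ :=
        (norm_sub_le _ _).trans (add_le_add_left (norm_sub_le _ _) _)
    _ ≤ η / 2 * (‖z‖ + ‖ε‖) + ‖z‖ * (η / 2) + ‖ε‖ * (η / 2) := by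
        rw [norm_mul, norm_mul]; gcongr
    _ = η * (‖z‖ + ‖ε‖) := by ring

/-- Invertibility of a pencil for all parameters in a compact set is an open condition. -/
lemma eventually_forall_isUnit [CompleteSpace X] {S₀ k : X →L[ℂ] X} {Q : Set ℂ}
    (hQ : IsCompact Q) (h : ∀ z ∈ Q, IsUnit (S₀ - z • k)) :
    ∀ᶠ S in 𝓝 S₀, ∀ z ∈ Q, IsUnit (S - z • k) := by
  have hcont : Continuous fun t : (X →L[ℂ] X) × ℂ => t.1 - t.2 • k := by fun_prop
  have hopen : IsOpen {t : (X →L[ℂ] X) × ℂ | IsUnit (t.1 - t.2 • k)} :=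
    Units.isOpen.preimage hcont
  exact hQ.eventually_forall_of_forall_eventually fun z hz =>
    hopen.mem_nhds (h z hz)

end Abstract

section Differentiated

variable {d f₀ ζ μ ε : ℝ}

/-- The derivative of a solution of the stationary equation is again a `C²` function, and solves
the differentiated equation. -/
lemma exists_deriv_solution (hd : d ≠ 0) {V V' : Per ℝ} (hV : ∀ x, HasDerivAt V.fn (V'.fn x) x)
    {g : Per ℂ} (hg : ∀ x, stationaryExpr d f₀ ζ μ ε (V.fn x)
      ((Per.K ℝ g).fn x) ((Per.D ℝ g).fn x) ((Per.K ℝ g - g).fn x) = 0) :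
    ∃ p : Per ℂ, Per.K ℝ p = Per.D ℝ g ∧ Per.D ℝ p = Per.K ℝ g - g ∧
      ∀ x, (opL d ζ μ (Per.K ℝ g) p).fn x =
        -(Complex.I * ε * V'.fn x * (Per.D ℝ g).fn x) -
          Complex.I * ε * V.fn x * (Per.D ℝ p).fn x := by
  have hd' : (d : ℂ) ≠ 0 := by exact_mod_cast hd
  set u := (Per.K ℝ g).fn with hu
  set u' := (Per.D ℝ g).fn with hu'
  set u'' := (Per.K ℝ g - g).fn with hu''
  have h1 : ∀ x, HasDerivAt u (u' x) x := Per.hasDerivAt_K ℝ g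
  have h2 : ∀ x, HasDerivAt u' (u'' x) x := Per.hasDerivAt_D ℝ g
  set w : ℝ → ℂ := fun x => (d : ℂ)⁻¹ * (Complex.I * ε * (V'.fn x * u' x + V.fn x * u'' x)
    + ((ζ : ℂ) - Complex.I * μ) * u' x
    - (2 * u x * u' x * (starRingEnd ℂ) (u x) + u x ^ 2 * (starRingEnd ℂ) (u' x))) with hw
  have heq : u'' = fun x => (d : ℂ)⁻¹ * (Complex.I * ε * (V.fn x * u' x)
      + ((ζ : ℂ) - Complex.I * μ) * u x - u x ^ 2 * (starRingEnd ℂ) (u x) + Complex.I * f₀) := by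
    funext x
    have h := hg x
    rw [stationaryExpr, ofReal_norm_sq] at h
    field_simp
    linear_combination -h
  have h3 : ∀ x, HasDerivAt u'' (w x) x := by
    intro x
    have hVc : HasDerivAt (fun y => (V.fn y : ℂ)) (V'.fn x : ℂ) x := (hV x).ofReal_comp
    have hconj : HasDerivAt (fun y => (starRingEnd ℂ) (u y)) ((starRingEnd ℂ) (u' x)) x :=
      Complex.conjCLE.hasFDerivAt.comp_hasDerivAt x (h1 x)
    have h := (((((hVc.mul (h2 x)).const_mul (Complex.I * ε)).add
      ((h1 x).const_mul ((ζ : ℂ) - Complex.I * μ))).sub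
      (((h1 x).pow 2).mul hconj)).add_const (Complex.I * f₀)).const_mul (d : ℂ)⁻¹
    rw [heq]
    refine h.congr_deriv ?_
    simp only [hw, Pi.pow_apply]
    push_cast
    ring
  have cw : Continuous w := by
    have c0 : Continuous u := Per.continuous_fn _
    have c1 : Continuous u' := Per.continuous_fn _
    have c2 : Continuous u'' := Per.continuous_fn _
    have c3 := V.continuous_fn
    have c4 := V'.continuous_fn
    fun_prop
  obtain ⟨p, e1, e2, e3⟩ := Per.exists_eq_K ℝ (Per.periodic_fn _) h2 h3 cw
  refine ⟨p, Per.fn_injective e1.symm, Per.fn_injective e2.symm, fun x => ?_⟩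
  rw [opL_fn, ← e3, ← e2, ← e1, ofReal_norm_sq]
  simp only [hw]
  field_simp
  ring

end Differentiated

/-! ### The base point -/

/-- The data at `ε = 0`: `u` is the base solution, `K p = u'`, and `φ` spans the kernel of the
adjoint of `L_u`. -/
structure BasePoint (d ζ μ : ℝ) (u p φ : Per ℂ) : Prop where
  d_ne : d ≠ 0
  opL_p : opL d ζ μ u p = 0
  ker : ∀ g, opL d ζ μ u g = 0 → ∃ c : ℝ, g = c • p
  adj : ∀ g, innerL φ (opL d ζ μ u g) = 0
  norm_eq : pairR φ (Per.K ℝ p) = 1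

namespace BasePoint

variable {d ζ μ : ℝ} {u p φ : Per ℂ}

lemma pairR_opL (h : BasePoint d ζ μ u p φ) (g : Per ℂ) :
    pairR φ (-Complex.I • opL d ζ μ u g) = 0 := by
  rw [pairR_apply, smul_smul, mul_neg, Complex.I_mul_I, neg_neg, one_smul, h.adj]

lemma pairC_opS (h : BasePoint d ζ μ u p φ) (V : Per ℝ) (g : Per (Fin 2 → ℂ)) :
    pairC φ (opS d ζ μ V u 0 g) = 0 := by
  rw [opS_decompose, map_add, map_smul (pairC φ), pairC_toC2, pairC_toC2, h.pairR_opL, h.pairR_opL]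
  simp

lemma opS_p (h : BasePoint d ζ μ u p φ) (V : Per ℝ) : opS d ζ μ V u 0 (Per.toC2 p) = 0 := by
  rw [opS_toC2, h.opL_p, smul_zero, map_zero, Complex.ofReal_zero, zero_add,
    Per.zero_smul_C2]

lemma ker_opS (h : BasePoint d ζ μ u p φ) {V : Per ℝ} {g : Per (Fin 2 → ℂ)}
    (hg : opS d ζ μ V u 0 g = 0) : ∃ c : ℂ, g = c • Per.toC2 p := by
  rw [opS_decompose] at hg
  obtain ⟨h1, h2⟩ := Per.eq_zero_of_toC2_add hg
  rw [smul_eq_zero_iff_right (neg_ne_zero.2 Complex.I_ne_zero)] at h1 h2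
  obtain ⟨a, ha⟩ := h.ker _ h1
  obtain ⟨b, hb⟩ := h.ker _ h2
  refine ⟨a + b * Complex.I, ?_⟩
  rw [← Per.decompose g, ha, hb, map_smul, map_smul]
  refine Per.ext_fn fun x => ?_
  simp only [Per.add_fn, Per.smul_fn]
  ext i
  simp
  ring

lemma pairC_K_p (h : BasePoint d ζ μ u p φ) : pairC φ (Per.K ℂ (Per.toC2 p)) = 1 := by
  rw [Per.K_toC2, pairC_toC2, h.norm_eq, Complex.ofReal_one]

lemma toC2_p_ne_zero (h : BasePoint d ζ μ u p φ) : Per.toC2 p ≠ 0 := by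
  intro h0
  have := h.pairC_K_p
  rw [h0, map_zero, map_zero] at this
  exact zero_ne_one this

lemma isUnit_bordered (h : BasePoint d ζ μ u p φ) (V : Per ℝ) :
    IsUnit (bordered (opS d ζ μ V u 0) (Per.K ℂ) (pairC φ) (Per.toC2 p)) := by
  have e : bordered (opS d ζ μ V u 0) (Per.K ℂ) (pairC φ) (Per.toC2 p) =
      opS d ζ μ V u 0 + (-(pairC φ).smulRight (Per.K ℂ (Per.toC2 p))) ∘L Per.K ℂ := by
    ext1 g
    simp [bordered_apply, sub_eq_add_neg]
  rw [e]
  refine isUnit_opS_add h.d_ne ζ μ V u _ fun g hg => ?_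
  rw [← e, bordered_apply] at hg
  have h1 := congrArg (pairC φ) hg
  rw [map_sub, map_smul, h.pairC_opS, h.pairC_K_p, map_zero, smul_eq_mul, mul_one, zero_sub,
    neg_eq_zero] at h1
  rw [h1, Per.zero_smul_C2, sub_zero] at hg
  obtain ⟨c, rfl⟩ := h.ker_opS hg
  rw [map_smul, map_smul, h.pairC_K_p, smul_eq_mul, mul_one] at h1
  rw [h1, Per.zero_smul_C2]

lemma isUnit_pencil (h : BasePoint d ζ μ u p φ) (V : Per ℝ) {z : ℂ}
    (hz : ∀ g : Per (Fin 2 → ℂ), opS d ζ μ V u 0 g = z • Per.K ℂ g → g = 0) :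
    IsUnit (opS d ζ μ V u 0 - z • Per.K ℂ) := by
  have e : opS d ζ μ V u 0 - z • Per.K ℂ =
      opS d ζ μ V u 0 + ((-z) • (1 : Per (Fin 2 → ℂ) →L[ℂ] Per (Fin 2 → ℂ))) ∘L Per.K ℂ := by
    ext1 g
    refine Per.ext_fn fun x => ?_
    change (opS d ζ μ V u 0 g).fn x - z • (Per.K ℂ g).fn x =
      (opS d ζ μ V u 0 g).fn x + (-z) • (Per.K ℂ g).fn x
    rw [neg_smul, sub_eq_add_neg]
  rw [e]
  refine isUnit_opS_add h.d_ne ζ μ V u _ fun g hg => hz g ?_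
  rw [← e] at hg
  exact sub_eq_zero.1 hg

end BasePoint

/-! ### A priori bounds for eigenvalues -/

lemma integral_deriv_periodic_eq_zero {G G' : ℝ → ℝ} (hG : ∀ x, HasDerivAt G (G' x) x)
    (hc : Continuous G') (hp : Function.Periodic G (2 * π)) : ∫ x in (-π)..π, G' x = 0 := by
  rw [intervalIntegral.integral_eq_sub_of_hasDerivAt (fun x _ => hG x) (hc.intervalIntegrable _ _)]
  have := hp (-π)
  rw [neg_pi_add_two_pi] at this
  rw [this, sub_self]

lemma hasDerivAt_re_mul_conj {a b a' b' : ℝ → ℂ} {x : ℝ} (ha : HasDerivAt a (a' x) x)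
    (hb : HasDerivAt b (b' x) x) :
    HasDerivAt (fun y => (a y).re * (b y).re + (a y).im * (b y).im)
      ((a' x).re * (b x).re + (a x).re * (b' x).re +
        ((a' x).im * (b x).im + (a x).im * (b' x).im)) x := by
  have ra : HasDerivAt (fun y => (a y).re) (a' x).re x :=
    Complex.reCLM.hasFDerivAt.comp_hasDerivAt x ha
  have ia : HasDerivAt (fun y => (a y).im) (a' x).im x :=
    Complex.imCLM.hasFDerivAt.comp_hasDerivAt x ha
  have rb : HasDerivAt (fun y => (b y).re) (b' x).re x :=
    Complex.reCLM.hasFDerivAt.comp_hasDerivAt x hb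
  have ib : HasDerivAt (fun y => (b y).im) (b' x).im x :=
    Complex.imCLM.hasFDerivAt.comp_hasDerivAt x hb
  exact (ra.mul rb).add (ia.mul ib)

section Energy

variable {δ μ ε M N : ℝ} {z : ℂ} {V V' q : ℝ → ℝ} {a a' a'' b f : ℝ → ℂ}

/-- Energy identity, real part. -/
lemma energy_re (h1 : ∀ x, HasDerivAt a (a' x) x) (h2 : ∀ x, HasDerivAt a' (a'' x) x)
    (hV : ∀ x, HasDerivAt V (V' x) x) (ca : Continuous a'') (cV : Continuous V')
    (cb : Continuous b) (pa : Function.Periodic a (2 * π)) (pV : Function.Periodic V (2 * π))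
    (heq : ∀ x, z * a x = Complex.I * δ * a'' x + Complex.I * q x * a x + f x - μ * a x +
      ε * V x * a' x)
    (hf : ∀ x, ‖f x‖ ≤ M * ‖b x‖) (hN : ∀ x, |V' x| ≤ N) (hε : |ε| * N ≤ μ) :
    (z.re + μ / 2) * ∫ x in (-π)..π, ‖a x‖ ^ 2 ≤ M * ∫ x in (-π)..π, ‖a x‖ * ‖b x‖ := by
  have hpi : -π ≤ π := by linarith [Real.pi_pos]
  have c0 : Continuous a := continuous_iff_continuousAt.2 fun x => (h1 x).continuousAt
  have c1 : Continuous a' := continuous_iff_continuousAt.2 fun x => (h2 x).continuousAt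
  have cV0 : Continuous V := continuous_iff_continuousAt.2 fun x => (hV x).continuousAt
  have pa' : Function.Periodic a' (2 * π) := fun x => by
    have := (h1 (x + 2 * π)).comp_add_const x (2 * π)
    simp only [pa _] at this
    exact this.unique (h1 x)
  have hIa : ∀ x, HasDerivAt (fun y => -Complex.I * a y) (-Complex.I * a' x) x :=
    fun x => (h1 x).const_mul (-Complex.I)
  set G' : ℝ → ℝ := fun x => -δ * ((a'' x).im * (a x).re - (a'' x).re * (a x).im) +
    ε / 2 * (V' x * ‖a x‖ ^ 2 + V x * (2 * ((a x).re * (a' x).re + (a x).im * (a' x).im))) with hG'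
  have hzero : ∫ x in (-π)..π, G' x = 0 := by
    refine integral_deriv_periodic_eq_zero (G := fun x => -δ * ((a' x).re * (-Complex.I * a x).re +
      (a' x).im * (-Complex.I * a x).im) * (-1) + ε / 2 * (V x * ((a x).re * (a x).re +
        (a x).im * (a x).im))) (fun x => ?_) (by fun_prop) (fun x => by
        simp only [pa x, pa' x, pV x])
    have e1 := ((hasDerivAt_re_mul_conj (b' := fun y => -Complex.I * a' y)
      (h2 x) (hIa x)).const_mul (-δ)).mul_const (-1)
    have e2 := ((hV x).mul (hasDerivAt_re_mul_conj (h1 x) (h1 x))).const_mul (ε / 2)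
    refine (e1.add e2).congr_deriv ?_
    simp only [hG', ← Complex.normSq_eq_norm_sq, Complex.normSq_apply]
    simp
    ring
  have hpt : ∀ x, (z.re + μ / 2) * ‖a x‖ ^ 2 ≤ M * (‖a x‖ * ‖b x‖) + G' x := by
    intro x
    have hre := congrArg (fun w => (w * (starRingEnd ℂ) (a x)).re) (heq x)
    have hfa : (f x * (starRingEnd ℂ) (a x)).re ≤ M * (‖a x‖ * ‖b x‖) := by
      refine (Complex.re_le_norm _).trans ?_
      rw [norm_mul, RCLike.norm_conj]
      calc ‖f x‖ * ‖a x‖ ≤ M * ‖b x‖ * ‖a x‖ := mul_le_mul_of_nonneg_right (hf x) (norm_nonneg _)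
        _ = _ := by ring
    have hVx : -(ε / 2 * V' x) * ‖a x‖ ^ 2 ≤ μ / 2 * ‖a x‖ ^ 2 := by
      refine mul_le_mul_of_nonneg_right ?_ (sq_nonneg _)
      have h3 : |ε * V' x| ≤ μ := by
        rw [abs_mul]
        exact (mul_le_mul_of_nonneg_left (hN x) (abs_nonneg _)).trans hε
      linarith [neg_abs_le (ε * V' x)]
    have hid : (z.re + μ) * ‖a x‖ ^ 2 = (f x * (starRingEnd ℂ) (a x)).re + G' x -
        (ε / 2 * V' x) * ‖a x‖ ^ 2 := by
      simp only [hG', ← Complex.normSq_eq_norm_sq, Complex.normSq_apply]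
      simp at hre ⊢
      linear_combination hre
    linarith
  have ci1 : IntervalIntegrable (fun x => ‖a x‖ ^ 2) volume (-π) π :=
    Continuous.intervalIntegrable (by fun_prop) _ _
  have ci2 : IntervalIntegrable (fun x => ‖a x‖ * ‖b x‖) volume (-π) π :=
    Continuous.intervalIntegrable (by fun_prop) _ _
  have ci3 : IntervalIntegrable G' volume (-π) π :=
    Continuous.intervalIntegrable (by fun_prop) _ _
  have := intervalIntegral.integral_mono_on hpi (ci1.const_mul (z.re + μ / 2))
    ((ci2.const_mul M).add ci3) (fun x _ => hpt x)
  rw [intervalIntegral.integral_add (ci2.const_mul M) ci3, hzero, add_zero,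
    intervalIntegral.integral_const_mul, intervalIntegral.integral_const_mul] at this
  exact this

/-- Energy estimate, imaginary part. -/
lemma energy_im (h1 : ∀ x, HasDerivAt a (a' x) x) (h2 : ∀ x, HasDerivAt a' (a'' x) x)
    (ca : Continuous a'') (cb : Continuous b) (pa : Function.Periodic a (2 * π))
    (heq : ∀ x, z * a x = Complex.I * δ * a'' x + Complex.I * q x * a x + f x - μ * a x +
      ε * V x * a' x)
    (hf : ∀ x, ‖f x‖ ≤ M * ‖b x‖) (hq : ∀ x, |q x| ≤ M) (hN : ∀ x, |V x| ≤ N) (hε : |ε| ≤ 1)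
    (hδ : 0 < δ * z.im) :
    (|z.im| - (M + N ^ 2 / (4 * |δ|))) * ∫ x in (-π)..π, ‖a x‖ ^ 2 ≤
      M * ∫ x in (-π)..π, ‖a x‖ * ‖b x‖ := by
  have hpi : -π ≤ π := by linarith [Real.pi_pos]
  have c0 : Continuous a := continuous_iff_continuousAt.2 fun x => (h1 x).continuousAt
  have c1 : Continuous a' := continuous_iff_continuousAt.2 fun x => (h2 x).continuousAt
  have pa' : Function.Periodic a' (2 * π) := fun x => by
    have := (h1 (x + 2 * π)).comp_add_const x (2 * π)
    simp only [pa _] at this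
    exact this.unique (h1 x)
  have hδ0 : δ ≠ 0 := by rintro rfl; simp at hδ
  have hδa : 0 < |δ| := abs_pos.2 hδ0
  set G' : ℝ → ℝ := fun x => |δ| * ((a'' x).re * (a x).re + (a' x).re * (a' x).re +
        ((a'' x).im * (a x).im + (a' x).im * (a' x).im)) with hG'
  have hzero : ∫ x in (-π)..π, G' x = 0 := by
    refine integral_deriv_periodic_eq_zero (G := fun x => |δ| * ((a' x).re * (a x).re +
      (a' x).im * (a x).im)) (fun x => ?_) (by fun_prop) (fun x => by simp only [pa x, pa' x])
    exact (hasDerivAt_re_mul_conj (h2 x) (h1 x)).const_mul _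
  have hpt : ∀ x, (|z.im| - (M + N ^ 2 / (4 * |δ|))) * ‖a x‖ ^ 2 ≤
      M * (‖a x‖ * ‖b x‖) + G' x := by
    intro x
    have him := congrArg (fun w => (w * (starRingEnd ℂ) (a x)).im) (heq x)
    obtain ⟨s, hs, hsδ, hsz⟩ : ∃ s : ℝ, |s| = 1 ∧ s * δ = |δ| ∧ s * z.im = |z.im| := by
      rcases pos_and_pos_or_neg_and_neg_of_mul_pos hδ with h | h
      · exact ⟨1, by simp, by rw [abs_of_pos h.1, one_mul], by rw [abs_of_pos h.2, one_mul]⟩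
      · exact ⟨-1, by simp, by rw [abs_of_neg h.1]; ring, by rw [abs_of_neg h.2]; ring⟩
    have hfa : s * (f x * (starRingEnd ℂ) (a x)).im ≤ M * (‖a x‖ * ‖b x‖) := by
      refine (le_abs_self _).trans ?_
      rw [abs_mul, hs, one_mul]
      refine (Complex.abs_im_le_norm _).trans ?_
      rw [norm_mul, RCLike.norm_conj]
      calc ‖f x‖ * ‖a x‖ ≤ M * ‖b x‖ * ‖a x‖ := mul_le_mul_of_nonneg_right (hf x) (norm_nonneg _)
        _ = _ := by ring
    have hqa : s * q x * ‖a x‖ ^ 2 ≤ M * ‖a x‖ ^ 2 := by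
      refine mul_le_mul_of_nonneg_right ?_ (sq_nonneg _)
      refine (le_abs_self _).trans ?_
      rw [abs_mul, hs, one_mul]
      exact hq x
    have hVa : s * (ε * V x * (a' x * (starRingEnd ℂ) (a x)).im) ≤
        |δ| * ‖a' x‖ ^ 2 + N ^ 2 / (4 * |δ|) * ‖a x‖ ^ 2 := by
      have h3 : s * (ε * V x * (a' x * (starRingEnd ℂ) (a x)).im) ≤ N * (‖a' x‖ * ‖a x‖) := by
        refine (le_abs_self _).trans ?_
        rw [abs_mul, hs, one_mul, abs_mul, abs_mul]
        have h4 : |(a' x * (starRingEnd ℂ) (a x)).im| ≤ ‖a' x‖ * ‖a x‖ := by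
          refine (Complex.abs_im_le_norm _).trans ?_
          rw [norm_mul, RCLike.norm_conj]
        have h5 : |ε| * |V x| ≤ 1 * N :=
          mul_le_mul hε (hN x) (abs_nonneg _) zero_le_one
        rw [one_mul] at h5
        exact mul_le_mul h5 h4 (abs_nonneg _) ((abs_nonneg _).trans (hN x))
      refine h3.trans ?_
      have h6 : |δ| * ‖a' x‖ ^ 2 + N ^ 2 / (4 * |δ|) * ‖a x‖ ^ 2 - N * (‖a' x‖ * ‖a x‖) =
          (2 * |δ| * ‖a' x‖ - N * ‖a x‖) ^ 2 / (4 * |δ|) := by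
        field_simp
        ring
      have h7 : 0 ≤ (2 * |δ| * ‖a' x‖ - N * ‖a x‖) ^ 2 / (4 * |δ|) := by positivity
      linarith
    have hid : |z.im| * ‖a x‖ ^ 2 = G' x - |δ| * ‖a' x‖ ^ 2 + s * q x * ‖a x‖ ^ 2 +
        s * (f x * (starRingEnd ℂ) (a x)).im +
        s * (ε * V x * (a' x * (starRingEnd ℂ) (a x)).im) := by
      simp only [hG', ← Complex.normSq_eq_norm_sq, Complex.normSq_apply, ← hsz, ← hsδ]
      simp at him ⊢
      linear_combination s * him
    linarith
  have ci1 : IntervalIntegrable (fun x => ‖a x‖ ^ 2) volume (-π) π :=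
    Continuous.intervalIntegrable (by fun_prop) _ _
  have ci2 : IntervalIntegrable (fun x => ‖a x‖ * ‖b x‖) volume (-π) π :=
    Continuous.intervalIntegrable (by fun_prop) _ _
  have ci3 : IntervalIntegrable G' volume (-π) π :=
    Continuous.intervalIntegrable (by fun_prop) _ _
  have := intervalIntegral.integral_mono_on hpi (ci1.const_mul _)
    ((ci2.const_mul M).add ci3) (fun x _ => hpt x)
  rw [intervalIntegral.integral_add (ci2.const_mul M) ci3, hzero, add_zero,
    intervalIntegral.integral_const_mul, intervalIntegral.integral_const_mul] at this
  exact this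

end Energy

/-- The diagonalizing coordinate `v₀ + j v₁`, where `j² = -1`. -/
def diagL (j : ℂ) : (Fin 2 → ℂ) →L[ℝ] ℂ :=
  ContinuousLinearMap.proj 0 + j • ContinuousLinearMap.proj 1

lemma diagL_apply (j : ℂ) (v : Fin 2 → ℂ) : diagL j v = v 0 + j * v 1 := rfl

lemma diagL_linExpr {j : ℂ} (hj : j * j = -1) (d ζ μ ε V : ℝ) (u : ℂ) (v v' v'' : Fin 2 → ℂ) :
    diagL j (linExpr d ζ μ ε V u v v' v'') = j * d * diagL j v'' +
      j * ((-ζ + 2 * ‖u‖ ^ 2 : ℝ) : ℂ) * diagL j v +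
      j * (u.re + j * u.im) ^ 2 * diagL (-j) v - μ * diagL j v + ε * V * diagL j v' := by
  have hn : ‖u‖ ^ 2 = u.re ^ 2 + u.im ^ 2 := by
    rw [← Complex.normSq_eq_norm_sq, Complex.normSq_apply]; ring
  simp only [diagL_apply, linExpr_zero, linExpr_one, hn]
  push_cast
  linear_combination (-(d * v'' 1 + (-ζ + 2 * ((u.re : ℂ) ^ 2 + (u.im : ℂ) ^ 2)) * v 1
    - (u.re : ℂ) ^ 2 * v 1 + 2 * u.re * u.im * v 0 - 2 * j * u.re * u.im * v 1
    + j * (u.im : ℂ) ^ 2 * v 0 - (j * j - 1) * (u.im : ℂ) ^ 2 * v 1)) * hj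

lemma integral_norm_sq_eq_innerL (f : Per ℂ) : ∫ x in (-π)..π, ‖f.fn x‖ ^ 2 = innerL f f := by
  rw [innerL_eq_integral]
  refine intervalIntegral.integral_congr fun x _ => ?_
  simp only [← Complex.normSq_eq_norm_sq, Complex.normSq_apply]

lemma integral_young (a b : Per ℂ) {α β γ : ℝ}
    (h : ∀ X Y : ℝ, γ * (X * Y) ≤ α * X ^ 2 + β * Y ^ 2) :
    γ * ∫ x in (-π)..π, ‖a.fn x‖ * ‖b.fn x‖ ≤
      α * (∫ x in (-π)..π, ‖a.fn x‖ ^ 2) + β * ∫ x in (-π)..π, ‖b.fn x‖ ^ 2 := by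
  have hpi : -π ≤ π := by linarith [Real.pi_pos]
  have ca := a.continuous_fn
  have cb := b.continuous_fn
  have i1 : IntervalIntegrable (fun x => ‖a.fn x‖ ^ 2) volume (-π) π :=
    Continuous.intervalIntegrable (by fun_prop) _ _
  have i2 : IntervalIntegrable (fun x => ‖b.fn x‖ ^ 2) volume (-π) π :=
    Continuous.intervalIntegrable (by fun_prop) _ _
  have i3 : IntervalIntegrable (fun x => ‖a.fn x‖ * ‖b.fn x‖) volume (-π) π :=
    Continuous.intervalIntegrable (by fun_prop) _ _
  rw [← intervalIntegral.integral_const_mul, ← intervalIntegral.integral_const_mul,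
    ← intervalIntegral.integral_const_mul,
    ← intervalIntegral.integral_add (i1.const_mul _) (i2.const_mul _)]
  exact intervalIntegral.integral_mono_on hpi (i3.const_mul _)
    ((i1.const_mul _).add (i2.const_mul _)) fun x _ => h _ _

lemma re_bound_arith {x μ M A B P : ℝ} (hμ : 0 < μ) (hM : 0 ≤ M) (hA : 0 ≤ A) (hB : 0 ≤ B)
    (hAB : 0 < A ∨ 0 < B) (RA : (x + μ / 2) * A ≤ M * P) (RB : (x + μ / 2) * B ≤ M * P)
    (hP : P ≤ 1 / 2 * A + 1 / 2 * B) : x ≤ M := by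
  have hpos : 0 < A + B := by rcases hAB with h | h <;> linarith
  have h1 : (x + μ / 2) * (A + B) ≤ M * (A + B) := by
    have := mul_le_mul_of_nonneg_left hP hM
    linarith
  linarith [le_of_mul_le_mul_right h1 hpos]

lemma im_bound_arith {x y μ M C A B P : ℝ} (hμ : 0 < μ) (hx : 0 ≤ x) (hA : 0 ≤ A) (hB : 0 ≤ B)
    (hAB : 0 < A ∨ 0 < B) (RB : (x + μ / 2) * B ≤ M * P)
    (hP : M * P ≤ μ / 4 * B + M ^ 2 / μ * A) (I : (y - C) * A ≤ M * P) :
    y ≤ C + 2 * (M ^ 2 / μ) := by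
  by_contra! hcon
  have hzB := mul_nonneg hx hB
  have hA1 : (y - C - 2 * (M ^ 2 / μ)) * A ≤ 0 := by linarith
  have hAz : A ≤ 0 := by
    by_contra! hA2
    linarith [mul_pos (by linarith : 0 < y - C - 2 * (M ^ 2 / μ)) hA2]
  have hAe : A = 0 := le_antisymm hAz hA
  rw [hAe] at hP hAB
  rcases hAB with h | h
  · exact lt_irrefl _ h
  · linarith [mul_pos hμ h]

/-- Eigenvalues in the right half plane are a priori bounded. -/
lemma exists_eigenvalue_bound {d ζ μ : ℝ} (hd : d ≠ 0) (hμ : 0 < μ) {V V' : Per ℝ}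
    (hV : ∀ x, HasDerivAt V.fn (V'.fn x) x) (r : ℝ) :
    ∃ ε₁ > 0, ∃ C : ℝ, ∀ (u : Per ℂ) (ε : ℝ) (z : ℂ) (g : Per (Fin 2 → ℂ)), ‖u‖ ≤ r → |ε| ≤ ε₁ →
      0 ≤ z.re → g ≠ 0 → opS d ζ μ V u ε g = z • Per.K ℂ g → ‖z‖ ≤ C := by
  set N := ‖V‖ + ‖V'‖ with hN
  have hN0 : 0 ≤ N := by positivity
  set M := |ζ| + 2 * r ^ 2 with hM
  have hM0 : 0 ≤ M := by positivity
  set C' := M + N ^ 2 / (4 * |d|) with hC'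
  refine ⟨min 1 (μ / (N + 1)), by positivity, M + (C' + 2 * (M ^ 2 / μ)), ?_⟩
  intro u ε z g hu hε hz hg heig
  have hε1 : |ε| ≤ 1 := hε.trans (min_le_left _ _)
  have hεN : |ε| * N ≤ μ := by
    have h1 : |ε| ≤ μ / (N + 1) := hε.trans (min_le_right _ _)
    rw [le_div_iff₀ (by positivity)] at h1
    nlinarith [abs_nonneg ε]
  have hr : ∀ x, ‖u.fn x‖ ^ 2 ≤ r ^ 2 := fun x =>
    pow_le_pow_left₀ (norm_nonneg _) ((u.norm_fn_le x).trans hu) 2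
  have hq : ∀ x, |(-ζ + 2 * ‖u.fn x‖ ^ 2)| ≤ M := fun x => by
    refine (abs_add_le _ _).trans ?_
    rw [abs_neg, abs_of_nonneg (by positivity : 0 ≤ 2 * ‖u.fn x‖ ^ 2)]
    linarith [hr x]
  have hVN : ∀ x, |V.fn x| ≤ N := fun x => (V.norm_fn_le x).trans (by simp [hN])
  have hVN' : ∀ x, |V'.fn x| ≤ N := fun x => (V'.norm_fn_le x).trans (by simp [hN])
  have hnu : ∀ j : ℂ, j * j = -1 → j = Complex.I ∨ j = -Complex.I := fun j hj =>
    mul_self_eq_mul_self_iff.1 (hj.trans Complex.I_mul_I.symm)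
  set a : ℂ → Per ℂ := fun j => Per.postcomp (diagL j) (Per.K ℂ g) with ha
  set a' : ℂ → Per ℂ := fun j => Per.postcomp (diagL j) (Per.D ℂ g) with ha'
  set a'' : ℂ → Per ℂ := fun j => Per.postcomp (diagL j) (Per.K ℂ g - g) with ha''
  set f : ℂ → ℝ → ℂ := fun j x => j * ((u.fn x).re + j * (u.fn x).im) ^ 2 * (a (-j)).fn x with hf
  have h1 : ∀ j x, HasDerivAt (a j).fn ((a' j).fn x) x := fun j x =>
    (diagL j).hasFDerivAt.comp_hasDerivAt x (Per.hasDerivAt_K ℂ g x)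
  have h2 : ∀ j x, HasDerivAt (a' j).fn ((a'' j).fn x) x := fun j x =>
    (diagL j).hasFDerivAt.comp_hasDerivAt x (Per.hasDerivAt_D ℂ g x)
  have heq : ∀ j, j * j = -1 → ∀ x, z * (a j).fn x = j * d * (a'' j).fn x +
      j * ((-ζ + 2 * ‖u.fn x‖ ^ 2 : ℝ) : ℂ) * (a j).fn x + f j x - μ * (a j).fn x +
      ε * V.fn x * (a' j).fn x := by
    intro j hj x
    have h3 : diagL j ((opS d ζ μ V u ε g).fn x) = diagL j (z • (Per.K ℂ g).fn x) := by
      rw [heig]; rfl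
    rw [opS_fn, diagL_linExpr hj] at h3
    have h4 : diagL j (z • (Per.K ℂ g).fn x) = z * (a j).fn x := by
      simp only [ha, Per.postcomp_fn, diagL_apply, Pi.smul_apply, smul_eq_mul]
      ring
    rw [← h4, ← h3]
    rfl
  have hfb : ∀ j, j * j = -1 → ∀ x, ‖f j x‖ ≤ M * ‖(a (-j)).fn x‖ := by
    intro j hj x
    have h5 : ‖j‖ = 1 := by rcases hnu j hj with rfl | rfl <;> simp
    have h6 : ‖((u.fn x).re + j * (u.fn x).im : ℂ)‖ = ‖u.fn x‖ := by
      rcases hnu j hj with rfl | rfl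
      · rw [mul_comm, Complex.re_add_im]
      · rw [← RCLike.norm_conj (u.fn x)]
        congr 1
        apply Complex.ext <;> simp
    rw [hf]
    simp only [norm_mul, norm_pow, h5, h6, one_mul]
    refine mul_le_mul_of_nonneg_right ?_ (norm_nonneg _)
    linarith [hr x, abs_nonneg ζ, sq_nonneg r]
  have hI : Complex.I * Complex.I = -1 := Complex.I_mul_I
  have hI' : -Complex.I * -Complex.I = -1 := by simp
  set A := ∫ x in (-π)..π, ‖(a Complex.I).fn x‖ ^ 2 with hA
  set B := ∫ x in (-π)..π, ‖(a (-Complex.I)).fn x‖ ^ 2 with hB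
  set P := ∫ x in (-π)..π, ‖(a Complex.I).fn x‖ * ‖(a (-Complex.I)).fn x‖ with hP
  have hP' : ∫ x in (-π)..π, ‖(a (-Complex.I)).fn x‖ * ‖(a Complex.I).fn x‖ = P := by
    simp only [hP, mul_comm]
  have hpi : -π ≤ π := by linarith [Real.pi_pos]
  have hA0 : 0 ≤ A := intervalIntegral.integral_nonneg hpi fun x _ => sq_nonneg _
  have hB0 : 0 ≤ B := intervalIntegral.integral_nonneg hpi fun x _ => sq_nonneg _
  have heqI : ∀ x, z * (a Complex.I).fn x = Complex.I * (d : ℝ) * (a'' Complex.I).fn x +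
      Complex.I * ((-ζ + 2 * ‖u.fn x‖ ^ 2 : ℝ) : ℂ) * (a Complex.I).fn x + f Complex.I x -
      μ * (a Complex.I).fn x + ε * V.fn x * (a' Complex.I).fn x := heq _ hI
  have heqI' : ∀ x, z * (a (-Complex.I)).fn x =
      Complex.I * ((-d : ℝ) : ℂ) * (a'' (-Complex.I)).fn x +
      Complex.I * ((-(-ζ + 2 * ‖u.fn x‖ ^ 2) : ℝ) : ℂ) * (a (-Complex.I)).fn x +
      f (-Complex.I) x - μ * (a (-Complex.I)).fn x + ε * V.fn x * (a' (-Complex.I)).fn x := by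
    intro x
    rw [heq _ hI' x, Complex.ofReal_neg, Complex.ofReal_neg]
    ring
  have hfI' : ∀ x, ‖f (-Complex.I) x‖ ≤ M * ‖(a Complex.I).fn x‖ := fun x => by
    have := hfb _ hI' x
    rwa [neg_neg] at this
  have RA : (z.re + μ / 2) * A ≤ M * P :=
    energy_re (h1 _) (h2 _) hV (Per.continuous_fn _) (Per.continuous_fn _) (Per.continuous_fn _)
      (Per.periodic_fn _) V.periodic_fn heqI (hfb _ hI) hVN' hεN
  have RB : (z.re + μ / 2) * B ≤ M * P := by
    rw [← hP']
    exact energy_re (h1 _) (h2 _) hV (Per.continuous_fn _) (Per.continuous_fn _)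
      (Per.continuous_fn _) (Per.periodic_fn _) V.periodic_fn heqI' hfI' hVN' hεN
  have hAB : 0 < A ∨ 0 < B := by
    by_contra! hcon
    have eA : a Complex.I = 0 := eq_zero_of_innerL_self (by
      rw [← integral_norm_sq_eq_innerL]; exact le_antisymm hcon.1 hA0)
    have eB : a (-Complex.I) = 0 := eq_zero_of_innerL_self (by
      rw [← integral_norm_sq_eq_innerL]; exact le_antisymm hcon.2 hB0)
    apply hg
    refine (injective_iff_map_eq_zero _).1 (Per.K_injective ℂ) g (Per.ext_fn fun x => ?_)
    have xA : (Per.K ℂ g).fn x 0 + Complex.I * (Per.K ℂ g).fn x 1 = 0 :=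
      congrArg (fun w : Per ℂ => w.fn x) eA
    have xB : (Per.K ℂ g).fn x 0 + -Complex.I * (Per.K ℂ g).fn x 1 = 0 :=
      congrArg (fun w : Per ℂ => w.fn x) eB
    ext i
    fin_cases i
    · change (Per.K ℂ g).fn x 0 = 0
      linear_combination (xA + xB) / 2
    · change (Per.K ℂ g).fn x 1 = 0
      linear_combination (-Complex.I / 2) * (xA - xB) + (Per.K ℂ g).fn x 1 * hI
  have hP2 : P ≤ 1 / 2 * A + 1 / 2 * B :=
    (one_mul P).symm.le.trans (integral_young (γ := 1) _ _ fun X Y => by nlinarith [sq_nonneg (X - Y)])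
  have hy : ∀ X Y : ℝ, M * (X * Y) ≤ μ / 4 * X ^ 2 + M ^ 2 / μ * Y ^ 2 := by
    intro X Y
    have h6 : μ / 4 * X ^ 2 + M ^ 2 / μ * Y ^ 2 - M * (X * Y) = (μ / 2 * X - M * Y) ^ 2 / μ := by
      field_simp
      ring
    have h7 : 0 ≤ (μ / 2 * X - M * Y) ^ 2 / μ := by positivity
    linarith
  have y1 : M * P ≤ μ / 4 * A + M ^ 2 / μ * B := integral_young _ _ hy
  have y2 : M * P ≤ μ / 4 * B + M ^ 2 / μ * A := by
    rw [← hP']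
    exact integral_young _ _ hy
  have hC0 : 0 ≤ C' := by positivity
  have hre : z.re ≤ M := re_bound_arith hμ hM0 hA0 hB0 hAB RA RB hP2
  have him : |z.im| ≤ C' + 2 * (M ^ 2 / μ) := by
    rcases eq_or_ne z.im 0 with him0 | him0
    · rw [him0, abs_zero]
      positivity
    rcases lt_or_gt_of_ne (mul_ne_zero hd him0) with hs | hs
    · have IB : (|z.im| - C') * B ≤ M * P := by
        rw [← hP', hC', ← abs_neg d]
        exact energy_im (h1 _) (h2 _) (Per.continuous_fn _) (Per.continuous_fn _)
          (Per.periodic_fn _) heqI' hfI' (fun x => by rw [abs_neg]; exact hq x) hVN hε1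
          (by linarith)
      exact im_bound_arith hμ hz hB0 hA0 hAB.symm RA y1 IB
    · exact im_bound_arith hμ hz hA0 hB0 hAB RB y2 (energy_im (h1 _) (h2 _) (Per.continuous_fn _)
        (Per.continuous_fn _) (Per.periodic_fn _) heqI (hfb _ hI) hq hVN hε1 hs)
  refine (Complex.norm_le_abs_re_add_abs_im z).trans ?_
  rw [abs_of_nonneg hz]
  linarith

/-! ### Stability near the base point -/

/-- A real periodic function as a complex valued one. -/
def Per.ofReal : Per ℝ →L[ℝ] Per ℂ := Per.postcomp Complex.ofRealCLM

@[simp] lemma Per.ofReal_fn (V : Per ℝ) (x : ℝ) : (Per.ofReal V).fn x = (V.fn x : ℂ) := rfl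

lemma opMul_toC2 (V : Per ℝ) (f : Per ℂ) :
    opMul V (Per.toC2 f) = Per.toC2 (Per.ofReal V * f) := by
  refine Per.ext_fn fun x => ?_
  rw [opMul_fn, Per.toC2_fn, Per.toC2_fn, Per.mul_fn, Per.ofReal_fn]
  ext i
  fin_cases i <;> simp

lemma opS_of_deriv_solution {d ζ μ ε : ℝ} {V V' : Per ℝ} {u u' p : Per ℂ}
    (h : ∀ x, (opL d ζ μ u p).fn x = -(Complex.I * ε * V'.fn x * u'.fn x) -
      Complex.I * ε * V.fn x * (Per.D ℝ p).fn x) :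
    opS d ζ μ V u ε (Per.toC2 p) = -((ε : ℂ) • Per.toC2 (Per.ofReal V' * u')) := by
  rw [opS_toC2, opMul_toC2]
  refine Per.ext_fn fun x => ?_
  simp only [Per.add_fn, Per.neg_fn, Per.smul_fn, Per.toC2_fn, Per.mul_fn, Per.ofReal_fn, h]
  ext i
  fin_cases i <;> simp <;> ring

/-- If `z` is close to `-ε m`, then `Re z` and `ε m` have opposite signs. -/
lemma re_mul_neg_of_close {z : ℂ} {ε m η : ℝ} (hε : ε ≠ 0) (hη : 0 < η)
    (hη1 : η ≤ 1 / 4) (hηm : η ≤ |m| / 4)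
    (h : ‖z + (ε : ℂ) * (m : ℂ)‖ ≤ η * (‖z‖ + ‖(ε : ℂ)‖)) : z.re * (m * ε) < 0 := by
  by_contra! hcon
  have hm : 0 < |m| := by linarith
  have hε' : 0 < |ε| := abs_pos.2 hε
  rw [Complex.norm_real, Real.norm_eq_abs] at h
  have hsq : ‖z‖ ^ 2 + (|ε| * |m|) ^ 2 ≤ ‖z + (ε : ℂ) * (m : ℂ)‖ ^ 2 := by
    rw [← Complex.normSq_eq_norm_sq, ← Complex.normSq_eq_norm_sq, Complex.normSq_apply,
      Complex.normSq_apply, ← abs_mul, sq_abs]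
    simp
    nlinarith
  have h1 : ‖z‖ ≤ ‖z + (ε : ℂ) * (m : ℂ)‖ :=
    abs_le_of_sq_le_sq' (by nlinarith [sq_nonneg (|ε| * |m|)]) (norm_nonneg _) |>.2
  have h2 : |ε| * |m| ≤ ‖z + (ε : ℂ) * (m : ℂ)‖ :=
    abs_le_of_sq_le_sq' (by nlinarith [sq_nonneg ‖z‖]) (norm_nonneg _) |>.2
  have h3 : η * ‖z‖ ≤ 1 / 4 * ‖z‖ := mul_le_mul_of_nonneg_right hη1 (norm_nonneg _)
  have h4 : η * |ε| ≤ |m| / 4 * |ε| := mul_le_mul_of_nonneg_right hηm hε'.le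
  nlinarith [mul_pos hε' hm, norm_nonneg z]

lemma tendsto_opS {d ζ μ ε₀ : ℝ} {V : Per ℝ} {u : Per ℂ} {α : Type*} {l : Filter α}
    {f : α → Per ℂ} {e : α → ℝ} (hf : Tendsto f l (𝓝 u)) (he : Tendsto e l (𝓝 ε₀)) :
    Tendsto (fun t => opS d ζ μ V (f t) (e t)) l (𝓝 (opS d ζ μ V u ε₀)) := by
  have hc := continuous_opS d ζ μ V
  generalize opS d ζ μ V = F at hc ⊢
  exact (hc.tendsto (u, ε₀)).comp (hf.prodMk_nhds he)

theorem BasePoint.eventually_stability {d f₀ ζ μ m : ℝ} {u p φ : Per ℂ}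
    (hb : BasePoint d ζ μ u p φ) (hμ : 0 < μ) {V V' : Per ℝ}
    (hV : ∀ x, HasDerivAt V.fn (V'.fn x) x)
    (hA2 : ∀ z : ℂ, 0 ≤ z.re → z ≠ 0 → ∀ g : Per (Fin 2 → ℂ),
      opS d ζ μ V u 0 g = z • Per.K ℂ g → g = 0)
    (hm : pairR φ (Per.ofReal V' * Per.K ℝ p) = m) (hm0 : m ≠ 0) {G : ℝ → Per ℂ}
    (hG : ∀ᶠ ε in 𝓝 (0 : ℝ), ∀ x, stationaryExpr d f₀ ζ μ ε (V.fn x) ((Per.K ℝ (G ε)).fn x)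
      ((Per.D ℝ (G ε)).fn x) ((Per.K ℝ (G ε) - G ε).fn x) = 0)
    (hKG : Tendsto (fun ε => Per.K ℝ (G ε)) (𝓝 0) (𝓝 u))
    (hDG : Tendsto (fun ε => Per.D ℝ (G ε)) (𝓝 0) (𝓝 (Per.K ℝ p))) :
    ∀ᶠ ε in 𝓝 (0 : ℝ),
      (0 < m * ε → ∀ (z : ℂ) (g : Per (Fin 2 → ℂ)), g ≠ 0 →
        opS d ζ μ V (Per.K ℝ (G ε)) ε g = z • Per.K ℂ g → z.re ≤ 0) ∧
      (m * ε < 0 → ∃ (z : ℂ) (g : Per (Fin 2 → ℂ)), g ≠ 0 ∧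
        opS d ζ μ V (Per.K ℝ (G ε)) ε g = z • Per.K ℂ g ∧ 0 < z.re) := by
  set S : ℝ → Per (Fin 2 → ℂ) →L[ℂ] Per (Fin 2 → ℂ) :=
    fun ε => opS d ζ μ V (Per.K ℝ (G ε)) ε with hS
  have hSt : Tendsto S (𝓝 0) (𝓝 (opS d ζ μ V u 0)) :=
    tendsto_opS hKG tendsto_id
  set η := min (1 / 4) (|m| / 4) with hη
  have hη0 : 0 < η := by have := abs_pos.2 hm0; positivity
  obtain ⟨ρ, hρ, hasym⟩ := eigenvalue_asymptotics
    (q₀ := Per.toC2 (Per.ofReal V' * Per.K ℝ p))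
    (hb.pairC_opS V) hb.pairC_K_p (hb.isUnit_bordered V) hη0
  have hq0 : pairC φ (Per.toC2 (Per.ofReal V' * Per.K ℝ p)) = m := by rw [pairC_toC2, hm]
  have htrip : Tendsto (fun ε => (S ε, Per.toC2 (Per.D ℝ (G ε)),
      Per.toC2 (Per.ofReal V' * Per.D ℝ (G ε)))) (𝓝 0)
      (𝓝 (opS d ζ μ V u 0, Per.K ℂ (Per.toC2 p), Per.toC2 (Per.ofReal V' * Per.K ℝ p))) := by
    rw [Per.K_toC2]
    refine hSt.prodMk_nhds (Tendsto.prodMk_nhds ?_ ?_)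
    · exact (Per.toC2.continuous.tendsto _).comp hDG
    · exact (Per.toC2.continuous.tendsto _).comp (tendsto_const_nhds.mul hDG)
  have key : ∀ᶠ ε in 𝓝 (0 : ℝ), ∀ (z : ℂ) (g : Per (Fin 2 → ℂ)), ‖z‖ < ρ → ε ≠ 0 → g ≠ 0 →
      S ε g = z • Per.K ℂ g → z.re * (m * ε) < 0 := by
    filter_upwards [htrip.eventually hasym, hG] with ε h1 h2 z g hz hε hg hSg
    obtain ⟨p', e1, -, e3⟩ := exists_deriv_solution hb.d_ne hV h2
    have h3 := h1 z ε (Per.toC2 p') g hz (by rw [Per.K_toC2, e1])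
      (opS_of_deriv_solution e3) hg hSg
    rw [hq0] at h3
    exact re_mul_neg_of_close hε hη0 (min_le_left _ _) (min_le_right _ _) h3
  obtain ⟨ε₁, hε₁, C, hbound⟩ := exists_eigenvalue_bound hb.d_ne hμ hV (‖u‖ + 1)
  set Q : Set ℂ := Metric.closedBall 0 C ∩ {z | 0 ≤ z.re} ∩ {z | ρ ≤ ‖z‖} with hQ
  have hQc : IsCompact Q := by
    refine ((isCompact_closedBall _ _).inter_right ?_).inter_right ?_
    · exact isClosed_le continuous_const Complex.continuous_re
    · exact isClosed_le continuous_const continuous_norm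
  have hunit := hSt.eventually (eventually_forall_isUnit hQc (fun z hz =>
    hb.isUnit_pencil V (hA2 z hz.1.2 (by
      rintro rfl
      have := hz.2
      simp only [mem_ofPred_eq, norm_zero] at this
      linarith))))
  have hnorm : ∀ᶠ ε in 𝓝 (0 : ℝ), ‖Per.K ℝ (G ε)‖ < ‖u‖ + 1 :=
    hKG.norm.eventually (gt_mem_nhds (by linarith))
  have habs : ∀ᶠ ε in 𝓝 (0 : ℝ), |ε| < ε₁ := by
    have := (continuous_abs.tendsto (0 : ℝ)).eventually (gt_mem_nhds (by simpa using hε₁))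
    exact this
  have hex := hSt.eventually (eventually_exists_eigenvalue hb.toC2_p_ne_zero (hb.opS_p V)
    (hb.isUnit_bordered V) hρ)
  filter_upwards [key, hunit, hnorm, habs, hex] with ε h1 h2 h3 h4 h5
  refine ⟨fun hpos z g hg hSg => ?_, fun hneg => ?_⟩
  · by_contra! hz
    have hε : ε ≠ 0 := by rintro rfl; simp at hpos
    have hzC := hbound _ ε z g h3.le h4.le hz.le hg hSg
    by_cases hzρ : ‖z‖ < ρ
    · have := h1 z g hzρ hε hg hSg
      nlinarith
    · have hu := h2 z ⟨⟨by simpa using hzC, hz.le⟩, not_lt.1 hzρ⟩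
      apply hg
      have hinj := (ContinuousLinearMap.isUnit_iff_bijective.1 hu).1
      refine (injective_iff_map_eq_zero _).1 hinj g ?_
      change S ε g - z • Per.K ℂ g = 0
      rw [hSg, sub_self]
  · obtain ⟨z, g, hz, hg, hSg⟩ := h5
    have hε : ε ≠ 0 := by rintro rfl; simp at hneg
    refine ⟨z, g, hg, hSg, ?_⟩
    have := h1 z g hz hε hg hSg
    nlinarith

/-! ### Existence of the branch -/

section Translate

lemma Per.continuous_translate_left {E : Type*} [TopologicalSpace E] (f : Per E) : Continuous fun s : ℝ => Per.translate s f :=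
  Per.continuous_translate.comp (continuous_id.prodMk continuous_const)

variable {E : Type*} [NormedAddCommGroup E] [NormedSpace ℝ E] [CompleteSpace E]

lemma Per.hasDerivAt_translate {f f' : Per E} (h : ∀ x, HasDerivAt f.fn (f'.fn x) x) (s : ℝ) :
    HasDerivAt (fun t => Per.translate t f) (Per.translate s f') s := by
  have hc := Per.continuous_translate_left f'
  have heq : (fun t => Per.translate t f) = fun t =>
      f + ∫ y in (0 : ℝ)..t, Per.translate y f' := by
    funext t
    refine Per.ext_fn fun x => ?_
    have h1 := (ContinuousMap.evalCLM ℝ (x : AddCircle (2 * π))).intervalIntegral_comp_comm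
      (hc.intervalIntegrable (μ := volume) 0 t)
    have h2 : (∫ y in (0 : ℝ)..t, Per.translate y f').fn x =
        ∫ y in (0 : ℝ)..t, (Per.translate y f').fn x := h1.symm
    have h3 : ∫ y in (0 : ℝ)..t, (Per.translate y f').fn x = f.fn (x + t) - f.fn (x + 0) := by
      simp only [Per.translate_fn]
      refine intervalIntegral.integral_eq_sub_of_hasDerivAt
        (fun y _ => (h (x + y)).comp_const_add x y) ?_
      refine Continuous.intervalIntegrable ?_ _ _
      exact f'.continuous_fn.comp (by fun_prop)
    rw [Per.add_fn, h2, h3, Per.translate_fn, add_zero]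
    abel
  rw [heq]
  exact ((hc.integral_hasStrictDerivAt 0 s).hasDerivAt).const_add f

lemma Per.contDiff_translate {f f' : Per E} (h : ∀ x, HasDerivAt f.fn (f'.fn x) x) :
    ContDiff ℝ 1 fun t => Per.translate t f := by
  rw [contDiff_one_iff_deriv]
  refine ⟨fun s => (Per.hasDerivAt_translate h s).differentiableAt, ?_⟩
  rw [show deriv (fun t => Per.translate t f) = fun s => Per.translate s f' from
    funext fun s => (Per.hasDerivAt_translate h s).deriv]
  exact Per.continuous_translate_left f'

end Translate

/-- Pointwise complex conjugation. -/
def Per.conj : Per ℂ →L[ℝ] Per ℂ := Per.postcomp Complex.conjCLE.toContinuousLinearMap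

@[simp] lemma Per.conj_fn (f : Per ℂ) (x : ℝ) : (Per.conj f).fn x = (starRingEnd ℂ) (f.fn x) := rfl

/-- Multiplication by `i`. -/
def Per.mulI : Per ℂ →L[ℝ] Per ℂ := Per.postcomp (ContinuousLinearMap.mul ℝ ℂ Complex.I)

@[simp] lemma Per.mulI_fn (f : Per ℂ) (x : ℝ) : (Per.mulI f).fn x = Complex.I * f.fn x := rfl

lemma pairR_eq_innerL_mulI (φ f : Per ℂ) : pairR φ f = innerL φ (Per.mulI f) := rfl

/-- The stationary equation for `u + ε K g` in the frame translated by `pairR φ (K g)`, divided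
by `ε`. -/
def branchMap (d ζ μ : ℝ) (V : Per ℝ) (u p φ : Per ℂ) (t : ℝ × Per ℂ) : Per ℂ :=
  opL d ζ μ u t.2 + Per.mulI (Per.ofReal (Per.translate (pairR φ (Per.K ℝ t.2)) V) *
      (Per.K ℝ p + t.1 • Per.D ℝ t.2))
    - t.1 • ((2 : ℝ) • (u * Per.K ℝ t.2 * Per.conj (Per.K ℝ t.2)) +
        Per.conj u * (Per.K ℝ t.2 * Per.K ℝ t.2))
    - t.1 ^ 2 • (Per.K ℝ t.2 * Per.K ℝ t.2 * Per.conj (Per.K ℝ t.2))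

lemma contDiff_branchMap (d ζ μ : ℝ) {V V' : Per ℝ} (hV : ∀ x, HasDerivAt V.fn (V'.fn x) x)
    (u p φ : Per ℂ) : ContDiff ℝ 1 (branchMap d ζ μ V u p φ) := by
  have h1 : ContDiff ℝ 1 fun t : ℝ × Per ℂ => Per.translate (pairR φ (Per.K ℝ t.2)) V :=
    (Per.contDiff_translate hV).comp
      ((pairR φ ∘L Per.K ℝ ∘L ContinuousLinearMap.snd ℝ ℝ (Per ℂ)).contDiff)
  unfold branchMap
  fun_prop

lemma hasFDerivAt_branchMap (d ζ μ : ℝ) {V V' : Per ℝ} (hV : ∀ x, HasDerivAt V.fn (V'.fn x) x)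
    (u p φ g : Per ℂ) (hg : pairR φ (Per.K ℝ g) = 0) :
    HasFDerivAt (fun w => branchMap d ζ μ V u p φ (0, w))
      (opL d ζ μ u + (pairR φ).smulRight (Per.mulI (Per.ofReal V' * Per.K ℝ p)) ∘L Per.K ℝ) g := by
  have e : (fun w => branchMap d ζ μ V u p φ (0, w)) = fun w => opL d ζ μ u w +
      Per.mulI (Per.ofReal (Per.translate (pairR φ (Per.K ℝ w)) V) * Per.K ℝ p) := by
    funext w
    simp [branchMap]
  rw [e]
  have h0 : HasDerivAt (fun t => Per.mulI (Per.ofReal (Per.translate t V) * Per.K ℝ p))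
      (Per.mulI (Per.ofReal (Per.translate 0 V') * Per.K ℝ p)) ((pairR φ ∘L Per.K ℝ) g) := by
    rw [ContinuousLinearMap.comp_apply, hg]
    exact Per.mulI.hasFDerivAt.comp_hasDerivAt 0
      ((Per.ofReal.hasFDerivAt.comp_hasDerivAt 0 (Per.hasDerivAt_translate hV 0)).mul_const _)
  have h1 := h0.hasFDerivAt.comp g ((pairR φ ∘L Per.K ℝ).hasFDerivAt)
  refine ((opL d ζ μ u).hasFDerivAt.add h1).congr_fderiv ?_
  have h2 : Per.translate 0 V' = V' := Per.ext_fn fun x => by simp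
  rw [h2]
  ext1 w
  rfl

lemma BasePoint.isUnit_realBordered {d ζ μ m : ℝ} {u p φ : Per ℂ} (hb : BasePoint d ζ μ u p φ)
    {w : Per ℂ} (hm : innerL φ w = m) (hm0 : m ≠ 0) :
    IsUnit (opL d ζ μ u + (pairR φ).smulRight w ∘L Per.K ℝ) := by
  refine isUnit_opL_add hb.d_ne ζ μ u _ fun g hg => ?_
  have hg' : opL d ζ μ u g + pairR φ (Per.K ℝ g) • w = 0 := hg
  have h1 := congrArg (innerL φ) hg'
  rw [map_add, hb.adj, map_smul, hm, map_zero, zero_add, smul_eq_mul,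
    mul_eq_zero_iff_right hm0] at h1
  rw [h1, zero_smul, add_zero] at hg'
  obtain ⟨c, rfl⟩ := hb.ker g hg'
  rw [map_smul, map_smul, hb.norm_eq, smul_eq_mul, mul_one] at h1
  rw [h1, zero_smul]

theorem BasePoint.exists_branch {d f₀ ζ μ m : ℝ} {g₀ p φ : Per ℂ}
    (hb : BasePoint d ζ μ (Per.K ℝ g₀) p φ) (hp : Per.K ℝ p = Per.D ℝ g₀) {V V' : Per ℝ}
    (hV : ∀ x, HasDerivAt V.fn (V'.fn x) x)
    (hg₀ : ∀ x, stationaryExpr d f₀ ζ μ 0 (V.fn x) ((Per.K ℝ g₀).fn x)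
      ((Per.D ℝ g₀).fn x) ((Per.K ℝ g₀ - g₀).fn x) = 0)
    (hzero : pairR φ (Per.ofReal V * Per.K ℝ p) = 0)
    (hm : pairR φ (Per.ofReal V' * Per.K ℝ p) = m) (hm0 : m ≠ 0) :
    ∃ r > 0, ∃ (h : ℝ → Per ℂ) (s : ℝ → ℝ) (C : ℝ), s 0 = 0 ∧
      (∀ ε ∈ Ioo (-r) r, ContinuousAt h ε ∧ ContinuousAt s ε ∧ |s ε| ≤ C * |ε| ∧ ‖h ε‖ ≤ C ∧
        ∀ x, stationaryExpr d f₀ ζ μ ε (V.fn (x + s ε)) ((Per.K ℝ (g₀ + ε • h ε)).fn x)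
          ((Per.D ℝ (g₀ + ε • h ε)).fn x)
          ((Per.K ℝ (g₀ + ε • h ε) - (g₀ + ε • h ε)).fn x) = 0) := by
  set u := Per.K ℝ g₀ with hu
  set B := opL d ζ μ u + (pairR φ).smulRight (Per.mulI (Per.ofReal V' * Per.K ℝ p)) ∘L Per.K ℝ
    with hB
  have hBu : IsUnit B := hb.isUnit_realBordered (by rw [← pairR_eq_innerL_mulI, hm]) hm0
  obtain ⟨g₁, hg₁⟩ := (ContinuousLinearMap.isUnit_iff_bijective.1 hBu).2
    (-Per.mulI (Per.ofReal V * Per.K ℝ p))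
  have hg₁' : opL d ζ μ u g₁ + pairR φ (Per.K ℝ g₁) • Per.mulI (Per.ofReal V' * Per.K ℝ p) =
    -Per.mulI (Per.ofReal V * Per.K ℝ p) := hg₁
  have hs0 : pairR φ (Per.K ℝ g₁) = 0 := by
    have h1 := congrArg (innerL φ) hg₁'
    rw [map_add, hb.adj, map_smul, map_neg, ← pairR_eq_innerL_mulI, ← pairR_eq_innerL_mulI, hm,
      hzero, neg_zero, zero_add, smul_eq_mul, mul_eq_zero_iff_right hm0] at h1
    exact h1
  rw [hs0, zero_smul, add_zero] at hg₁'
  have hF0 : branchMap d ζ μ V u p φ (0, g₁) = 0 := by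
    have h2 : Per.translate 0 V = V := Per.ext_fn fun x => by simp
    simp [branchMap, hs0, hg₁', h2]
  have hs : HasStrictFDerivAt (branchMap d ζ μ V u p φ)
      (fderiv ℝ (branchMap d ζ μ V u p φ) (0, g₁)) (0, g₁) :=
    (contDiff_branchMap d ζ μ hV u p φ).contDiffAt.hasStrictFDerivAt (by norm_num)
  have hpart : fderiv ℝ (branchMap d ζ μ V u p φ) (0, g₁) ∘L .inr ℝ ℝ (Per ℂ) = B :=
    (hs.hasFDerivAt.comp g₁ (hasFDerivAt_prodMk_right (0 : ℝ) g₁)).unique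
      (hasFDerivAt_branchMap d ζ μ hV u p φ g₁ hs0)
  have hinv : (fderiv ℝ (branchMap d ζ μ V u p φ) (0, g₁) ∘L .inr ℝ ℝ (Per ℂ)).IsInvertible := by
    rw [hpart]
    obtain ⟨W, hW⟩ := hBu
    exact ⟨ContinuousLinearEquiv.ofUnit W, by rw [← hW]; rfl⟩
  have he := hs.eventually_apply_implicitFunctionOfProdDomain hinv
  have ht := hs.tendsto_implicitFunctionOfProdDomain hinv
  obtain ⟨L, T, hT, hL⟩ :=
    (hs.hasStrictFDerivAt_implicitFunctionOfProdDomain hinv).exists_lipschitzOnWith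
  have hself := (hs.hasStrictFDerivAt_implicitFunctionOfProdDomain hinv).continuousAt
  set h := hs.implicitFunctionOfProdDomain hinv with hh
  simp only at he ht hT hself
  have h0 : h 0 = g₁ := tendsto_nhds_unique hself ht
  obtain ⟨r, hr, hrT⟩ := Metric.mem_nhds_iff.1 (inter_mem hT he)
  have hball : ∀ ε ∈ Ioo (-r) r, ε ∈ Metric.ball (0 : ℝ) r := fun ε hε => by
    rw [mem_ball_zero_iff, Real.norm_eq_abs, abs_lt]
    exact hε
  have hcont : ∀ ε ∈ Ioo (-r) r, ContinuousAt h ε := fun ε hε =>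
    hL.continuousOn.continuousAt (mem_of_superset (Metric.isOpen_ball.mem_nhds (hball ε hε))
      fun y hy => (hrT hy).1)
  have hLip : ∀ ε ∈ Ioo (-r) r, ‖h ε - g₁‖ ≤ L * |ε| := fun ε hε => by
    have := hL.dist_le_mul ε (hrT (hball ε hε)).1 0 (hrT (Metric.mem_ball_self hr)).1
    rwa [h0, dist_eq_norm, dist_eq_norm, sub_zero, Real.norm_eq_abs] at this
  set c := ‖pairR φ ∘L Per.K ℝ‖ with hc
  refine ⟨r, hr, h, fun ε => pairR φ (Per.K ℝ (h ε)), c * L + (L * r + ‖g₁‖), ?_, ?_⟩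
  · simp only [h0, hs0]
  · intro ε hε
    have habs : |ε| < r := abs_lt.2 hε
    refine ⟨hcont ε hε, ?_, ?_, ?_, ?_⟩
    · exact ((pairR φ ∘L Per.K ℝ).continuous.continuousAt).comp (hcont ε hε)
    · have h1 : pairR φ (Per.K ℝ (h ε)) = (pairR φ ∘L Per.K ℝ) (h ε - g₁) := by
        simp [hs0]
      change |pairR φ (Per.K ℝ (h ε))| ≤ _
      rw [h1]
      calc |(pairR φ ∘L Per.K ℝ) (h ε - g₁)| ≤ c * ‖h ε - g₁‖ := by
            rw [← Real.norm_eq_abs]; exact ContinuousLinearMap.le_opNorm _ _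
        _ ≤ c * (L * |ε|) := mul_le_mul_of_nonneg_left (hLip ε hε) (norm_nonneg _)
        _ = c * L * |ε| := by ring
        _ ≤ _ := by
          refine mul_le_mul_of_nonneg_right ?_ (abs_nonneg _)
          have : 0 ≤ L * r + ‖g₁‖ := by positivity
          linarith
    · have h1 : ‖h ε‖ ≤ ‖h ε - g₁‖ + ‖g₁‖ := by
        simpa using norm_add_le (h ε - g₁) g₁
      have h2 : (L : ℝ) * |ε| ≤ L * r := mul_le_mul_of_nonneg_left habs.le L.2
      have h3 : 0 ≤ c * L := by positivity
      linarith [hLip ε hε]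
    · intro x
      have h1 : branchMap d ζ μ V u p φ (ε, h ε) = 0 := ((hrT (hball ε hε)).2).trans hF0
      have h2 := congrArg (fun f : Per ℂ => f.fn x) h1
      simp only [branchMap, Per.add_fn, Per.sub_fn, Per.smul_fn, Per.mulI_fn, Per.mul_fn,
        Per.ofReal_fn, Per.translate_fn, Per.conj_fn, Per.zero_fn, hp, opL_fn,
        ofReal_norm_sq, Complex.real_smul] at h2
      have h3 := hg₀ x
      simp only [stationaryExpr, map_add, map_smul, Per.add_fn, Per.sub_fn, Per.smul_fn,
        ofReal_norm_sq, Complex.real_smul, ← hu, map_mul, Complex.conj_ofReal] at h3 ⊢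
      push_cast at h2 h3 ⊢
      linear_combination h3 + ε * h2

/-! ### Consequences of the spectral assumption -/

lemma innerL_comm (f g : Per ℂ) : innerL g f = innerL f g := by
  rw [innerL_eq_integral, innerL_eq_integral]
  refine intervalIntegral.integral_congr fun x _ => ?_
  ring

lemma integral_sub_eq_zero_of_deriv {F F' F₁ F₂ : ℝ → ℝ} (hF : ∀ x, HasDerivAt F (F' x) x)
    (hp : Function.Periodic F (2 * π)) (h1 : Continuous F₁) (h2 : Continuous F₂)
    (h : ∀ x, F₁ x - F₂ x = F' x) : ∫ x in (-π)..π, F₁ x = ∫ x in (-π)..π, F₂ x := by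
  have hc : Continuous F' := by
    rw [← funext h]
    exact h1.sub h2
  have := integral_deriv_periodic_eq_zero hF hc hp
  rw [← funext h, intervalIntegral.integral_sub (h1.intervalIntegrable _ _)
    (h2.intervalIntegrable _ _)] at this
  linarith

/-- The antisymmetric part of `L_u` is multiplication by `-iμ`. -/
lemma innerL_opL (d ζ μ : ℝ) (u g h : Per ℂ) :
    innerL (Per.K ℝ h) (opL d ζ μ u g) = innerL (Per.K ℝ g) (opL d ζ μ u h)
      - 2 * μ * pairR (Per.K ℝ h) (Per.K ℝ g) := by
  have e : innerL (Per.K ℝ h) (opL d ζ μ u g + (2 * μ) • Per.mulI (Per.K ℝ g)) =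
      innerL (Per.K ℝ g) (opL d ζ μ u h) := by
    rw [innerL_eq_integral, innerL_eq_integral]
    refine integral_sub_eq_zero_of_deriv (F := fun x =>
      -d * (((Per.D ℝ g).fn x).re * ((Per.K ℝ h).fn x).re +
        ((Per.D ℝ g).fn x).im * ((Per.K ℝ h).fn x).im) +
      d * (((Per.D ℝ h).fn x).re * ((Per.K ℝ g).fn x).re +
        ((Per.D ℝ h).fn x).im * ((Per.K ℝ g).fn x).im)) (fun x =>
      ((hasDerivAt_re_mul_conj (Per.hasDerivAt_D ℝ g x) (Per.hasDerivAt_K ℝ h x)).const_mul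
        (-d)).add ((hasDerivAt_re_mul_conj (Per.hasDerivAt_D ℝ h x)
          (Per.hasDerivAt_K ℝ g x)).const_mul d)) (fun x => ?_) ?_ ?_ (fun x => ?_)
    · simp only [Per.periodic_fn _ x]
    · have h1 := (opL d ζ μ u g + (2 * μ) • Per.mulI (Per.K ℝ g)).continuous_fn
      have h2 := (Per.K ℝ h).continuous_fn
      fun_prop
    · have h1 := (opL d ζ μ u h).continuous_fn
      have h2 := (Per.K ℝ g).continuous_fn
      fun_prop
    · simp only [Per.add_fn, Per.smul_fn, Per.mulI_fn, opL_fn]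
      simp [pow_two]
      ring
  rw [← e, map_add, map_smul, ← pairR_eq_innerL_mulI, smul_eq_mul]
  ring

namespace BasePoint

variable {d ζ μ : ℝ} {u p φ : Per ℂ}

lemma K_p_ne_zero (h : BasePoint d ζ μ u p φ) : Per.K ℝ p ≠ 0 := by
  intro h0
  have := h.norm_eq
  rw [h0, map_zero] at this
  exact zero_ne_one this

lemma innerL_K_p_ne_zero (h : BasePoint d ζ μ u p φ) :
    innerL (Per.K ℝ p) (Per.K ℝ p) ≠ 0 := fun h0 => h.K_p_ne_zero (eq_zero_of_innerL_self h0)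

lemma innerL_K_p_opL (h : BasePoint d ζ μ u p φ) (g : Per ℂ) :
    innerL (Per.K ℝ p) (opL d ζ μ u g) = -(2 * μ) * pairR (Per.K ℝ p) (Per.K ℝ g) := by
  rw [innerL_opL, h.opL_p, map_zero]
  ring

lemma mu_ne_zero (h : BasePoint d ζ μ u p φ) : μ ≠ 0 := by
  rintro rfl
  set w := Per.K ℝ p with hw
  have hw0 : innerL w w ≠ 0 := h.innerL_K_p_ne_zero
  have horth : ∀ g, innerL w (opL d ζ 0 u g) = 0 := fun g => by
    rw [h.innerL_K_p_opL]; ring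
  have hunit : IsUnit (opL d ζ 0 u + (innerL w).smulRight w ∘L Per.K ℝ) := by
    refine isUnit_opL_add h.d_ne ζ 0 u _ fun g hg => ?_
    have hg' : opL d ζ 0 u g + innerL w (Per.K ℝ g) • w = 0 := hg
    have h1 := congrArg (innerL w) hg'
    rw [map_add, horth, map_smul, map_zero, zero_add, smul_eq_mul,
      mul_eq_zero_iff_right hw0] at h1
    rw [h1, zero_smul, add_zero] at hg'
    obtain ⟨c, rfl⟩ := h.ker g hg'
    rw [map_smul, map_smul, smul_eq_mul, mul_eq_zero_iff_right hw0] at h1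
    rw [h1, zero_smul]
  set c := innerL φ w / innerL w w with hc
  obtain ⟨g, hg⟩ := (ContinuousLinearMap.isUnit_iff_bijective.1 hunit).2 (φ - c • w)
  have hg' : opL d ζ 0 u g + innerL w (Per.K ℝ g) • w = φ - c • w := hg
  have e1 : innerL φ (φ - c • w) = innerL w (Per.K ℝ g) * innerL φ w := by
    rw [← hg', map_add, h.adj, map_smul, zero_add, smul_eq_mul]
  have e2 : innerL w (φ - c • w) = innerL w (Per.K ℝ g) * innerL w w := by
    rw [← hg', map_add, horth, map_smul, zero_add, smul_eq_mul]
  have e3 : innerL (φ - c • w) (φ - c • w) = 0 := by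
    conv_lhs => rw [map_sub, map_smul, innerL_comm, innerL_comm w, e1, e2]
    rw [smul_eq_mul, hc]
    field_simp
    ring
  have e4 : φ = c • w := sub_eq_zero.1 (eq_zero_of_innerL_self e3)
  have e5 := h.norm_eq
  rw [pairR_eq_integral, e4] at e5
  have e6 : ∀ x, (w.fn x).re * ((c • w).fn x).im - (w.fn x).im * ((c • w).fn x).re = 0 := by
    intro x
    simp
    ring
  simp only [← hw, e6] at e5
  simp at e5

/-- Eigenvalues at the base point lie in the spectrum. -/
lemma mem_spectrumL2_of_opS {V : Per ℝ} {z : ℂ} {g : Per (Fin 2 → ℂ)} (hg : g ≠ 0)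
    (h : opS d ζ μ V u 0 g = z • Per.K ℂ g) :
    z ∈ spectrumL2 (linearization d ζ μ 0 V.fn u.fn) := by
  intro hz
  obtain ⟨v, -, hv⟩ := hz.1 0 MemLp.zero'
  have h1 := hv (Per.K ℂ g).fn ⟨memH2per_K ℂ g, Eventually.of_forall fun x => by
    simp only [Pi.sub_apply, Pi.smul_apply, Pi.zero_apply]
    rw [← opS_fn_eq_linearization, h]
    exact sub_self _⟩
  have h2 := hv (Per.K ℂ (0 : Per (Fin 2 → ℂ))).fn ⟨memH2per_K ℂ 0, Eventually.of_forall fun x => by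
    simp only [Pi.sub_apply, Pi.smul_apply, Pi.zero_apply]
    rw [← opS_fn_eq_linearization, map_zero, map_zero]
    simp⟩
  exact hg (Per.K_injective ℂ (Per.fn_injective (h1.trans h2.symm)))

lemma neg_two_mu_mem_spectrumL2 (h : BasePoint d ζ μ u p φ) (V : Per ℝ) :
    ((-(2 * μ) : ℝ) : ℂ) ∈ spectrumL2 (linearization d ζ μ 0 V.fn u.fn) := by
  intro hz
  set F : Per (Fin 2 → ℂ) := Per.toC2 (-Per.mulI (Per.K ℝ p)) with hF
  have hFL : MemLp F.fn 2 periodMeasure :=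
    MemLp.of_bound F.continuous_fn.aestronglyMeasurable ‖F‖
      (Eventually.of_forall fun x => Per.norm_fn_le _ x)
  obtain ⟨v, ⟨hv, hvF⟩, -⟩ := hz.1 F.fn hFL
  have cv := hv.continuous
  have cF := F.continuous_fn
  obtain ⟨g, hg1, hg2⟩ := exists_eq_K_of_linearization (ζ := ζ) (μ := μ) (ε := 0) h.d_ne V u hv
    (F := fun x => ((-(2 * μ) : ℝ) : ℂ) • v x - F.fn x) (by fun_prop)
    (fun x => by simp only [hv.1 x, F.periodic_fn x]) (by
      filter_upwards [hvF] with x hx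
      rw [← hx]
      simp)
  have hS : opS d ζ μ V u 0 g = ((-(2 * μ) : ℝ) : ℂ) • Per.K ℂ g - F :=
    Per.ext_fn fun x => by rw [hg2, hg1]; rfl
  set a := Per.postcomp reVec g
  set b := Per.postcomp imVec g
  have hK : Per.K ℂ g = Per.toC2 (Per.K ℝ a) + Complex.I • Per.toC2 (Per.K ℝ b) := by
    conv_lhs => rw [← Per.decompose g]
    rw [map_add, map_smul, Per.K_toC2, Per.K_toC2]
  rw [opS_decompose, hK, hF] at hS
  have hre : Per.toC2 (-Complex.I • opL d ζ μ u a + (2 * μ) • Per.K ℝ a - Per.mulI (Per.K ℝ p)) +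
      Complex.I • Per.toC2 (-Complex.I • opL d ζ μ u b + (2 * μ) • Per.K ℝ b) = 0 := by
    have hx := fun x => congrArg (fun f : Per (Fin 2 → ℂ) => f.fn x) hS
    refine Per.ext_fn fun x => ?_
    have h1 := hx x
    simp only [Per.add_fn, Per.sub_fn, Per.smul_fn, Per.toC2_fn, Per.neg_fn, map_add, map_sub,
      map_smul, map_neg, Per.zero_fn] at h1 ⊢
    ext i
    have h2 := congrFun h1 i
    simp only [Pi.add_apply, Pi.sub_apply, Pi.smul_apply, Pi.neg_apply, smul_eq_mul,
      Complex.real_smul, Pi.zero_apply] at h2 ⊢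
    push_cast at h2 ⊢
    linear_combination h2
  have h1 := (Per.eq_zero_of_toC2_add hre).1
  have h2 : opL d ζ μ u a = -(2 * μ) • Per.mulI (Per.K ℝ a) - Per.K ℝ p := by
    refine Per.ext_fn fun x => ?_
    have h3 := congrArg (fun f : Per ℂ => f.fn x) h1
    simp only [Per.add_fn, Per.sub_fn, Per.smul_fn, Per.mulI_fn, Per.zero_fn, smul_eq_mul,
      Complex.real_smul] at h3 ⊢
    push_cast at h3 ⊢
    linear_combination Complex.I * h3 + ((opL d ζ μ u a).fn x + (Per.K ℝ p).fn x) *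
      Complex.I_mul_I
  have h3 := h.innerL_K_p_opL a
  rw [h2, map_sub, map_smul, ← pairR_eq_innerL_mulI, smul_eq_mul] at h3
  exact h.innerL_K_p_ne_zero (by linarith)

lemma mu_pos (h : BasePoint d ζ μ u p φ) {V : Per ℝ}
    (hA2 : AssumptionA2 (linearization d ζ μ 0 V.fn u.fn)) : 0 < μ := by
  obtain ⟨-, ξ, hξ, hs⟩ := hA2
  rcases hs (h.neg_two_mu_mem_spectrumL2 V) with h1 | h1
  · have h2 : ((-(2 * μ) : ℝ) : ℂ).re ≤ -ξ := h1
    rw [Complex.ofReal_re] at h2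
    linarith
  · have h2 : ((-(2 * μ) : ℝ) : ℂ) = 0 := h1
    rw [Complex.ofReal_eq_zero] at h2
    exact absurd (by linarith) h.mu_ne_zero

lemma eq_zero_of_opS_eq {V : Per ℝ} (hA2 : AssumptionA2 (linearization d ζ μ 0 V.fn u.fn)) {z : ℂ}
    (hz : 0 ≤ z.re) (hz0 : z ≠ 0) {g : Per (Fin 2 → ℂ)}
    (h : opS d ζ μ V u 0 g = z • Per.K ℂ g) : g = 0 := by
  obtain ⟨-, ξ, hξ, hs⟩ := hA2
  by_contra hg
  rcases hs (mem_spectrumL2_of_opS hg h) with h1 | h1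
  · have h2 : z.re ≤ -ξ := h1
    linarith
  · exact hz0 h1

end BasePoint

/-! ### Translations -/

namespace Per

lemma hasDerivAt_translate_fn {E : Type*} [NormedAddCommGroup E] [NormedSpace ℝ E] {f f' : Per E}
    (hf : ∀ x, HasDerivAt f.fn (f'.fn x) x) (s x : ℝ) :
    HasDerivAt (translate s f).fn ((translate s f').fn x) x := by
  rw [funext (translate_fn s f), translate_fn]
  exact (hf (x + s)).comp_add_const x s

section

variable {E : Type*} [NormedAddCommGroup E] [NormedSpace ℝ E] [CompleteSpace E]
  (𝕜 : Type*) [RCLike 𝕜] [NormedSpace 𝕜 E] [SMulCommClass ℝ 𝕜 E]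

lemma K_D_translate (s : ℝ) (g : Per E) :
    K 𝕜 (translate s g) = translate s (K 𝕜 g) ∧ D 𝕜 (translate s g) = translate s (D 𝕜 g) := by
  have h1 := hasDerivAt_translate_fn (hasDerivAt_K 𝕜 g) s
  have h2 := hasDerivAt_translate_fn (hasDerivAt_D 𝕜 g) s
  have h3 : translate s (K 𝕜 g) - translate s (K 𝕜 g - g) = translate s g :=
    ext_fn fun x => by simp
  have := K_of_hasDerivAt 𝕜 h1 h2
  rwa [h3] at this

end

lemma translate_neg_translate {E : Type*} [NormedAddCommGroup E] (s : ℝ) (f : Per E) :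
    translate (-s) (translate s f) = f := ext_fn fun x => by simp

lemma norm_translate_le {E : Type*} [NormedAddCommGroup E] (s : ℝ) (f : Per E) :
    ‖translate s f‖ ≤ ‖f‖ :=
  norm_le_of_fn (norm_nonneg f) fun x => by
    rw [translate_fn]
    exact norm_fn_le f _

lemma norm_translate_sub_le {s t L : ℝ} {f : Per ℂ} (hL : 0 ≤ L)
    (hf : ∀ x y, ‖f.fn x - f.fn y‖ ≤ L * |x - y|) :
    ‖translate s f - translate t f‖ ≤ L * |s - t| :=
  norm_le_of_fn (by positivity) fun x => by
    rw [sub_fn, translate_fn, translate_fn]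
    have := hf (x + s) (x + t)
    rwa [add_sub_add_left_eq_sub] at this

end Per

lemma translate_opS (d ζ μ s : ℝ) (V : Per ℝ) (u : Per ℂ) (ε : ℝ) (g : Per (Fin 2 → ℂ)) :
    opS d ζ μ (Per.translate s V) (Per.translate s u) ε (Per.translate s g) =
      Per.translate s (opS d ζ μ V u ε g) :=
  Per.ext_fn fun x => by
    simp only [Per.translate_fn, opS_fn, Per.sub_fn, (Per.K_D_translate ℂ s g).1,
      (Per.K_D_translate ℂ s g).2]

lemma opS_zero_eq (d ζ μ : ℝ) (V W : Per ℝ) (u : Per ℂ) (g : Per (Fin 2 → ℂ)) :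
    opS d ζ μ V u 0 g = opS d ζ μ W u 0 g :=
  Per.ext_fn fun x => by
    simp only [opS_fn, linExpr, zero_mul]

/-- The spectral problem is invariant under translations. -/
lemma exists_opS_translate_iff (d ζ μ s : ℝ) (V : Per ℝ) (u : Per ℂ) (ε : ℝ) (z : ℂ) :
    (∃ g ≠ 0, opS d ζ μ (Per.translate s V) (Per.translate s u) ε g = z • Per.K ℂ g) ↔
      ∃ g ≠ 0, opS d ζ μ V u ε g = z • Per.K ℂ g := by
  have key : ∀ (t : ℝ) (W : Per ℝ) (v : Per ℂ), (∃ g ≠ 0, opS d ζ μ W v ε g = z • Per.K ℂ g) →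
      ∃ g ≠ 0, opS d ζ μ (Per.translate t W) (Per.translate t v) ε g = z • Per.K ℂ g := by
    rintro t W v ⟨g, hg, h⟩
    refine ⟨Per.translate t g, fun h0 => hg ?_, ?_⟩
    · rw [← Per.translate_neg_translate t g, h0]
      exact Per.ext_fn fun x => by simp
    · rw [translate_opS, h, (Per.K_D_translate ℂ t g).1]
      exact Per.ext_fn fun x => by simp
  refine ⟨fun h => ?_, key s V u⟩
  have := key (-s) _ _ h
  rwa [Per.translate_neg_translate, Per.translate_neg_translate] at this

/-! ### The norm of `H²` -/

lemma integral_norm_sq_le (f : Per ℂ) :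
    ∫ x in (-π)..π, ‖f.fn x‖ ^ 2 ≤ 2 * π * ‖f‖ ^ 2 := by
  have hc := f.continuous_fn
  have h := intervalIntegral.integral_mono_on (a := -π) (b := π) (μ := volume)
    (f := fun x => ‖f.fn x‖ ^ 2) (g := fun _ => ‖f‖ ^ 2) (by linarith [Real.pi_pos])
    ((by fun_prop : Continuous _).intervalIntegrable _ _) (by simp)
    (fun x _ => pow_le_pow_left₀ (norm_nonneg _) (Per.norm_fn_le f x) 2)
  rw [intervalIntegral.integral_const, smul_eq_mul] at h
  linarith

lemma integral_norm_sq_nonneg (f : ℝ → ℂ) : 0 ≤ ∫ x in (-π)..π, ‖f x‖ ^ 2 :=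
  intervalIntegral.integral_nonneg (by linarith [Real.pi_pos]) fun _ _ => by positivity

lemma exists_H2norm_K_le : ∃ C : ℝ, 0 ≤ C ∧ ∀ g : Per ℂ, H2norm (Per.K ℝ g).fn ≤ C * ‖g‖ := by
  obtain ⟨B, hB0, hB⟩ : ∃ B : ℝ, 0 ≤ B ∧ ∀ g : Per ℂ, ‖Per.K ℝ g‖ ≤ B * ‖g‖ ∧
      ‖Per.D ℝ g‖ ≤ B * ‖g‖ ∧ ‖Per.K ℝ g - g‖ ≤ B * ‖g‖ := by
    obtain ⟨a, ha, hK⟩ := (Per.K ℝ : Per ℂ →L[ℝ] Per ℂ).bound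
    obtain ⟨b, hb, hD⟩ := (Per.D ℝ : Per ℂ →L[ℝ] Per ℂ).bound
    refine ⟨a + b + 1, by positivity, fun g => ?_⟩
    have h1 := hK g
    have h2 := hD g
    have h3 := norm_sub_le (Per.K ℝ g) g
    have h4 := mul_nonneg ha.le (norm_nonneg g)
    have h5 := mul_nonneg hb.le (norm_nonneg g)
    have h6 := norm_nonneg g
    exact ⟨by linarith, by linarith, by linarith⟩
  refine ⟨Real.sqrt (6 * π) * B, by positivity, fun g => ?_⟩
  have h0 : ∀ f : Per ℂ, ‖f‖ ≤ B * ‖g‖ →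
      ∫ x in (-π)..π, ‖f.fn x‖ ^ 2 ≤ 2 * π * (B * ‖g‖) ^ 2 := fun f hf =>
    (integral_norm_sq_le f).trans (mul_le_mul_of_nonneg_left
      (pow_le_pow_left₀ (norm_nonneg f) hf 2) (by positivity))
  have h1 := h0 _ (hB g).1
  have h2 := h0 _ (hB g).2.1
  have h3 := h0 _ (hB g).2.2
  rw [H2norm, Per.deriv_deriv_K, Per.deriv_K, mul_assoc]
  refine Real.sqrt_le_iff.2 ⟨by positivity, ?_⟩
  rw [mul_pow, Real.sq_sqrt (by positivity)]
  linarith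

/-- The Sobolev inequality in one dimension. -/
lemma norm_le_of_integral_norm_sq_le {f f' : Per ℂ} (hf : ∀ x, HasDerivAt f.fn (f'.fn x) x)
    {N : ℝ} (hN : 0 ≤ N) (h0 : ∫ x in (-π)..π, ‖f.fn x‖ ^ 2 ≤ N ^ 2)
    (h1 : ∫ x in (-π)..π, ‖f'.fn x‖ ^ 2 ≤ N ^ 2) : ‖f‖ ≤ (1 + 2 * π) * N := by
  have hpi := Real.pi_gt_three
  have L1 : ∀ w : Per ℂ, ∫ x in (-π)..π, ‖w.fn x‖ ^ 2 ≤ N ^ 2 →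
      ∫ x in (-π)..π, ‖w.fn x‖ ≤ 2 * π * N := by
    intro w hw
    have cw := w.continuous_fn
    set I := ∫ x in (-π)..π, ‖w.fn x‖ with hI
    have h : 0 ≤ ∫ x in (-π)..π, (‖w.fn x‖ ^ 2 - (I / π) * ‖w.fn x‖ + (I / (2 * π)) ^ 2) :=
      intervalIntegral.integral_nonneg (by linarith) fun x _ => by
        have := sq_nonneg (‖w.fn x‖ - I / (2 * π))
        have e : ‖w.fn x‖ ^ 2 - (I / π) * ‖w.fn x‖ + (I / (2 * π)) ^ 2 =
          (‖w.fn x‖ - I / (2 * π)) ^ 2 := by field_simp; ring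
        rwa [e]
    rw [intervalIntegral.integral_add ((by fun_prop : Continuous _).intervalIntegrable _ _)
      (by simp), intervalIntegral.integral_sub
      ((by fun_prop : Continuous _).intervalIntegrable _ _)
      ((by fun_prop : Continuous _).intervalIntegrable _ _),
      intervalIntegral.integral_const_mul, intervalIntegral.integral_const, ← hI, smul_eq_mul] at h
    have e : (π - -π) * (I / (2 * π)) ^ 2 = I ^ 2 / (2 * π) := by field_simp; ring
    have e' : I / π * I = 2 * (I ^ 2 / (2 * π)) := by field_simp
    rw [e, e'] at h
    have h2 : I ^ 2 / (2 * π) ≤ N ^ 2 := by linarith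
    rw [div_le_iff₀ (by positivity)] at h2
    refine abs_le_of_sq_le_sq' ?_ (by positivity) |>.2
    nlinarith [sq_nonneg N, mul_nonneg (sq_nonneg N) Real.pi_pos.le]
  have c := f.continuous_fn
  have c' := f'.continuous_fn
  have i0 := L1 f h0
  have i1 := L1 f' h1
  have hxy : ∀ x ∈ Icc (-π) π, ∀ y ∈ Icc (-π) π, ‖f.fn x‖ ≤ ‖f.fn y‖ + 2 * π * N := by
    intro x hx y hy
    have e : ∫ t in y..x, f'.fn t = f.fn x - f.fn y :=
      intervalIntegral.integral_eq_sub_of_hasDerivAt (fun t _ => hf t) (c'.intervalIntegrable _ _)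
    have e1 : ‖f.fn x - f.fn y‖ ≤ 2 * π * N := by
      rw [← e]
      refine (intervalIntegral.norm_integral_le_integral_norm_uIoc).trans (le_trans ?_ i1)
      rw [intervalIntegral.integral_of_le (by linarith)]
      refine setIntegral_mono_set ?_ (Eventually.of_forall fun t => norm_nonneg _) ?_
      · exact (c'.norm.integrableOn_Icc (a := -π) (b := π)).mono_set Ioc_subset_Icc_self
      · refine LE.le.eventuallyLE fun t ht => ?_
        rcases mem_uIoc.1 ht with h | h
        · exact ⟨hy.1.trans_lt h.1, h.2.trans hx.2⟩
        · exact ⟨hx.1.trans_lt h.1, h.2.trans hy.2⟩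
    calc ‖f.fn x‖ = ‖f.fn y + (f.fn x - f.fn y)‖ := by rw [add_sub_cancel]
      _ ≤ ‖f.fn y‖ + ‖f.fn x - f.fn y‖ := norm_add_le _ _
      _ ≤ _ := by linarith
  have hx : ∀ x ∈ Icc (-π) π, ‖f.fn x‖ ≤ (1 + 2 * π) * N := by
    intro x hx
    have h := intervalIntegral.integral_mono_on (a := -π) (b := π) (μ := volume)
      (f := fun _ => ‖f.fn x‖) (g := fun y => ‖f.fn y‖ + 2 * π * N) (by linarith)
      (by simp) ((by fun_prop : Continuous _).intervalIntegrable _ _)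
      (fun y hy => hxy x hx y hy)
    rw [intervalIntegral.integral_add (c.norm.intervalIntegrable _ _) (by simp),
      intervalIntegral.integral_const, intervalIntegral.integral_const, smul_eq_mul,
      smul_eq_mul] at h
    have h2 : (2 * π) * ‖f.fn x‖ ≤ (2 * π) * ((1 + 2 * π) * N) := by linarith
    exact le_of_mul_le_mul_left h2 (by positivity)
  refine Per.norm_le_of_fn (by positivity) fun x => ?_
  obtain ⟨n, hn, -⟩ := existsUnique_sub_zsmul_mem_Ioc Real.two_pi_pos x (-π)
  rw [neg_pi_add_two_pi] at hn
  have h2 := hx _ (Ioc_subset_Icc_self hn)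
  rwa [zsmul_eq_mul, f.periodic_fn.sub_int_mul_eq n] at h2

lemma norm_K_D_le (g : Per ℂ) : ‖Per.K ℝ g‖ ≤ (1 + 2 * π) * H2norm (Per.K ℝ g).fn ∧
    ‖Per.D ℝ g‖ ≤ (1 + 2 * π) * H2norm (Per.K ℝ g).fn := by
  have h0 := integral_norm_sq_nonneg (Per.K ℝ g).fn
  have h1 := integral_norm_sq_nonneg (Per.D ℝ g).fn
  have h2 := integral_norm_sq_nonneg (Per.K ℝ g - g).fn
  have hN : 0 ≤ H2norm (Per.K ℝ g).fn := Real.sqrt_nonneg _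
  have hsq : H2norm (Per.K ℝ g).fn ^ 2 = (∫ x in (-π)..π, ‖(Per.K ℝ g).fn x‖ ^ 2) +
      (∫ x in (-π)..π, ‖(Per.D ℝ g).fn x‖ ^ 2) +
      ∫ x in (-π)..π, ‖(Per.K ℝ g - g).fn x‖ ^ 2 := by
    rw [H2norm, Per.deriv_deriv_K, Per.deriv_K, Real.sq_sqrt (by positivity)]
  exact ⟨norm_le_of_integral_norm_sq_le (Per.hasDerivAt_K ℝ g) hN (by linarith) (by linarith),
    norm_le_of_integral_norm_sq_le (Per.hasDerivAt_D ℝ g) hN (by linarith) (by linarith)⟩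

lemma K_fn_sub (f g : Per ℂ) :
    (Per.K ℝ f).fn - (Per.K ℝ g).fn = (Per.K ℝ (f - g)).fn := by
  rw [map_sub]
  rfl

/-! ### Pairings -/

lemma pairingI_eq_pairR (W : Per ℝ) (f φ : Per ℂ) :
    pairingI W.fn f.fn φ.fn = pairR φ (Per.ofReal W * f) := by
  rw [pairR_apply, innerL_apply, pairingI]
  congr 1
  refine intervalIntegral.integral_congr fun x _ => ?_
  simp only [Per.smul_fn, Per.mul_fn, Per.ofReal_fn, smul_eq_mul]
  ring

lemma pairingJ_eq_pairR (W : Per ℝ) (f φ : Per ℂ) :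
    pairingJ W.fn f.fn φ.fn = pairR φ (Per.ofReal W * f) := by
  rw [pairR_eq_integral, pairingJ]
  refine intervalIntegral.integral_congr fun x _ => ?_
  simp [toVec, matJ, dotProduct, Matrix.mulVec, Fin.sum_univ_two]
  ring

lemma hasDerivAt_pairR_translate {W W' : Per ℝ} (hW : ∀ x, HasDerivAt W.fn (W'.fn x) x)
    (f φ : Per ℂ) (σ : ℝ) :
    HasDerivAt (fun σ => pairR φ (Per.ofReal (Per.translate σ W) * f))
      (pairR φ (Per.ofReal (Per.translate σ W') * f)) σ := by
  have h1 := Per.hasDerivAt_translate (fun x => hW x) σ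
  have h2 := Per.ofReal.hasFDerivAt.comp_hasDerivAt σ h1
  exact (pairR φ).hasFDerivAt.comp_hasDerivAt σ (h2.mul_const f)

section Main

variable {d f₀ ζ μ : ℝ} {g₀ p φ : Per ℂ} {V V' : Per ℝ}

lemma BasePoint.of_isNondegenerate (hd : d ≠ 0) (hp : opL d ζ μ (Per.K ℝ g₀) p = 0)
    (hpg : Per.K ℝ p = Per.D ℝ g₀) (hnd : IsNondegenerate d ζ μ (Per.K ℝ g₀).fn)
    (hφ : MemAdjointKernel d ζ μ (Per.K ℝ g₀).fn φ.fn) (hnorm : pairR φ (Per.K ℝ p) = 1) :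
    BasePoint d ζ μ (Per.K ℝ g₀) p φ where
  d_ne := hd
  opL_p := hp
  ker g hg := by
    have hmem : (Per.K ℝ g).fn ∈ {ψ : ℝ → ℂ | MemH2per ψ ∧
        complexLinearization d ζ μ (Per.K ℝ g₀).fn ψ =ᵐ[periodMeasure] 0} := by
      refine ⟨memH2per_K ℝ g, Eventually.of_forall fun x => ?_⟩
      rw [← opL_fn_eq_complexLinearization, hg]
      rfl
    rw [hnd.2] at hmem
    obtain ⟨c, hc⟩ := hmem
    refine ⟨c, Per.K_injective ℝ (Per.fn_injective ?_)⟩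
    rw [hc, Per.deriv_K, map_smul, hpg]
    rfl
  adj g := by
    rw [innerL_apply, opL_fn_eq_complexLinearization]
    exact hφ.2 _ (memH2per_K ℝ g)
  norm_eq := hnorm

/-- Translates of solutions are solutions for the translated potential. -/
lemma stationaryExpr_translate {ε s : ℝ} {g : Per ℂ}
    (h : ∀ x, stationaryExpr d f₀ ζ μ ε (V.fn x) ((Per.K ℝ g).fn x) ((Per.D ℝ g).fn x)
      ((Per.K ℝ g - g).fn x) = 0) (x : ℝ) :
    stationaryExpr d f₀ ζ μ ε (V.fn (x + s)) ((Per.K ℝ (Per.translate s g)).fn x)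
      ((Per.D ℝ (Per.translate s g)).fn x)
      ((Per.K ℝ (Per.translate s g) - Per.translate s g).fn x) = 0 := by
  rw [Per.sub_fn, (Per.K_D_translate ℝ s g).1, (Per.K_D_translate ℝ s g).2]
  simp only [Per.translate_fn]
  exact h (x + s)

lemma norm_translate_branch_sub_le {h : Per ℂ}
    (hp' : Per.D ℝ p = Per.K ℝ g₀ - g₀) {σ s ε C : ℝ} (hs : |s| ≤ C * |ε|) (hh : ‖h‖ ≤ C) :
    ‖Per.translate (-(σ + s)) (g₀ + ε • h) - Per.translate (-σ) g₀‖ ≤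
      ((‖Per.D ℝ g₀‖ + ‖Per.K ℝ p - p‖) * C + C) * |ε| := by
  have hLip : ∀ x y, ‖g₀.fn x - g₀.fn y‖ ≤ (‖Per.D ℝ g₀‖ + ‖Per.K ℝ p - p‖) * |x - y| := by
    intro x y
    have e : g₀ = Per.K ℝ g₀ - Per.D ℝ p := by rw [hp', sub_sub_cancel]
    have e' : g₀.fn x - g₀.fn y = ((Per.K ℝ g₀).fn x - (Per.K ℝ g₀).fn y) -
        ((Per.D ℝ p).fn x - (Per.D ℝ p).fn y) := by
      conv_lhs => rw [e]
      simp only [Per.sub_fn]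
      ring
    rw [e', add_mul]
    exact (norm_sub_le _ _).trans (add_le_add (Per.lipschitz_K ℝ g₀ x y) (Per.lipschitz_D ℝ p x y))
  have e : Per.translate (-(σ + s)) (g₀ + ε • h) - Per.translate (-σ) g₀ =
      (Per.translate (-(σ + s)) g₀ - Per.translate (-σ) g₀) +
        ε • Per.translate (-(σ + s)) h := Per.ext_fn fun x => by
    simp only [Per.sub_fn, Per.add_fn, Per.smul_fn, Per.translate_fn]
    ring
  have h1 := Per.norm_translate_sub_le (s := -(σ + s)) (t := -σ) (f := g₀) (by positivity) hLip
  have h2 : |-(σ + s) - -σ| ≤ C * |ε| := by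
    rw [show -(σ + s) - -σ = -s by ring, abs_neg]
    exact hs
  have h3 : ‖ε • Per.translate (-(σ + s)) h‖ ≤ |ε| * C := by
    rw [norm_smul, Real.norm_eq_abs]
    exact mul_le_mul_of_nonneg_left ((Per.norm_translate_le _ h).trans hh) (abs_nonneg _)
  rw [e]
  refine (norm_add_le _ _).trans ?_
  have h4 := h1.trans (mul_le_mul_of_nonneg_left h2
    (by positivity : 0 ≤ ‖Per.D ℝ g₀‖ + ‖Per.K ℝ p - p‖))
  linarith

theorem BasePoint.exists_isSolutionBranch {m σ : ℝ} (hb : BasePoint d ζ μ (Per.K ℝ g₀) p φ)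
    (hp : Per.K ℝ p = Per.D ℝ g₀) (hp' : Per.D ℝ p = Per.K ℝ g₀ - g₀)
    (hV : ∀ x, HasDerivAt V.fn (V'.fn x) x)
    (hg₀ : ∀ x, stationaryExpr d f₀ ζ μ 0 ((Per.translate σ V).fn x) ((Per.K ℝ g₀).fn x)
      ((Per.D ℝ g₀).fn x) ((Per.K ℝ g₀ - g₀).fn x) = 0)
    (hzero : pairR φ (Per.ofReal (Per.translate σ V) * Per.K ℝ p) = 0)
    (hm : pairR φ (Per.ofReal (Per.translate σ V') * Per.K ℝ p) = m) (hm0 : m ≠ 0) :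
    ∃ r : ℝ, 0 < r ∧ ∃ u : ℝ → ℝ → ℂ,
      IsSolutionBranch d f₀ ζ μ V.fn (fun x => (Per.K ℝ g₀).fn (x - σ)) r u ∧
      ∃ C : ℝ, ∀ ε ∈ Ioo (-r) r,
        H2norm (u ε - fun x => (Per.K ℝ g₀).fn (x - σ)) ≤ C * |ε| := by
  have hVs := Per.hasDerivAt_translate_fn hV σ
  obtain ⟨r, hr, h, s, C, hs0, hbr⟩ := hb.exists_branch hp hVs hg₀ hzero hm hm0
  obtain ⟨B, hB0, hB⟩ := exists_H2norm_K_le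
  set G : ℝ → Per ℂ := fun ε => Per.translate (-(σ + s ε)) (g₀ + ε • h ε) with hG
  have hw : (fun x => (Per.K ℝ g₀).fn (x - σ)) = (Per.K ℝ (Per.translate (-σ) g₀)).fn := by
    funext x
    rw [(Per.K_D_translate ℝ (-σ) g₀).1, Per.translate_fn, sub_eq_add_neg]
  have hG0 : G 0 = Per.translate (-σ) g₀ := by simp [hG, hs0]
  refine ⟨r, hr, fun ε => (Per.K ℝ (G ε)).fn, ⟨?_, fun ε hε => ?_, fun ε hε => ?_⟩,
    B * ((‖Per.D ℝ g₀‖ + ‖Per.K ℝ p - p‖) * C + C), fun ε hε => ?_⟩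
  · simp only [hG0, hw]
  · refine isStationarySolution_K fun x => ?_
    have h1 : ∀ x, stationaryExpr d f₀ ζ μ ε ((Per.translate (σ + s ε) V).fn x)
        ((Per.K ℝ (g₀ + ε • h ε)).fn x) ((Per.D ℝ (g₀ + ε • h ε)).fn x)
        ((Per.K ℝ (g₀ + ε • h ε) - (g₀ + ε • h ε)).fn x) = 0 := fun x => by
      have := (hbr ε hε).2.2.2.2 x
      rw [Per.translate_fn] at this ⊢
      rwa [show x + (σ + s ε) = x + s ε + σ by ring]
    have h2 := stationaryExpr_translate (s := -(σ + s ε)) h1 x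
    rwa [Per.translate_fn, neg_add_cancel_right] at h2
  · have hc : ContinuousAt G ε := by
      have h1 : ContinuousAt (fun ε => (-(σ + s ε), g₀ + ε • h ε)) ε :=
        ((continuousAt_const.add (hbr ε hε).2.1).neg).prodMk
          (continuousAt_const.add (continuousAt_id.smul (hbr ε hε).1))
      exact Per.continuous_translate.continuousAt.comp h1
    have h1 : Tendsto (fun ε' => B * ‖G ε' - G ε‖) (𝓝 ε) (𝓝 0) := by
      have := (tendsto_iff_norm_sub_tendsto_zero.1 hc.tendsto).const_mul B
      rwa [mul_zero] at this
    refine squeeze_zero (fun _ => Real.sqrt_nonneg _) (fun ε' => ?_) h1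
    rw [K_fn_sub]
    exact hB _
  · rw [hw, K_fn_sub, mul_assoc]
    exact (hB _).trans (mul_le_mul_of_nonneg_left
      (norm_translate_branch_sub_le hp' (hbr ε hε).2.2.1 (hbr ε hε).2.2.2.1) hB0)

theorem BasePoint.spectral_stability_of_isSolutionBranch {m σ : ℝ}
    (hb : BasePoint d ζ μ (Per.K ℝ g₀) p φ) (hp : Per.K ℝ p = Per.D ℝ g₀)
    (hV : ∀ x, HasDerivAt V.fn (V'.fn x) x)
    (hA2 : AssumptionA2 (linearization d ζ μ 0 V.fn (Per.K ℝ g₀).fn))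
    (hm : pairR φ (Per.ofReal (Per.translate σ V') * Per.K ℝ p) = m) (hm0 : m ≠ 0)
    {r : ℝ} (hr : 0 < r) {u : ℝ → ℝ → ℂ}
    (hu : IsSolutionBranch d f₀ ζ μ V.fn (fun x => (Per.K ℝ g₀).fn (x - σ)) r u) :
    ∃ ε₀ : ℝ, 0 < ε₀ ∧ ε₀ ≤ r ∧ ∀ ε ∈ Ioo (-ε₀) ε₀,
      (0 < m * ε → IsSpectrallyStable (linearization d ζ μ ε V.fn (u ε))) ∧
      (m * ε < 0 → IsSpectrallyUnstable (linearization d ζ μ ε V.fn (u ε))) := by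
  have hVs := Per.hasDerivAt_translate_fn hV σ
  obtain ⟨hu0, husol, hucont⟩ := hu
  have hex : ∀ ε, ∃ g : Per ℂ, ε ∈ Ioo (-r) r → u ε = (Per.K ℝ g).fn ∧
      ∀ x, stationaryExpr d f₀ ζ μ ε (V.fn x) ((Per.K ℝ g).fn x) ((Per.D ℝ g).fn x)
        ((Per.K ℝ g - g).fn x) = 0 := fun ε => by
    by_cases hε : ε ∈ Ioo (-r) r
    · obtain ⟨g, hg⟩ := (husol ε hε).exists_eq_K hb.d_ne V.continuous_fn V.periodic_fn
      exact ⟨g, fun _ => hg⟩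
    · exact ⟨0, fun h => absurd h hε⟩
  choose G hG using hex
  have h0 : (0 : ℝ) ∈ Ioo (-r) r := ⟨by linarith, hr⟩
  have hnhds : ∀ᶠ ε in 𝓝 (0 : ℝ), ε ∈ Ioo (-r) r := isOpen_Ioo.mem_nhds h0
  have hG0 : Per.translate σ (G 0) = g₀ := by
    refine Per.K_injective ℝ (Per.ext_fn fun x => ?_)
    rw [(Per.K_D_translate ℝ σ _).1, Per.translate_fn, ← (hG 0 h0).1, hu0]
    simp only [add_sub_cancel_right]
  have hlim : Tendsto (fun ε => (1 + 2 * π) * H2norm (u ε - u 0)) (𝓝 0) (𝓝 0) := by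
    have := (hucont 0 h0).const_mul (1 + 2 * π)
    rwa [mul_zero] at this
  have hbound : ∀ᶠ ε in 𝓝 (0 : ℝ), (1 + 2 * π) * H2norm (u ε - u 0) =
      (1 + 2 * π) * H2norm (Per.K ℝ (G ε - G 0)).fn := by
    filter_upwards [hnhds] with ε hε
    rw [(hG ε hε).1, (hG 0 h0).1, K_fn_sub]
  have hK : Tendsto (fun ε => Per.K ℝ (G ε)) (𝓝 0) (𝓝 (Per.K ℝ (G 0))) := by
    refine tendsto_iff_norm_sub_tendsto_zero.2 (squeeze_zero' (Eventually.of_forall fun _ =>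
      norm_nonneg _) ?_ hlim)
    filter_upwards [hbound] with ε hε
    rw [hε, ← map_sub]
    exact (norm_K_D_le _).1
  have hD : Tendsto (fun ε => Per.D ℝ (G ε)) (𝓝 0) (𝓝 (Per.D ℝ (G 0))) := by
    refine tendsto_iff_norm_sub_tendsto_zero.2 (squeeze_zero' (Eventually.of_forall fun _ =>
      norm_nonneg _) ?_ hlim)
    filter_upwards [hbound] with ε hε
    rw [hε, ← map_sub]
    exact (norm_K_D_le _).2
  have htr : Continuous (Per.translate σ : Per ℂ → Per ℂ) :=
    Per.continuous_translate.comp (Continuous.prodMk_right σ)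
  have hstab := hb.eventually_stability (f₀ := f₀) (V := Per.translate σ V) (hb.mu_pos hA2) hVs
    (fun z hz hz0 g hg => eq_zero_of_opS_eq hA2 hz hz0 (by rwa [opS_zero_eq d ζ μ V]))
    hm hm0 (G := fun ε => Per.translate σ (G ε)) (by
      filter_upwards [hnhds] with ε hε x
      rw [Per.translate_fn]
      exact stationaryExpr_translate (hG ε hε).2 x)
    (by
      have h1 := (htr.tendsto _).comp hK
      simp only [Function.comp_def, ← (Per.K_D_translate ℝ σ _).1] at h1
      rwa [hG0] at h1)
    (by
      have h1 := (htr.tendsto _).comp hD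
      simp only [Function.comp_def, ← (Per.K_D_translate ℝ σ _).2] at h1
      rwa [hG0, ← hp] at h1)
  obtain ⟨ρ, hρ, hball⟩ := Metric.eventually_nhds_iff.1 hstab
  refine ⟨min ρ r, lt_min hρ hr, min_le_right _ _, fun ε hε => ?_⟩
  have hεr : ε ∈ Ioo (-r) r :=
    ⟨(neg_le_neg (min_le_right _ _)).trans_lt hε.1, hε.2.trans_le (min_le_right _ _)⟩
  have hερ : dist ε 0 < ρ := by
    rw [Real.dist_eq, sub_zero, abs_lt]
    exact ⟨(neg_le_neg (min_le_left _ _)).trans_lt hε.1, hε.2.trans_le (min_le_left _ _)⟩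
  obtain ⟨hs, hi⟩ := hball hερ
  simp only [(Per.K_D_translate ℝ σ _).1] at hs hi
  rw [(hG ε hεr).1]
  refine ⟨fun h z hz => ?_, fun h => ?_⟩
  · obtain ⟨g, hg, hgz⟩ := (exists_opS_translate_iff d ζ μ σ V _ ε z).2
      (hz.exists_opS hb.d_ne)
    exact hs h z g hg hgz
  · obtain ⟨z, g, hg, hgz, hre⟩ := hi h
    obtain ⟨g', hg', hgz'⟩ := (exists_opS_translate_iff d ζ μ σ V _ ε z).1 ⟨g, hg, hgz⟩
    exact ⟨z, isEigenvalue_of_opS hg' hgz', hre⟩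

end Main

end LLE

end

theorem mainTheorem2 (d f₀ ζ μ : ℝ) (hd : d ≠ 0)
    (V : ℝ → ℝ) (hA1 : LLE.AssumptionA1 V)
    (u₀ : ℝ → ℂ) (hu₀ : LLE.IsStationarySolution d f₀ ζ μ 0 V u₀)
    (hnd : LLE.IsNondegenerate d ζ μ u₀)
    (hA2 : LLE.AssumptionA2 (LLE.linearization d ζ μ 0 V u₀))
    (φ : ℝ → ℂ) (hφ : LLE.MemAdjointKernel d ζ μ u₀ φ)
    (hnorm : LLE.pairingJ 1 (deriv u₀) φ = 1)
    (σ₀ : ℝ) (hzero : LLE.Veff V u₀ φ σ₀ = 0) (hsimple : deriv (LLE.Veff V u₀ φ) σ₀ ≠ 0) :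
    -- the formula for the derivative of the effective potential
    HasDerivAt (LLE.Veff V u₀ φ)
        (LLE.pairingI (fun x => deriv V (x + σ₀)) (deriv u₀) φ) σ₀ ∧
      LLE.pairingI (fun x => deriv V (x + σ₀)) (deriv u₀) φ
        = LLE.pairingJ (fun x => deriv V (x + σ₀)) (deriv u₀) φ ∧
      LLE.pairingJ (fun x => deriv V (x + σ₀)) (deriv u₀) φ ≠ 0 ∧
    -- the solution branch through the translate of `u₀` exists
      (∃ r : ℝ, 0 < r ∧ ∃ u : ℝ → ℝ → ℂ,
        LLE.IsSolutionBranch d f₀ ζ μ V (fun x => u₀ (x - σ₀)) r u ∧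
        ∃ C : ℝ, ∀ ε ∈ Set.Ioo (-r) r,
          LLE.H2norm (u ε - fun x => u₀ (x - σ₀)) ≤ C * |ε|) ∧
    -- stability and instability along every such branch
      ∀ (r : ℝ) (u : ℝ → ℝ → ℂ), 0 < r →
        LLE.IsSolutionBranch d f₀ ζ μ V (fun x => u₀ (x - σ₀)) r u →
        ∃ ε₀ : ℝ, 0 < ε₀ ∧ ε₀ ≤ r ∧ ∀ ε ∈ Set.Ioo (-ε₀) ε₀,
          (0 < deriv (LLE.Veff V u₀ φ) σ₀ * ε →
            LLE.IsSpectrallyStable (LLE.linearization d ζ μ ε V (u ε))) ∧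
          (deriv (LLE.Veff V u₀ φ) σ₀ * ε < 0 →
            LLE.IsSpectrallyUnstable (LLE.linearization d ζ μ ε V (u ε))) := by
  obtain ⟨W, rfl⟩ : ∃ W : LLE.Per ℝ, W.fn = V :=
    ⟨LLE.Per.of V hA1.2.continuous hA1.1, LLE.Per.of_fn _ _ _⟩
  obtain ⟨W', hW'⟩ : ∃ W' : LLE.Per ℝ, W'.fn = deriv W.fn :=
    ⟨LLE.Per.of _ (hA1.2.continuous_deriv (by norm_num))
      (LLE.periodic_deriv_of_periodic hA1.1), LLE.Per.of_fn _ _ _⟩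
  have hW : ∀ x, HasDerivAt W.fn (W'.fn x) x := fun x => by
    rw [hW']
    exact (hA1.2.differentiable (by norm_num) x).hasDerivAt
  obtain ⟨Φ, rfl⟩ : ∃ Φ : LLE.Per ℂ, Φ.fn = φ :=
    ⟨LLE.Per.of φ hφ.1.continuous hφ.1.1, LLE.Per.of_fn _ _ _⟩
  obtain ⟨g₀, rfl, hg₀⟩ := hu₀.exists_eq_K hd W.continuous_fn W.periodic_fn
  obtain ⟨p, hp, hp', hpL⟩ := LLE.exists_deriv_solution hd hW hg₀
  have hpL0 : LLE.opL d ζ μ (LLE.Per.K ℝ g₀) p = 0 := LLE.Per.ext_fn fun x => by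
    rw [hpL]
    simp
  have hw : deriv (LLE.Per.K ℝ g₀).fn = (LLE.Per.K ℝ p).fn := by rw [LLE.Per.deriv_K, hp]
  have htW : ∀ σ, (fun x => W.fn (x + σ)) = (LLE.Per.translate σ W).fn := fun σ =>
    (funext (LLE.Per.translate_fn σ W)).symm
  have htW' : (fun x => deriv W.fn (x + σ₀)) = (LLE.Per.translate σ₀ W').fn := by
    rw [← hW']
    exact (funext (LLE.Per.translate_fn σ₀ W')).symm
  have hVeff : LLE.Veff W.fn (LLE.Per.K ℝ g₀).fn Φ.fn = fun σ =>
      LLE.pairR Φ (LLE.Per.ofReal (LLE.Per.translate σ W) * LLE.Per.K ℝ p) := funext fun σ => by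
    rw [LLE.Veff, hw, htW, LLE.pairingI_eq_pairR]
  have hder := LLE.hasDerivAt_pairR_translate hW (LLE.Per.K ℝ p) Φ σ₀
  rw [hw] at hnorm
  rw [hVeff] at hzero hsimple ⊢
  rw [hder.deriv] at hsimple ⊢
  rw [hw, htW', LLE.pairingI_eq_pairR, LLE.pairingJ_eq_pairR]
  have hb : LLE.BasePoint d ζ μ (LLE.Per.K ℝ g₀) p Φ := by
    refine LLE.BasePoint.of_isNondegenerate hd hpL0 hp hnd hφ ?_
    have h1 : LLE.Per.ofReal (1 : LLE.Per ℝ) * LLE.Per.K ℝ p = LLE.Per.K ℝ p :=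
      LLE.Per.ext_fn fun x => by
        change ((1 : ℝ) : ℂ) * (LLE.Per.K ℝ p).fn x = _
        rw [Complex.ofReal_one, one_mul]
    rw [← h1, ← LLE.pairingJ_eq_pairR]
    exact hnorm
  refine ⟨hder, rfl, hsimple, ?_, fun r u hr hu => ?_⟩
  · exact hb.exists_isSolutionBranch hp hp' hW
      (fun x => by simpa [LLE.stationaryExpr] using hg₀ x) hzero rfl hsimple
  · exact hb.spectral_stability_of_isSolutionBranch hp hW hA2 rfl hsimple hr hu
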